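/- **Setting.** Let $G$ be a Lie group with Lie algebra $\mathfrak g$ and a basis $(e_a)$ of $\mathfrak g$. Let $\pi: X\to S$ be a smooth fibre bundle with compact fibres of even dimension $n$, with a smooth horizontal distribution $H\subset TX$ (so $d\pi: H_x\to T_{\pi(x)}S$ is an isomorphism) and a smooth metric $g^{X/S}$ on the vertical bundle $T(X/S)=\ker d\pi$. Let $G$ act smoothly on $X$ and $S$ such that $\pi$ is equivariant and $H$, $g^{X/S}$ are preserved. Let $P: TX\to T(X/S)$ be the projection with kernel $H$, let $T(\eta,\zeta)=-P[\eta,\zeta]$ for sections $\eta,\zeta$ of $H$ be the Frobenius tensor (extended by $0$ to vertical vectors), and let $\nu^{X/S}\in\Omega^n_X$ be the vertical Riemannian volume form for an orientation of $T(X/S)$, extended by $0$ along $H$; suppose that it is $G$-invariant. The mean curvature form is the $1$-form $k\in\Omega^1_X$ vanishing on vertical vectors that is characterized by $$d\nu^{X/S}=k\wedge\nu^{X/S}+\sum_{i=1}^n\langle T,e_i\rangle\wedge\iota_{e_i}\nu^{X/S},$$ $(e_i)$ being an orthonormal basis of $T(X/S)$. Let $Q\to M$ be a principal $G$-bundle with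 connection form $\Phi=\phi^a e_a\in\Omega^1_Q(\mathfrak g)$ and $V=\ker\Phi$. For a $G$-manifold $Y$ put $Y_Q=Q\times_G Y=(Q\times Y)/G$, the quotient by $(q,y)\cdot g=(qg,g^{-1}y)$, with quotient map $q_Y: Q\times Y\to Y_Q$. Let $\iota_a$ be the contraction with the vector field on $Q\times Y$ generated by $e_a$ through this action. Let $\pi_Q: X_Q\to S_Q$ be the family induced by $\pi$, with horizontal distribution $H_Q=(q_X)_*(V\oplus H)$ and with the vertical metric $g_Q^{X/S}$ to which the pullback of $g^{X/S}$ to $Q\times X$ descends, and let $k_Q$ be its mean curvature form (defined as above from $\pi_Q,H_Q,g_Q^{X/S}$ and a vertical volume form of $X_Q\to S_Q$). **Proposition.** On $Q\times X$ one has $$q_X^*k_Q=k-\phi^a\iota_a k ,$$ where $k$ and $\phi^a$ are pulled back to $Q\times X$. Consequently, when a $1$-form on the total space of a family that vanishes on vertical vectors is regarded, through horizontal lifts, as a $1$-form on the base with values in the functions on the fibres, one has $$k_Q=k-\phi^a\iota_a k$$ as $1$-forms on $Q\times S$ with values in the functions on the fibres of $\pi$ (with $k_Q$ pulled back along $q_S$),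 and this form is basic, i.e. annihilated by all $\iota_a$ and $G$-invariant. -/

import Mathlib

open scoped Manifold ContDiff Topology
open MulOpposite

namespace Families

/-- The equivalence relation `(q, y) ~ (q g, g⁻¹ y)` on `Q × Y`, for a right action of `G` on `Q`
and a left action of `G` on `Y`. -/
def assocSetoid (G Q Y : Type*) [Group G] [MulAction Gᵐᵒᵖ Q] [MulAction G Y] : Setoid (Q × Y) where
  r z w := ∃ g : G, w = (op g • z.1, g⁻¹ • z.2)
  iseqv := by
    refine ⟨fun z => ⟨1, by simp⟩, ?_, ?_⟩
    · rintro z _ ⟨g, rfl⟩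
      exact ⟨g⁻¹, by simp [smul_smul]⟩
    · rintro z _ _ ⟨g, rfl⟩ ⟨h, rfl⟩
      exact ⟨g * h, by simp [smul_smul]⟩

section Principal

variable (EG EQ EM : Type*) (G : Type*) {Q M : Type*}
    [NormedAddCommGroup EG] [NormedSpace ℝ EG] [NormedAddCommGroup EQ] [NormedSpace ℝ EQ]
    [NormedAddCommGroup EM] [NormedSpace ℝ EM]
    [Group G] [TopologicalSpace G] [ChartedSpace EG G]
    [TopologicalSpace Q] [ChartedSpace EQ Q] [TopologicalSpace M] [ChartedSpace EM M]
    [MulAction Gᵐᵒᵖ Q]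

/-- An equivariant local trivialization of `proj : Q → M` over the open set `base`: the
diffeomorphism `q ↦ (proj q, fib q)` of `proj⁻¹(base)` onto `base × G`, whose inverse is
`(m, g) ↦ sec m · g`. -/
structure LocalTriv (proj : Q → M) where
  base : Set M
  fib : Q → G
  sec : M → Q
  isOpen_base : IsOpen base
  smooth_fib : ContMDiffOn 𝓘(ℝ, EQ) 𝓘(ℝ, EG) ∞ fib (proj ⁻¹' base)
  smooth_sec : ContMDiffOn 𝓘(ℝ, EM) 𝓘(ℝ, EQ) ∞ sec base
  right_inv : ∀ m ∈ base, ∀ g : G, proj (op g • sec m) = m ∧ fib (op g • sec m) = g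
  left_inv : ∀ q ∈ proj ⁻¹' base, op (fib q) • sec (proj q) = q

variable (Q M)

/-- A smooth principal `G`-bundle `proj : Q → M`, with its right action of `G` on `Q`. -/
structure PrincipalBundle where
  proj : Q → M
  contMDiff_proj : ContMDiff 𝓘(ℝ, EQ) 𝓘(ℝ, EM) ∞ proj
  contMDiff_act : ContMDiff (𝓘(ℝ, EQ).prod 𝓘(ℝ, EG)) 𝓘(ℝ, EQ) ∞
    (fun p : Q × G => op p.2 • p.1)
  proj_act : ∀ (g : G) (q : Q), proj (op g • q) = proj q
  locally_trivial : ∀ m : M, ∃ t : LocalTriv EG EQ EM G proj, m ∈ t.base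

end Principal

namespace PrincipalBundle

variable {EG EQ EM G Q M : Type*}
    [NormedAddCommGroup EG] [NormedSpace ℝ EG] [NormedAddCommGroup EQ] [NormedSpace ℝ EQ]
    [NormedAddCommGroup EM] [NormedSpace ℝ EM]
    [Group G] [TopologicalSpace G] [ChartedSpace EG G]
    [TopologicalSpace Q] [ChartedSpace EQ Q] [TopologicalSpace M] [ChartedSpace EM M]
    [MulAction Gᵐᵒᵖ Q]

/-- The total space of the associated bundle `Y_Q = Q ×_G Y`. -/
@[nolint unusedArguments]
def Assoc (_P : PrincipalBundle EG EQ EM G Q M) (Y : Type*) [MulAction G Y] : Type _ :=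
  Quotient (assocSetoid G Q Y)

variable (P : PrincipalBundle EG EQ EM G Q M)

section Set

variable {Y : Type*} [MulAction G Y]

/-- The quotient map `Q × Y → Y_Q`. -/
def assocMk (z : Q × Y) : P.Assoc Y := Quotient.mk (assocSetoid G Q Y) z

/-- A representative in `Q × Y` of a point of `Y_Q`. -/
noncomputable def assocOut (y : P.Assoc Y) : Q × Y := Quotient.out (s := assocSetoid G Q Y) y

theorem assocMk_out (y : P.Assoc Y) : P.assocMk (P.assocOut y) = y :=
  Quotient.out_eq (s := assocSetoid G Q Y) y

theorem assocMk_surjective : Function.Surjective (P.assocMk (Y := Y)) :=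
  fun y => ⟨_, P.assocMk_out y⟩

theorem assocMk_eq {z w : Q × Y} :
    P.assocMk z = P.assocMk w ↔ ∃ g : G, w = (op g • z.1, g⁻¹ • z.2) :=
  Quotient.eq (r := assocSetoid G Q Y)

/-- The bundle projection `Y_Q → M`. -/
def assocBase : P.Assoc Y → M :=
  Quotient.lift (s := assocSetoid G Q Y) (fun z => P.proj z.1) (by
    rintro z _ ⟨g, rfl⟩
    exact (P.proj_act g z.1).symm)

@[simp] theorem assocBase_mk (z : Q × Y) : P.assocBase (P.assocMk z) = P.proj z.1 := rfl

/-- The map `Y_Q → Z_Q` induced by an equivariant map `Y → Z`. -/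
def assocMap {Z : Type*} [MulAction G Z] (f : Y → Z) (hf : ∀ (g : G) (y : Y), f (g • y) = g • f y) :
    P.Assoc Y → P.Assoc Z :=
  Quotient.lift (s := assocSetoid G Q Y) (fun z => P.assocMk (z.1, f z.2)) (by
    rintro z _ ⟨g, rfl⟩
    exact P.assocMk_eq.2 ⟨g, by simp [hf]⟩)

@[simp] theorem assocMap_mk {Z : Type*} [MulAction G Z] (f : Y → Z)
    (hf : ∀ (g : G) (y : Y), f (g • y) = g • f y) (z : Q × Y) :
    P.assocMap f hf (P.assocMk z) = P.assocMk (z.1, f z.2) := rfl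

end Set

variable {P} in
theorem fib_act (t : LocalTriv EG EQ EM G P.proj) {q : Q} (hq : P.proj q ∈ t.base) (g : G) :
    t.fib (op g • q) = t.fib q * g := by
  have h := t.left_inv q hq
  conv_lhs => rw [← h, smul_smul, ← op_mul]
  exact (t.right_inv _ hq _).2

variable {P} in
theorem fib_sec (t : LocalTriv EG EQ EM G P.proj) {m : M} (hm : m ∈ t.base) :
    t.fib (t.sec m) = 1 := by
  simpa using (t.right_inv m hm 1).2

variable {P} in
theorem proj_sec (t : LocalTriv EG EQ EM G P.proj) {m : M} (hm : m ∈ t.base) :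
    P.proj (t.sec m) = m := by
  simpa using (t.right_inv m hm 1).1

instance {Y : Type*} [MulAction G Y] [TopologicalSpace Y] : TopologicalSpace (P.Assoc Y) :=
  inferInstanceAs (TopologicalSpace (Quotient (assocSetoid G Q Y)))

section Top

variable {Y : Type*} [MulAction G Y] [TopologicalSpace Y]

theorem isQuotientMap_assocMk : Topology.IsQuotientMap (P.assocMk (Y := Y)) :=
  isQuotientMap_quot_mk

theorem continuous_assocBase : Continuous (P.assocBase (Y := Y)) :=
  P.isQuotientMap_assocMk.continuous_iff.2 (P.contMDiff_proj.continuous.comp continuous_fst)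

end Top

variable {P}

/-- The map `[q, y] ↦ (proj q, fib q • y)` from `Y_Q` over `t.base` to `M × Y`. -/
noncomputable def assocFun (t : LocalTriv EG EQ EM G P.proj) {Y : Type*} [MulAction G Y]
    (y : P.Assoc Y) : M × Y :=
  (P.proj (P.assocOut y).1, t.fib (P.assocOut y).1 • (P.assocOut y).2)

theorem assocFun_mk (t : LocalTriv EG EQ EM G P.proj) {Y : Type*} [MulAction G Y] (z : Q × Y)
    (hz : P.proj z.1 ∈ t.base) :
    assocFun t (P.assocMk z) = (P.proj z.1, t.fib z.1 • z.2) := by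
  obtain ⟨g, hg⟩ := P.assocMk_eq.1 (P.assocMk_out (P.assocMk z)).symm
  unfold assocFun
  rw [hg]
  simp [P.proj_act, fib_act t hz, smul_smul]

/-- The homeomorphism `Y_Q|_U ≃ U × Y` given by a local trivialization over `U = t.base`. -/
noncomputable def assocHomeo (t : LocalTriv EG EQ EM G P.proj)
    (Y : Type*) [MulAction G Y] [TopologicalSpace Y] [ContinuousSMul G Y] :
    OpenPartialHomeomorph (P.Assoc Y) (M × Y) where
  toFun := assocFun t
  invFun p := P.assocMk (t.sec p.1, p.2)
  source := P.assocBase ⁻¹' t.base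
  target := t.base ×ˢ Set.univ
  map_source' := by
    intro y hy
    obtain ⟨z, rfl⟩ := P.assocMk_surjective y
    rw [assocFun_mk t z hy]
    exact ⟨hy, trivial⟩
  map_target' := by
    rintro ⟨m, y⟩ ⟨hm, -⟩
    simpa [proj_sec t hm] using hm
  left_inv' := by
    intro y hy
    obtain ⟨z, rfl⟩ := P.assocMk_surjective y
    rw [assocFun_mk t z hy]
    refine P.assocMk_eq.2 ⟨t.fib z.1, ?_⟩
    simp [t.left_inv z.1 hy]
  right_inv' := by
    rintro ⟨m, y⟩ ⟨hm, -⟩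
    have hm' : m ∈ t.base := hm
    rw [assocFun_mk t _ (by simpa [proj_sec t hm'] using hm')]
    simp [proj_sec t hm', fib_sec t hm']
  open_source := t.isOpen_base.preimage P.continuous_assocBase
  open_target := t.isOpen_base.prod isOpen_univ
  continuousOn_toFun := by
    refine (P.isQuotientMap_assocMk.continuousOn_isOpen_iff
      (t.isOpen_base.preimage P.continuous_assocBase)).2 ?_
    have h1 : ContinuousOn (fun z : Q × Y => (P.proj z.1, t.fib z.1 • z.2))
        (P.assocMk ⁻¹' (P.assocBase ⁻¹' t.base)) := by
      refine ContinuousOn.prodMk (P.contMDiff_proj.continuous.comp continuous_fst).continuousOn ?_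
      refine ContinuousOn.smul ?_ continuous_snd.continuousOn
      exact t.smooth_fib.continuousOn.comp continuous_fst.continuousOn (fun z hz => hz)
    exact h1.congr (fun z hz => assocFun_mk t z hz)
  continuousOn_invFun := by
    refine P.isQuotientMap_assocMk.continuous.comp_continuousOn ?_
    refine ContinuousOn.prodMk ?_ continuous_snd.continuousOn
    exact t.smooth_sec.continuousOn.comp continuous_fst.continuousOn (fun z hz => hz.1)

/-- `Y_Q` is locally homeomorphic to `M × Y`, through the local trivializations of `Q → M`. -/
@[reducible] noncomputable def assocChartedProd (P : PrincipalBundle EG EQ EM G Q M) (Y : Type*)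
    [MulAction G Y] [TopologicalSpace Y] [ContinuousSMul G Y] :
    ChartedSpace (M × Y) (P.Assoc Y) where
  atlas := Set.range fun t : LocalTriv EG EQ EM G P.proj => assocHomeo t Y
  chartAt y := assocHomeo (P.locally_trivial (P.assocBase y)).choose Y
  mem_chart_source y := (P.locally_trivial (P.assocBase y)).choose_spec
  chart_mem_atlas _ := ⟨_, rfl⟩

/-- The manifold structure of `Y_Q`: its charts are the local trivializations `Y_Q|_U ≃ U × Y`
followed by the product charts of `M × Y`. -/
noncomputable instance assocChartedSpace (P : PrincipalBundle EG EQ EM G Q M) (Y : Type*)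
    [MulAction G Y] [TopologicalSpace Y] [ContinuousSMul G Y] {EY : Type*} [NormedAddCommGroup EY]
    [ChartedSpace EY Y] : ChartedSpace (ModelProd EM EY) (P.Assoc Y) :=
  letI := P.assocChartedProd Y
  ChartedSpace.comp (ModelProd EM EY) (M × Y) (P.Assoc Y)

section Smooth

variable {Y EY : Type*} [MulAction G Y] [TopologicalSpace Y] [ContinuousSMul G Y]
    [NormedAddCommGroup EY] [NormedSpace ℝ EY] [ChartedSpace EY Y]
    [ContMDiffSMul 𝓘(ℝ, EG) 𝓘(ℝ, EY) ∞ G Y]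

theorem smooth_change (t t' : LocalTriv EG EQ EM G P.proj) :
    ContMDiffOn (𝓘(ℝ, EM).prod 𝓘(ℝ, EY)) (𝓘(ℝ, EM).prod 𝓘(ℝ, EY)) ∞
      (assocHomeo t' Y ∘ (assocHomeo t Y).symm) ((t.base ∩ t'.base) ×ˢ Set.univ) := by
  have h : ContMDiffOn (𝓘(ℝ, EM).prod 𝓘(ℝ, EY)) (𝓘(ℝ, EM).prod 𝓘(ℝ, EY)) ∞
      (fun p : M × Y => (p.1, t'.fib (t.sec p.1) • p.2)) ((t.base ∩ t'.base) ×ˢ Set.univ) := by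
    refine contMDiffOn_fst.prodMk ?_
    have h1 : ContMDiffOn (𝓘(ℝ, EM).prod 𝓘(ℝ, EY)) 𝓘(ℝ, EG) ∞
        (fun p : M × Y => t'.fib (t.sec p.1)) ((t.base ∩ t'.base) ×ˢ Set.univ) := by
      refine t'.smooth_fib.comp (t.smooth_sec.comp contMDiffOn_fst fun p hp => hp.1.1) ?_
      intro p hp
      simpa [proj_sec t hp.1.1] using hp.1.2
    exact (contMDiff_smul (I := 𝓘(ℝ, EG)) (I' := 𝓘(ℝ, EY)) (n := ∞)
      (G := G) (M := Y)).comp_contMDiffOn (h1.prodMk contMDiffOn_snd)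
  refine h.congr fun p hp => ?_
  change assocFun t' (P.assocMk (t.sec p.1, p.2)) = _
  rw [assocFun_mk t' _ (by simpa [proj_sec t hp.1.1] using hp.1.2)]
  simp [proj_sec t hp.1.1]

/-- `Y_Q` is a smooth manifold. -/
instance [IsManifold 𝓘(ℝ, EM) ∞ M] [IsManifold 𝓘(ℝ, EY) ∞ Y] :
    IsManifold (𝓘(ℝ, EM).prod 𝓘(ℝ, EY)) ∞ (P.Assoc Y) := by
  refine isManifold_of_contDiffOn _ _ _ ?_
  intro e e' he he'
  obtain ⟨_, ⟨t, rfl⟩, c, hc, rfl⟩ := he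
  obtain ⟨_, ⟨t', rfl⟩, c', hc', rfl⟩ := he'
  rw [← contMDiffOn_iff_contDiffOn]
  have hc1 := contMDiffOn_symm_of_mem_maximalAtlas (I := 𝓘(ℝ, EM).prod 𝓘(ℝ, EY)) (n := ∞)
    (IsManifold.subset_maximalAtlas hc)
  have hc2 := contMDiffOn_of_mem_maximalAtlas (I := 𝓘(ℝ, EM).prod 𝓘(ℝ, EY)) (n := ∞)
    (IsManifold.subset_maximalAtlas hc')
  have h1 := (hc2.comp' ((smooth_change (EY := EY) (Y := Y) t t').comp' hc1)).comp'
    (ModelWithCorners.contMDiffOn_symm (I := 𝓘(ℝ, EM).prod 𝓘(ℝ, EY)) (n := ∞))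
  have h2 := (ModelWithCorners.contMDiff (I := 𝓘(ℝ, EM).prod 𝓘(ℝ, EY)) (n := ∞)).comp_contMDiffOn h1
  refine h2.mono ?_
  rintro x ⟨hx, hxr⟩
  refine ⟨hxr, ?_⟩
  simp only [OpenPartialHomeomorph.symm_source, OpenPartialHomeomorph.trans_source,
    Set.mem_preimage, Set.mem_inter_iff, OpenPartialHomeomorph.trans_symm_eq_symm_trans_symm,
    OpenPartialHomeomorph.coe_trans, Function.comp_apply] at hx ⊢
  obtain ⟨⟨ha, hb⟩, hc, hd⟩ := hx
  have hb' := hb.1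
  have hc' : P.proj (t.sec (c.symm ((𝓘(ℝ, EM).prod 𝓘(ℝ, EY)).symm x)).1) ∈ t'.base := hc
  rw [proj_sec t hb'] at hc'
  exact ⟨⟨ha, ⟨hb', hc'⟩, trivial⟩, hd⟩

end Smooth

end PrincipalBundle
/-! ### Differential forms -/

section Forms

/-- Differential `n`-forms on `X`, not assumed smooth. -/
abbrev Form {E H : Type*} [NormedAddCommGroup E] [NormedSpace ℝ E] [TopologicalSpace H]
    (I : ModelWithCorners ℝ E H) (X : Type*) [TopologicalSpace X] [ChartedSpace H X] (n : ℕ) :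
    Type _ :=
  ∀ x : X, TangentSpace I x [⋀^Fin n]→L[ℝ] ℝ

/-- Differential `1`-forms on `X`, not assumed smooth. -/
abbrev OneForm {E H : Type*} [NormedAddCommGroup E] [NormedSpace ℝ E] [TopologicalSpace H]
    (I : ModelWithCorners ℝ E H) (X : Type*) [TopologicalSpace X] [ChartedSpace H X] : Type _ :=
  ∀ x : X, TangentSpace I x →L[ℝ] ℝ

variable {E H X : Type*} [NormedAddCommGroup E] [NormedSpace ℝ E] [TopologicalSpace H]
    (I : ModelWithCorners ℝ E H) [TopologicalSpace X] [ChartedSpace H X]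

/-- The differential of the inverse of the preferred chart at `x₀`, at the point `y` of the model
space. -/
noncomputable def chartSymmDeriv (x₀ : X) (y : E) :
    E →L[ℝ] TangentSpace I ((extChartAt I x₀).symm y) :=
  mfderivWithin 𝓘(ℝ, E) I (extChartAt I x₀).symm (Set.range I) y

variable {I}

/-- The expression of a form in the preferred chart at `x₀`: its pullback by the inverse chart. -/
noncomputable def Form.inChart {n : ℕ} (η : Form I X n) (x₀ : X) (y : E) : E [⋀^Fin n]→L[ℝ] ℝ :=
  (η ((extChartAt I x₀).symm y)).compContinuousLinearMap (chartSymmDeriv I x₀ y)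

/-- The expression of a `1`-form in the preferred chart at `x₀`. -/
noncomputable def OneForm.inChart (α : OneForm I X) (x₀ : X) (y : E) : E →L[ℝ] ℝ :=
  (α ((extChartAt I x₀).symm y)).comp (chartSymmDeriv I x₀ y)

/-- A form is smooth if its expressions in the charts are smooth. -/
def Form.Smooth {n : ℕ} (η : Form I X n) : Prop :=
  ∀ x₀ : X, ContDiffOn ℝ ∞ (Form.inChart η x₀) (extChartAt I x₀).target

/-- A `1`-form is smooth if its expressions in the charts are smooth. -/
def OneForm.Smooth (α : OneForm I X) : Prop :=
  ∀ x₀ : X, ContDiffOn ℝ ∞ (OneForm.inChart α x₀) (extChartAt I x₀).target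

/-- The exterior derivative of a form, computed in the preferred chart at each point. -/
noncomputable def Form.d {n : ℕ} (η : Form I X n) : Form I X (n + 1) := fun x =>
  (extDerivWithin (Form.inChart η x) (Set.range I)
    (extChartAt I x x)).compContinuousLinearMap (mfderiv I 𝓘(ℝ, E) (extChartAt I x) x)

end Forms

section Wedge

variable {T : Type*} [AddCommGroup T] [Module ℝ T]

/-- The value `(α ∧ η)(v₀, …, vₙ) = ∑ᵢ (-1)ⁱ α(vᵢ) η(v₀, …, v̂ᵢ, …, vₙ)` of the exterior product of
a covector and an `n`-covector. -/
def wedgeOne {n : ℕ} (α : T → ℝ) (η : T [⋀^Fin n]→ₗ[ℝ] ℝ) (v : Fin (n + 1) → T) : ℝ :=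
  ∑ i : Fin (n + 1), (-1) ^ (i : ℕ) * (α (v i) * η (i.removeNth v))

/-- The value `(β ∧ η)(v₀, …, v_{m+1})` of the exterior product of a `2`-covector `β` and an
`m`-covector `η`: the sum over the pairs `a < b` of `(-1)^(a+b+1) β(v_a, v_b) η(…, v̂_a, …, v̂_b, …)`,
written as one half of the sum over all ordered pairs of distinct indices. The first index is `i`,
the second vector is the `j`-th of those left after the removal of `v i`. -/
noncomputable def wedgeTwo {m : ℕ} (β : T → T → ℝ) (η : T [⋀^Fin m]→ₗ[ℝ] ℝ)
    (v : Fin (m + 2) → T) : ℝ :=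
  (1 / 2) * ∑ i : Fin (m + 2), ∑ j : Fin (m + 1),
    (-1) ^ ((i : ℕ) + (j : ℕ)) * (β (v i) (i.removeNth v j) * η (j.removeNth (i.removeNth v)))

/-- The value of `β ∧ ι_e η` for a `2`-covector `β`, a vector `e` and an `n`-covector `η`; here
`ι_e η = η(e, ·)`, which is `0` when `n = 0`. -/
noncomputable def wedgeTwoContract (β : T → T → ℝ) (e : T) :
    {n : ℕ} → (T [⋀^Fin n]→ₗ[ℝ] ℝ) → (Fin (n + 1) → T) → ℝ
  | 0, _, _ => 0
  | _ + 1, η, v => wedgeTwo β (η.curryLeft e) v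

end Wedge

/-! ### Geometric families -/

section Family

/-- The vertical tangent space `T(X/S)_x = ker (dπ_x)`. -/
noncomputable def vertical {E H E' H' X S : Type*} [NormedAddCommGroup E] [NormedSpace ℝ E]
    [TopologicalSpace H] (I : ModelWithCorners ℝ E H) [TopologicalSpace X] [ChartedSpace H X]
    [NormedAddCommGroup E'] [NormedSpace ℝ E'] [TopologicalSpace H'] (J : ModelWithCorners ℝ E' H')
    [TopologicalSpace S] [ChartedSpace H' S] (π : X → S) (x : X) :
    Submodule ℝ (TangentSpace I x) :=
  LinearMap.ker (mfderiv I J π x).toLinearMap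

/-- The data `(π : X → S, H, g^{X/S})` underlying a geometric family: a map, a subspace of each
tangent space of `X`, and a pairing on each vertical tangent space. -/
structure FamilyData {E H E' H' : Type*} [NormedAddCommGroup E] [NormedSpace ℝ E]
    [TopologicalSpace H] (I : ModelWithCorners ℝ E H)
    [NormedAddCommGroup E'] [NormedSpace ℝ E'] [TopologicalSpace H'] (J : ModelWithCorners ℝ E' H')
    (X S : Type*) [TopologicalSpace X] [ChartedSpace H X]
    [TopologicalSpace S] [ChartedSpace H' S] where
  proj : X → S
  hor : ∀ x : X, Submodule ℝ (TangentSpace I x)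
  metric : ∀ x : X, vertical I J proj x → vertical I J proj x → ℝ

namespace FamilyData

variable {E H E' H' X S : Type*} [NormedAddCommGroup E] [NormedSpace ℝ E]
    [TopologicalSpace H] {I : ModelWithCorners ℝ E H} [TopologicalSpace X] [ChartedSpace H X]
    [NormedAddCommGroup E'] [NormedSpace ℝ E'] [TopologicalSpace H'] {J : ModelWithCorners ℝ E' H'}
    [TopologicalSpace S] [ChartedSpace H' S] (D : FamilyData I J X S)

/-- The vertical tangent space `T(X/S)_x`. -/
noncomputable abbrev vert (x : X) : Submodule ℝ (TangentSpace I x) := vertical I J D.proj x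

open Classical in
/-- The projection `P` of `T_x X` onto `T(X/S)_x` with kernel `H_x`. -/
noncomputable def vertProj (x : X) : TangentSpace I x →ₗ[ℝ] D.vert x :=
  if h : IsCompl (D.vert x) (D.hor x) then Submodule.projectionOnto _ _ h else 0

/-- The projection of `T_x X` onto `H_x` with kernel `T(X/S)_x`. -/
noncomputable def horProj (x : X) : TangentSpace I x →ₗ[ℝ] TangentSpace I x :=
  LinearMap.id - (D.vert x).subtype ∘ₗ D.vertProj x

/-- The horizontal lift of a tangent vector of `S` to `H_x`. -/
noncomputable def horLift (x : X) (w : TangentSpace J (D.proj x)) : TangentSpace I x :=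
  (Function.invFun (fun h : D.hor x => mfderiv I J D.proj x (h : TangentSpace I x)) w : D.hor x)

/-- A horizontal vector field with value `horProj u` at `x₀`: the horizontal part of the vector
field that is constant with value `u` in the preferred chart at `x₀`. -/
noncomputable def horExtend (x₀ : X) (u : TangentSpace I x₀) (x : X) : TangentSpace I x :=
  D.horProj x ((mfderiv I 𝓘(ℝ, E) (extChartAt I x₀) x).inverse
    (mfderiv I 𝓘(ℝ, E) (extChartAt I x₀) x₀ u))

/-- The Frobenius tensor `T(η, ζ) = -P[η, ζ]` for horizontal vector fields `η`, `ζ`, extended by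
zero to vertical vectors. Only the values of `η` and `ζ` at the point matter, so that they may be
taken to be the fields `horExtend`. -/
noncomputable def frobenius (x : X) (u v : TangentSpace I x) : D.vert x :=
  -D.vertProj x (VectorField.mlieBracket I (D.horExtend x u) (D.horExtend x v) x)

/-- Orthonormal `n`-tuples of vertical vectors at `x`. -/
def IsOrthonormal {n : ℕ} (x : X) (e : Fin n → D.vert x) : Prop :=
  ∀ i j, D.metric x (e i) (e j) = if i = j then 1 else 0

/-- `ν` is a vertical Riemannian volume form (for one of the orientations of `T(X/S)`), regarded as
an `n`-form on `X` by means of the horizontal distribution. -/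
structure IsVolumeForm {n : ℕ} (ν : Form I X n) : Prop where
  smooth : Form.Smooth ν
  horizontal : ∀ (x : X) (v : Fin n → TangentSpace I x), (∃ i, v i ∈ D.hor x) → ν x v = 0
  orthonormal : ∀ (x : X) (e : Fin n → D.vert x), D.IsOrthonormal x e →
    ν x (fun i => (e i : TangentSpace I x)) = 1 ∨ ν x (fun i => (e i : TangentSpace I x)) = -1

/-- `k` is the mean curvature form: a section of `H^*`, regarded as a `1`-form on `X` which vanishes
on vertical vectors, such that `dν = k ∧ ν + ∑ᵢ ⟨T, eᵢ⟩ ∧ ι_{eᵢ} ν` for the vertical volume form `ν`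
and the orthonormal bases `(eᵢ)` of the vertical tangent spaces. -/
structure IsMeanCurvature {n : ℕ} (ν : Form I X n) (k : OneForm I X) : Prop where
  smooth : OneForm.Smooth k
  vertical : ∀ (x : X), ∀ v ∈ D.vert x, k x v = 0
  eqn : ∀ (x : X) (e : Fin n → D.vert x), D.IsOrthonormal x e →
    ∀ v : Fin (n + 1) → TangentSpace I x,
      Form.d ν x v = wedgeOne (k x) (ν x).toAlternatingMap v +
        ∑ i, wedgeTwoContract (fun u w => D.metric x (D.frobenius x u w) (e i))
          (e i : TangentSpace I x) (ν x).toAlternatingMap v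

/-- The `1`-form on `S` with values in the bundle of functions on the fibres, given by a `1`-form on
`X` that vanishes on vertical vectors: at `s`, it sends `w ∈ T_s S` to the function
`x ↦ α(horizontal lift of w to x)` on the fibre over `s`. -/
noncomputable def toBase (α : OneForm I X) (x : X) (w : TangentSpace J (D.proj x)) : ℝ :=
  α x (D.horLift x w)

/-- `D` is a geometric family with fibres diffeomorphic to `F`, of dimension `n`: a smooth fibre
bundle with compact even-dimensional fibres, with a smooth horizontal distribution and a smooth
metric on the vertical tangent bundle. -/
structure IsGeometricFamily [IsManifold I ∞ X] (n : ℕ) (F : Type*) [TopologicalSpace F]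
    [ChartedSpace (EuclideanSpace ℝ (Fin n)) F] : Prop where
  compact_fibre : CompactSpace F
  even : Even n
  contMDiff_proj : ContMDiff I J ∞ D.proj
  /-- Local triviality: `x ↦ (π x, fib x)` is a diffeomorphism `π⁻¹(U) ≃ U × F` with inverse
  `inv`. -/
  locally_trivial : ∀ s : S, ∃ (U : Set S) (fib : X → F) (inv : S × F → X), IsOpen U ∧ s ∈ U ∧
    ContMDiffOn I (𝓡 n) ∞ fib (D.proj ⁻¹' U) ∧
    ContMDiffOn (J.prod (𝓡 n)) I ∞ inv (U ×ˢ Set.univ) ∧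
    (∀ s' ∈ U, ∀ f : F, D.proj (inv (s', f)) = s' ∧ fib (inv (s', f)) = f) ∧
    (∀ x ∈ D.proj ⁻¹' U, inv (D.proj x, fib x) = x)
  hor_bijective : ∀ x : X,
    Function.Bijective (fun h : D.hor x => mfderiv I J D.proj x (h : TangentSpace I x))
  /-- Smoothness of the horizontal distribution: the vertical part of a smooth vector field is
  smooth. -/
  smooth_hor : ∀ (x₀ : X) (V : ∀ x : X, TangentSpace I x),
    ContMDiffAt I I.tangent ∞ (fun x => (⟨x, V x⟩ : TangentBundle I X)) x₀ →
    ContMDiffAt I I.tangent ∞ (fun x => (⟨x, D.vertProj x (V x)⟩ : TangentBundle I X)) x₀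
  metric_add : ∀ (x : X) (u v w : D.vert x),
    D.metric x (u + v) w = D.metric x u w + D.metric x v w
  metric_smul : ∀ (x : X) (c : ℝ) (u v : D.vert x), D.metric x (c • u) v = c * D.metric x u v
  metric_symm : ∀ (x : X) (u v : D.vert x), D.metric x u v = D.metric x v u
  metric_pos : ∀ (x : X) (u : D.vert x), u ≠ 0 → 0 < D.metric x u u
  /-- Smoothness of the metric: the pairing of the vertical parts of smooth vector fields is
  smooth. -/
  smooth_metric : ∀ (x₀ : X) (V W : ∀ x : X, TangentSpace I x),
    ContMDiffAt I I.tangent ∞ (fun x => (⟨x, V x⟩ : TangentBundle I X)) x₀ →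
    ContMDiffAt I I.tangent ∞ (fun x => (⟨x, W x⟩ : TangentBundle I X)) x₀ →
    ContMDiffAt I 𝓘(ℝ, ℝ) ∞ (fun x => D.metric x (D.vertProj x (V x)) (D.vertProj x (W x))) x₀

variable (G : Type*) [Group G] [MulAction G X] [MulAction G S]

/-- The actions of `G` on `X` and `S` preserve the data. -/
structure IsInvariant : Prop where
  proj_smul : ∀ (g : G) (x : X), D.proj (g • x) = g • D.proj x
  hor_smul : ∀ (g : G) (x : X),
    (D.hor x).map (mfderiv I I (fun x => g • x) x).toLinearMap = D.hor (g • x)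
  metric_smul : ∀ (g : G) (x : X) (u v : D.vert x) (u' v' : D.vert (g • x)),
    (u' : TangentSpace I (g • x)) = mfderiv I I (fun x => g • x) x u →
    (v' : TangentSpace I (g • x)) = mfderiv I I (fun x => g • x) x v →
    D.metric (g • x) u' v' = D.metric x u v

end FamilyData

end Family

/-- The action of `G` on `X` preserves the form `ν`. -/
def Form.IsInvariant {E H X : Type*} [NormedAddCommGroup E] [NormedSpace ℝ E] [TopologicalSpace H]
    {I : ModelWithCorners ℝ E H} [TopologicalSpace X] [ChartedSpace H X] (G : Type*) [Group G]
    [MulAction G X] {n : ℕ} (ν : Form I X n) : Prop :=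
  ∀ (g : G) (x : X) (v : Fin n → TangentSpace I x),
    ν (g • x) (fun i => mfderiv I I (fun x => g • x) x (v i)) = ν x v

/-! ### Connections and the associated family -/

namespace PrincipalBundle

variable {EG EQ EM G Q M : Type*}
    [NormedAddCommGroup EG] [NormedSpace ℝ EG] [NormedAddCommGroup EQ] [NormedSpace ℝ EQ]
    [NormedAddCommGroup EM] [NormedSpace ℝ EM]
    [Group G] [TopologicalSpace G] [ChartedSpace EG G]
    [TopologicalSpace Q] [ChartedSpace EQ Q] [TopologicalSpace M] [ChartedSpace EM M]
    [MulAction Gᵐᵒᵖ Q] (P : PrincipalBundle EG EQ EM G Q M)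

/-- A connection on `Q → M`, given by its connection form `Φ ∈ Ω¹(Q; 𝔤)`. -/
structure Connection (P : PrincipalBundle EG EQ EM G Q M) where
  form : ∀ q : Q, TangentSpace 𝓘(ℝ, EQ) q →L[ℝ] GroupLieAlgebra 𝓘(ℝ, EG) G
  smooth : ∀ l : GroupLieAlgebra 𝓘(ℝ, EG) G →L[ℝ] ℝ,
    OneForm.Smooth (fun q : Q => l.comp (form q))
  /-- `Φ` sends the vector field generated by `v ∈ 𝔤` to `v`. -/
  form_generator : ∀ (q : Q) (v : GroupLieAlgebra 𝓘(ℝ, EG) G),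
    form q (mfderiv 𝓘(ℝ, EG) 𝓘(ℝ, EQ) (fun g : G => op g • q) 1 v : EQ) = v
  /-- `R_g^* Φ = Ad(g⁻¹) Φ`. -/
  equivariant : ∀ (g : G) (q : Q) (u : TangentSpace 𝓘(ℝ, EQ) q),
    form (op g • q) (mfderiv 𝓘(ℝ, EQ) 𝓘(ℝ, EQ) (fun q => op g • q) q u) =
      (mfderiv 𝓘(ℝ, EG) 𝓘(ℝ, EG) (fun h : G => g⁻¹ * h * g) 1 (form q u) : EG)

/-- The horizontal distribution `V = ker Φ` of a connection. -/
noncomputable def Connection.hor {P : PrincipalBundle EG EQ EM G Q M} (Φ : P.Connection) (q : Q) :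
    Submodule ℝ (TangentSpace 𝓘(ℝ, EQ) q) :=
  LinearMap.ker (Φ.form q).toLinearMap

/-- The tangent vector at `z = (q, y)` of the vector field on `Q × Y` generated by `v ∈ 𝔤` through
the action `(q, y) · g = (q g, g⁻¹ y)`. -/
noncomputable def generator (EQ : Type*) [NormedAddCommGroup EQ] [NormedSpace ℝ EQ]
    [ChartedSpace EQ Q] {EY Y : Type*} [NormedAddCommGroup EY] [NormedSpace ℝ EY]
    [TopologicalSpace Y] [ChartedSpace EY Y] [MulAction G Y]
    (v : GroupLieAlgebra 𝓘(ℝ, EG) G) (z : Q × Y) : TangentSpace (𝓘(ℝ, EQ).prod 𝓘(ℝ, EY)) z :=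
  (mfderiv 𝓘(ℝ, EG) (𝓘(ℝ, EQ).prod 𝓘(ℝ, EY)) (fun g : G => ((op g • z.1, g⁻¹ • z.2) : Q × Y)) 1 v :
    EQ × EY)

/-- The value at `z` of `α - φᵃ ι_a α` for a `1`-form `α` on `Q × Y`, where `Φ = φᵃ e_a` in a basis
`(e_a)` of `𝔤` and `ι_a` is the contraction with the vector field generated by `e_a`. -/
noncomputable def Connection.subContract {P : PrincipalBundle EG EQ EM G Q M} (Φ : P.Connection)
    {ι : Type*} [Fintype ι] (e : Module.Basis ι ℝ (GroupLieAlgebra 𝓘(ℝ, EG) G))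
    {EY Y : Type*} [NormedAddCommGroup EY] [NormedSpace ℝ EY]
    [TopologicalSpace Y] [ChartedSpace EY Y] [MulAction G Y] (z : Q × Y)
    (α : TangentSpace (𝓘(ℝ, EQ).prod 𝓘(ℝ, EY)) z → ℝ)
    (w : TangentSpace (𝓘(ℝ, EQ).prod 𝓘(ℝ, EY)) z) : ℝ :=
  α w - ∑ a, e.coord a (Φ.form z.1
    (mfderiv (𝓘(ℝ, EQ).prod 𝓘(ℝ, EY)) 𝓘(ℝ, EQ) Prod.fst z w)) * α (generator EQ (e a) z)

section

variable {EX ES X S : Type*} [NormedAddCommGroup EX] [NormedSpace ℝ EX]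
    [NormedAddCommGroup ES] [NormedSpace ℝ ES]
    [TopologicalSpace X] [ChartedSpace EX X] [TopologicalSpace S] [ChartedSpace ES S]
    [MulAction G X] [ContinuousSMul G X] [MulAction G S] [ContinuousSMul G S]

/-- The differential at `z` of the quotient map `Q × Y → Y_Q`. -/
noncomputable def assocDeriv {EY Y : Type*} [NormedAddCommGroup EY] [NormedSpace ℝ EY]
    [TopologicalSpace Y] [ChartedSpace EY Y] [MulAction G Y] [ContinuousSMul G Y] (z : Q × Y) :
    TangentSpace (𝓘(ℝ, EQ).prod 𝓘(ℝ, EY)) z →L[ℝ]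
      TangentSpace (𝓘(ℝ, EM).prod 𝓘(ℝ, EY)) (P.assocMk z) :=
  mfderiv (𝓘(ℝ, EQ).prod 𝓘(ℝ, EY)) (𝓘(ℝ, EM).prod 𝓘(ℝ, EY)) P.assocMk z

/-- A `1`-form `β` on `Q × S` with values in the functions on the fibres of `π : X → S` (at `(q, s)`
it sends a tangent vector `w` to the function `x ↦ β (q, x) w` on the fibre over `s`) is basic if it
is horizontal, i.e. annihilated by the vector fields generated by `𝔤`, and `G`-invariant. -/
structure IsBasic (EG : Type*) [NormedAddCommGroup EG] [NormedSpace ℝ EG] [ChartedSpace EG G]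
    (π : X → S) (β : ∀ z : Q × X,
      TangentSpace (𝓘(ℝ, EQ).prod 𝓘(ℝ, ES)) ((z.1, π z.2) : Q × S) → ℝ) : Prop where
  horizontal : ∀ (z : Q × X) (v : GroupLieAlgebra 𝓘(ℝ, EG) G),
    β z (generator EQ v ((z.1, π z.2) : Q × S)) = 0
  invariant : ∀ (z : Q × X) (g : G) (w : EQ × ES),
    β (op g • z.1, g⁻¹ • z.2) (mfderiv (𝓘(ℝ, EQ).prod 𝓘(ℝ, ES)) (𝓘(ℝ, EQ).prod 𝓘(ℝ, ES))
      (fun p : Q × S => ((op g • p.1, g⁻¹ • p.2) : Q × S)) (z.1, π z.2) w : EQ × ES) = β z w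

variable {P}

/-- The data `(π_Q : X_Q → S_Q, H_Q, g_Q^{X/S})` of the associated family: `H_Q` is the image of
`V ⊕ H` in the tangent bundle of `X_Q`, and `g_Q` is the metric to which the pullback of `g` to
`Q × X` descends. By `G`-invariance these do not depend on the representatives in `Q × X`. -/
noncomputable def assocFamily (Φ : P.Connection) (D : FamilyData 𝓘(ℝ, EX) 𝓘(ℝ, ES) X S)
    (hD : D.IsInvariant G) :
    FamilyData (𝓘(ℝ, EM).prod 𝓘(ℝ, EX)) (𝓘(ℝ, EM).prod 𝓘(ℝ, ES)) (P.Assoc X) (P.Assoc S) where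
  proj := P.assocMap D.proj hD.proj_smul
  hor y := Submodule.map (P.assocDeriv (P.assocOut y)).toLinearMap
    ((Φ.hor (P.assocOut y).1).prod (D.hor (P.assocOut y).2))
  metric y u v :=
    let pre : EM × EX → D.vert (P.assocOut y).2 := Function.invFun
      fun w => P.assocDeriv (P.assocOut y) ((0, w.1) : EQ × EX)
    D.metric (P.assocOut y).2 (pre u.1) (pre v.1)

end

end PrincipalBundle

end Families

/-!
The differential of `q_X : Q × X → X_Q` kills exactly the generators of the action, so subtracting
from `(a, v)` the generator of `Φ(a)` makes the `Q`-component horizontal without changing the image.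
It therefore suffices to compute `q_X^* k_Q` on `ker Φ ⊕ TX`, where it turns out to be the pullback
of `k`. Two volume forms of a Euclidean space agree up to sign, so on `ker Φ ⊕ TX` the form
`q_X^* ν_Q` is `± ν` with a locally constant sign, and its exterior derivative is accordingly `± dν`
on tuples with only one entry outside the vertical tangent space of `X`. Since the Frobenius tensor
vanishes on vertical vectors, `dν (h, e₁, …, eₙ) = k h * ν (e₁, …, eₙ)` for an orthonormal basis
`(eᵢ)`, so that `ν` and `dν` determine `k`, and the sign cancels. Finally, the resulting form on
`Q × S` is basic because it is pulled back from `S_Q`.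
-/

namespace Families

section LinearAlgebra

variable {V : Type*} [AddCommGroup V] [Module ℝ V]

theorem exists_basis_orthonormal_of_finrank_eq [FiniteDimensional ℝ V] {n : ℕ}
    (hn : Module.finrank ℝ V = n) (g : V → V → ℝ)
    (hadd : ∀ u v w, g (u + v) w = g u w + g v w) (hsmul : ∀ (c : ℝ) u v, g (c • u) v = c * g u v)
    (hsymm : ∀ u v, g u v = g v u) (hpos : ∀ u, u ≠ 0 → 0 < g u u) :
    ∃ e : Module.Basis (Fin n) ℝ V, ∀ i j, g (e i) (e j) = if i = j then 1 else 0 := by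
  have zero_left : ∀ w, g 0 w = 0 := fun w => by simpa using hsmul 0 0 w
  let core : InnerProductSpace.Core ℝ V :=
    { inner := g
      conj_inner_symm := fun u v => hsymm v u
      re_inner_nonneg := fun u => by
        rcases eq_or_ne u 0 with rfl | hu
        · exact (zero_left 0).ge
        · exact (hpos u hu).le
      add_left := hadd
      smul_left := fun u v c => hsmul c u v
      definite := fun u hu => by
        by_contra h
        exact (hpos u h).ne' hu }
  let _ : NormedAddCommGroup V := core.toNormedAddCommGroup
  let _ : InnerProductSpace ℝ V := InnerProductSpace.ofCore core.toCore
  subst hn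
  refine ⟨(stdOrthonormalBasis ℝ V).toBasis, fun i j => ?_⟩
  rw [OrthonormalBasis.coe_toBasis]
  exact orthonormal_iff_ite.1 (stdOrthonormalBasis ℝ V).orthonormal i j

theorem map_add_of_forall_mem_eq_zero {R ι M N : Type*} [Semiring R] [Finite ι] [AddCommMonoid M]
    [AddCommMonoid N] [Module R M] [Module R N] (f : MultilinearMap R (fun _ : ι => M) N)
    (K : Submodule R M) (hf : ∀ v : ι → M, (∃ i, v i ∈ K) → f v = 0) (u w : ι → M)
    (hw : ∀ i, w i ∈ K) : f (fun i => u i + w i) = f u := by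
  classical
  have := Fintype.ofFinite ι
  refine (f.map_add_univ u w).trans ?_
  rw [Finset.sum_eq_single Finset.univ, Finset.piecewise_univ]
  · intro s _ hs
    obtain ⟨i, hi⟩ : ∃ i, i ∉ s := by simpa [Finset.eq_univ_iff_forall] using hs
    exact hf _ ⟨i, by simpa [Finset.piecewise_eq_of_notMem _ _ _ hi] using hw i⟩
  · exact fun h => (h (Finset.mem_univ _)).elim

theorem alternatingMap_eq_mul_of_basis {n : ℕ} (b : Module.Basis (Fin n) ℝ V)
    (f g : V [⋀^Fin n]→ₗ[ℝ] ℝ) {c : ℝ} (h : f b = c * g b) (v : Fin n → V) : f v = c * g v := by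
  rw [f.eq_smul_basis_det b, g.eq_smul_basis_det b]
  simp only [AlternatingMap.smul_apply, smul_eq_mul, h]
  ring

theorem removeNth_succ_cons_prodMk {A B : Type*} [AddCommGroup A] [Module ℝ A] {n : ℕ} (a : A)
    (h : B) (e : Fin n → B) (j : Fin n) :
    j.succ.removeNth (Fin.cons (a, h) fun i => ((0 : A), e i) : Fin (n + 1) → A × B) =
      fun i => ((j.succ.removeNth (Fin.cons 1 fun _ => 0 : Fin (n + 1) → ℝ) i) • a,
        j.succ.removeNth (Fin.cons h e : Fin (n + 1) → B) i) := by
  funext i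
  simp only [Fin.removeNth]
  refine Fin.cases ?_ (fun k => ?_) (j.succ.succAbove i) <;> simp

theorem wedgeOne_cons {n : ℕ} (α : V → ℝ) (η : V [⋀^Fin n]→ₗ[ℝ] ℝ) (h : V) (e : Fin n → V)
    (he : ∀ i, α (e i) = 0) : wedgeOne α η (Fin.cons h e : Fin (n + 1) → V) = α h * η e := by
  simp [wedgeOne, Fin.sum_univ_succ, he, Fin.removeNth_zero]

theorem wedgeTwoContract_eq_zero (β : V → V → ℝ) (e : V) {n : ℕ} (η : V [⋀^Fin n]→ₗ[ℝ] ℝ)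
    (v : Fin (n + 1) → V) (h : ∀ i j, i ≠ j → β (v i) (v j) = 0) :
    wedgeTwoContract β e η v = 0 := by
  cases n with
  | zero => rfl
  | succ n =>
    simp only [wedgeTwoContract, wedgeTwo]
    rw [Finset.sum_eq_zero, mul_zero]
    refine fun i _ => Finset.sum_eq_zero fun j _ => ?_
    rw [Fin.removeNth_apply, h i (i.succAbove j) (Fin.succAbove_ne i j).symm]
    ring

end LinearAlgebra

section Calculus

theorem apply_fderiv_eq_zero_of_eventually_apply_eq_zero {𝕜 E F F' : Type*}
    [NontriviallyNormedField 𝕜] [NormedAddCommGroup E] [NormedSpace 𝕜 E]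
    [NormedAddCommGroup F] [NormedSpace 𝕜 F] [NormedAddCommGroup F'] [NormedSpace 𝕜 F']
    {A : E → F →L[𝕜] F'} {W : E → F} {y₀ : E} (hA : ContinuousAt A y₀) (hW : W y₀ = 0)
    (h : ∀ᶠ y in 𝓝 y₀, A y (W y) = 0) (b : E) : A y₀ (fderiv 𝕜 W y₀ b) = 0 := by
  by_cases hd : DifferentiableAt 𝕜 W y₀
  swap
  · simp [fderiv_zero_of_not_differentiableAt hd]
  have hA_sub : (fun y => A y₀ - A y) =o[𝓝 y₀] fun _ => (1 : ℝ) := by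
    rw [Asymptotics.isLittleO_one_iff]
    simpa using (tendsto_const_nhds (x := A y₀)).sub hA.tendsto
  have hW_bigO : W =O[𝓝 y₀] fun y => y - y₀ := by simpa [hW] using hd.hasFDerivAt.isBigO_sub
  have hzero : HasFDerivAt (fun y => A y₀ (W y)) (0 : E →L[𝕜] F') y₀ := by
    refine .of_isLittleO ?_
    have hsmall : (fun y => (A y₀ - A y) (W y)) =o[𝓝 y₀] fun y => y - y₀ := by
      refine ((Asymptotics.isBigO_of_le _ fun y => ?_).trans_isLittleO
        (hA_sub.norm_left.mul_isBigO hW_bigO.norm_norm)).trans_isBigO ?_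
      · simpa using (A y₀ - A y).le_opNorm (W y)
      · simpa using (Asymptotics.isBigO_refl (fun y => y - y₀) (𝓝 y₀)).norm_left
    refine hsmall.congr' ?_ Filter.EventuallyEq.rfl
    filter_upwards [h] with y hy
    simp [hW, hy]
  exact DFunLike.congr_fun (((A y₀).hasFDerivAt.comp y₀ hd.hasFDerivAt).unique hzero) b

theorem eventually_eq_of_eq_mul_of_sign {α : Type*} [TopologicalSpace α] {c f g : α → ℝ} {x₀ : α}
    (hc : ∀ᶠ x in 𝓝 x₀, c x = 1 ∨ c x = -1) (hf : ContinuousAt f x₀) (hg : ContinuousAt g x₀)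
    (hne : g x₀ ≠ 0) (h : ∀ᶠ x in 𝓝 x₀, f x = c x * g x) : ∀ᶠ x in 𝓝 x₀, c x = c x₀ := by
  have hquot : ContinuousAt (fun x => f x / g x) x₀ := hf.div hg hne
  have hcont : ContinuousAt c x₀ := by
    refine hquot.congr ?_
    filter_upwards [h, hg.eventually_ne hne] with x hx hgx
    rw [hx, mul_div_cancel_right₀ _ hgx]
  filter_upwards [hc, hcont.eventually (Metric.ball_mem_nhds _ one_pos)] with x hx hclose
  rw [Real.dist_eq, abs_lt] at hclose
  rcases hx with hx | hx <;> rcases hc.self_of_nhds with hx₀ | hx₀ <;> linarith [hclose.1, hclose.2]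

section Prod

variable {𝕜 A B F : Type*} [NontriviallyNormedField 𝕜] [NormedAddCommGroup A] [NormedSpace 𝕜 A]
    [NormedAddCommGroup B] [NormedSpace 𝕜 B] [NormedAddCommGroup F] [NormedSpace 𝕜 F]

theorem fderiv_comp_snd_apply (g : B → F) (p b : A × B) :
    fderiv 𝕜 (fun p : A × B => g p.2) p b = fderiv 𝕜 g p.2 b.2 := by
  by_cases hg : DifferentiableAt 𝕜 g p.2
  · have h : HasFDerivAt (fun p : A × B => g p.2) _ p := hg.hasFDerivAt.comp p hasFDerivAt_snd
    rw [h.fderiv]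
    rfl
  · have hg' : ¬ DifferentiableAt 𝕜 (fun p : A × B => g p.2) p := fun h =>
      hg (h.comp (f := fun x : B => (p.1, x)) p.2
        (hasFDerivAt_prodMk_right p.1 p.2).differentiableAt)
    simp [fderiv_zero_of_not_differentiableAt hg, fderiv_zero_of_not_differentiableAt hg']

theorem fderiv_prodMk_zero_apply (g : B → F) (b₀ b : B) :
    fderiv 𝕜 (fun x => ((0 : A), g x)) b₀ b = (0, fderiv 𝕜 g b₀ b) := by
  by_cases hg : DifferentiableAt 𝕜 g b₀
  · rw [((hasFDerivAt_const (0 : A) b₀).prodMk hg.hasFDerivAt).fderiv]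
    rfl
  · have hg' : ¬ DifferentiableAt 𝕜 (fun x => ((0 : A), g x)) b₀ := fun h => hg h.snd
    rw [fderiv_zero_of_not_differentiableAt hg, fderiv_zero_of_not_differentiableAt hg']
    rfl

theorem fderiv_apply_zero_prodMk {f : A × B → F} {p : A × B} (hf : DifferentiableAt 𝕜 f p) (b : B) :
    fderiv 𝕜 f p (0, b) = fderiv 𝕜 (fun x => f (p.1, x)) p.2 b := by
  have h : HasFDerivAt (fun x => f (p.1, x)) _ p.2 :=
    HasFDerivAt.comp p.2 (f := fun x : B => (p.1, x)) hf.hasFDerivAt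
      (hasFDerivAt_prodMk_right p.1 p.2)
  rw [h.fderiv]
  simp

end Prod

section ExtDeriv

variable {A B : Type*} [NormedAddCommGroup A] [NormedSpace ℝ A]
    [NormedAddCommGroup B] [NormedSpace ℝ B]

theorem differentiableAt_form_apply {n : ℕ} {η : A → A [⋀^Fin n]→L[ℝ] ℝ} {x : A}
    (hη : DifferentiableAt ℝ η x) (v : Fin n → A) : DifferentiableAt ℝ (fun y => η y v) x :=
  (ContinuousAlternatingMap.apply ℝ A ℝ v).differentiableAt.comp x hη

theorem extDeriv_prod_cons {n : ℕ} {α : A × B → (A × B) [⋀^Fin n]→L[ℝ] ℝ}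
    {β : B → B [⋀^Fin n]→L[ℝ] ℝ} {p₀ : A × B} (hα : DifferentiableAt ℝ α p₀)
    (hβ : DifferentiableAt ℝ β p₀.2) {a : A}
    (hvert : ∀ᶠ p in 𝓝 p₀, ∀ v : Fin n → B, α p (fun i => (0, v i)) = β p.2 v)
    (hslice : ∀ᶠ x in 𝓝 p₀.2, ∀ (r : Fin n → ℝ) (v : Fin n → B),
      α (p₀.1, x) (fun i => (r i • a, v i)) = β x v) (h : B) (e : Fin n → B) :
    extDeriv α p₀ (Fin.cons (a, h) fun i => (0, e i)) = extDeriv β p₀.2 (Fin.cons h e) := by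
  rw [extDeriv_apply hα, extDeriv_apply hβ]
  refine Finset.sum_congr rfl fun i _ => congrArg _ ?_
  cases i using Fin.cases with
  | zero =>
    simp only [Fin.removeNth_zero, Fin.tail_cons, Fin.cons_zero]
    have heq : (fun p => α p fun i => ((0 : A), e i)) =ᶠ[𝓝 p₀] fun p => β p.2 e := by
      filter_upwards [hvert] with p hp using hp e
    rw [heq.fderiv_eq, fderiv_comp_snd_apply (fun x => β x e)]
  | succ j =>
    simp only [Fin.cons_succ]
    rw [removeNth_succ_cons_prodMk, fderiv_apply_zero_prodMk (differentiableAt_form_apply hα _)]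
    refine DFunLike.congr_fun (Filter.EventuallyEq.fderiv_eq ?_) (e j)
    filter_upwards [hslice] with x hx using hx _ _

end ExtDeriv

end Calculus

section ModelDeriv

variable {E H X E' H' X' E'' H'' X'' : Type*}
    [NormedAddCommGroup E] [NormedSpace ℝ E] [TopologicalSpace H] {I : ModelWithCorners ℝ E H}
    [TopologicalSpace X] [ChartedSpace H X]
    [NormedAddCommGroup E'] [NormedSpace ℝ E'] [TopologicalSpace H'] {I' : ModelWithCorners ℝ E' H'}
    [TopologicalSpace X'] [ChartedSpace H' X']
    [NormedAddCommGroup E''] [NormedSpace ℝ E''] [TopologicalSpace H'']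
    {I'' : ModelWithCorners ℝ E'' H''} [TopologicalSpace X''] [ChartedSpace H'' X'']

variable (I I') in
/-- The differential of `f` at `x`, regarded as a map between the model spaces. Its type does not
depend on `x` and `f x`, so that differentials at propositionally equal points can be compared. -/
noncomputable def modelDeriv (f : X → X') (x : X) : E →L[ℝ] E' := mfderiv I I' f x

theorem modelDeriv_comp {g : X' → X''} {f : X → X'} {x : X} (hg : MDifferentiableAt I' I'' g (f x))
    (hf : MDifferentiableAt I I' f x) :
    modelDeriv I I'' (fun y => g (f y)) x =
      (modelDeriv I' I'' g (f x)).comp (modelDeriv I I' f x) :=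
  mfderiv_comp x hg hf

theorem modelDeriv_congr {f g : X → X'} {x : X} (h : f =ᶠ[𝓝 x] g) :
    modelDeriv I I' f x = modelDeriv I I' g x :=
  h.mfderiv_eq

theorem modelDeriv_id (x : X) : modelDeriv I I (fun y => y) x = ContinuousLinearMap.id ℝ E :=
  mfderiv_id

theorem modelDeriv_const (x : X) (c : X') : modelDeriv I I' (fun _ => c) x = 0 := mfderiv_const

theorem modelDeriv_prodMk {f : X → X'} {g : X → X''} {x : X} (hf : MDifferentiableAt I I' f x)
    (hg : MDifferentiableAt I I'' g x) :
    modelDeriv I (I'.prod I'') (fun y => (f y, g y)) x =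
      (modelDeriv I I' f x).prod (modelDeriv I I'' g x) :=
  mfderiv_prodMk hf hg

theorem modelDeriv_fst (z : X × X') :
    modelDeriv (I.prod I') I (fun p => p.1) z = ContinuousLinearMap.fst ℝ E E' := mfderiv_fst

theorem modelDeriv_eq_fderiv {f : E → E'} {y : E} :
    modelDeriv 𝓘(ℝ, E) 𝓘(ℝ, E') f y = fderiv ℝ f y :=
  mfderiv_eq_fderiv

end ModelDeriv

section Charts

variable {E H X : Type*} [NormedAddCommGroup E] [NormedSpace ℝ E] [TopologicalSpace H]
    {I : ModelWithCorners ℝ E H} [TopologicalSpace X] [ChartedSpace H X]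

/-- The expression of a vector field in the preferred chart at `x₀`. -/
noncomputable def vectorInChart (W : ∀ x : X, TangentSpace I x) (x₀ : X) (y : E) : E :=
  modelDeriv I 𝓘(ℝ, E) (extChartAt I x₀) ((extChartAt I x₀).symm y) (W ((extChartAt I x₀).symm y))

section Boundaryless

variable [I.Boundaryless]

theorem eventually_mem_extChartAt_target (x₀ : X) :
    ∀ᶠ y in 𝓝 (extChartAt I x₀ x₀), y ∈ (extChartAt I x₀).target :=
  (isOpen_extChartAt_target x₀).mem_nhds (mem_extChartAt_target x₀)

theorem chartSymmDeriv_eq_modelDeriv (x₀ : X) (y : E) :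
    (chartSymmDeriv I x₀ y : E →L[ℝ] E) = modelDeriv 𝓘(ℝ, E) I (extChartAt I x₀).symm y := by
  unfold chartSymmDeriv modelDeriv
  rw [I.range_eq_univ]
  exact congrFun mfderivWithin_univ y

end Boundaryless

variable [IsManifold I ∞ X]

theorem modelDeriv_extChartAt_self (x₀ : X) :
    modelDeriv I 𝓘(ℝ, E) (extChartAt I x₀) x₀ = ContinuousLinearMap.id ℝ E :=
  mfderiv_extChartAt_self

theorem contMDiffAt_vectorField_iff {x₀ : X} (V : ∀ x : X, TangentSpace I x) :
    ContMDiffAt I I.tangent ∞ (fun x => (⟨x, V x⟩ : TangentBundle I X)) x₀ ↔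
      ContMDiffAt I 𝓘(ℝ, E) ∞ (fun x => modelDeriv I 𝓘(ℝ, E) (extChartAt I x₀) x (V x)) x₀ := by
  refine (Bundle.contMDiffAt_section (IB := I) (F := E) (E := TangentSpace I) (s := V) x₀).trans ?_
  refine Filter.EventuallyEq.contMDiffAt_iff ?_
  filter_upwards [chart_source_mem_nhds H x₀] with x hx
  refine Eq.trans ?_ (DFunLike.congr_fun
    (TangentBundle.continuousLinearMapAt_trivializationAt (I := I) hx) (V x))
  rw [Bundle.Trivialization.continuousLinearMapAt_apply,
    Bundle.Trivialization.coe_linearMapAt_of_mem]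
  simpa using hx

theorem mpullbackWithin_extChartAt_symm (W : ∀ x : X, TangentSpace I x) (x₀ : X) {y : E}
    (hy : y ∈ (extChartAt I x₀).target) :
    (VectorField.mpullbackWithin 𝓘(ℝ, E) I (extChartAt I x₀).symm W (Set.range I) y : E) =
      vectorInChart W x₀ y := by
  have hinv : ((mfderivWithin 𝓘(ℝ, E) I (extChartAt I x₀).symm (Set.range I) y).inverse :
      E →L[ℝ] E) = modelDeriv I 𝓘(ℝ, E) (extChartAt I x₀) ((extChartAt I x₀).symm y) :=
    ContinuousLinearMap.inverse_eq (M := E) (M₂ := E)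
      (mfderivWithin_extChartAt_symm_comp_mfderiv_extChartAt hy)
      (mfderiv_extChartAt_comp_mfderivWithin_extChartAt_symm hy)
  exact DFunLike.congr_fun hinv _

theorem vectorInChart_extChartAt_self (W : ∀ x : X, TangentSpace I x) (x₀ : X) :
    vectorInChart W x₀ (extChartAt I x₀ x₀) = W x₀ := by
  have hself : ∀ x, x = x₀ → modelDeriv I 𝓘(ℝ, E) (extChartAt I x₀) x (W x) = W x₀ := by
    rintro _ rfl
    rw [modelDeriv_extChartAt_self]
    rfl
  exact hself _ (extChartAt_to_inv x₀)

variable [I.Boundaryless]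

theorem mdifferentiableAt_extChartAt_symm (x₀ : X) {y : E} (hy : y ∈ (extChartAt I x₀).target) :
    MDifferentiableAt 𝓘(ℝ, E) I (extChartAt I x₀).symm y :=
  ((contMDiffOn_extChartAt_symm (n := ∞) x₀).contMDiffAt
    ((isOpen_extChartAt_target x₀).mem_nhds hy)).mdifferentiableAt (by simp)

theorem modelDeriv_extChartAt_comp_symm (x₀ : X) {y : E} (hy : y ∈ (extChartAt I x₀).target) :
    (modelDeriv I 𝓘(ℝ, E) (extChartAt I x₀) ((extChartAt I x₀).symm y)).comp
      (modelDeriv 𝓘(ℝ, E) I (extChartAt I x₀).symm y) = ContinuousLinearMap.id ℝ E := by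
  rw [← chartSymmDeriv_eq_modelDeriv]
  exact mfderiv_extChartAt_comp_mfderivWithin_extChartAt_symm hy

theorem modelDeriv_extChartAt_symm_comp (x₀ : X) {y : E} (hy : y ∈ (extChartAt I x₀).target) :
    (modelDeriv 𝓘(ℝ, E) I (extChartAt I x₀).symm y).comp
      (modelDeriv I 𝓘(ℝ, E) (extChartAt I x₀) ((extChartAt I x₀).symm y)) =
      ContinuousLinearMap.id ℝ E := by
  rw [← chartSymmDeriv_eq_modelDeriv]
  exact mfderivWithin_extChartAt_symm_comp_mfderiv_extChartAt hy

theorem modelDeriv_extChartAt_symm_self (x₀ : X) :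
    modelDeriv 𝓘(ℝ, E) I (extChartAt I x₀).symm (extChartAt I x₀ x₀) =
      ContinuousLinearMap.id ℝ E := by
  rw [← chartSymmDeriv_eq_modelDeriv]
  exact mfderivWithin_range_extChartAt_symm

theorem inverse_mfderiv_extChartAt (x₀ : X) {y : E} (hy : y ∈ (extChartAt I x₀).target) :
    ((mfderiv I 𝓘(ℝ, E) (extChartAt I x₀) ((extChartAt I x₀).symm y)).inverse : E →L[ℝ] E) =
      modelDeriv 𝓘(ℝ, E) I (extChartAt I x₀).symm y :=
  ContinuousLinearMap.inverse_eq (M := E) (M₂ := E) (modelDeriv_extChartAt_comp_symm x₀ hy)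
    (modelDeriv_extChartAt_symm_comp x₀ hy)

theorem mlieBracket_eq_fderiv_of_eq_zero {V W : ∀ x : X, TangentSpace I x} {x₀ : X}
    (hW : W x₀ = 0) :
    (VectorField.mlieBracket I V W x₀ : E) =
      fderiv ℝ (vectorInChart W x₀) (extChartAt I x₀ x₀) (V x₀) := by
  have hpull (U : ∀ x : X, TangentSpace I x) : (VectorField.mpullbackWithin 𝓘(ℝ, E) I
      (extChartAt I x₀).symm U Set.univ : E → E) =ᶠ[𝓝 (extChartAt I x₀ x₀)] vectorInChart U x₀ := by
    filter_upwards [eventually_mem_extChartAt_target x₀] with y hy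
    have hvalue := mpullbackWithin_extChartAt_symm U x₀ hy
    rw [I.range_eq_univ] at hvalue
    exact hvalue
  have hbracket := VectorField.mlieBracketWithin_apply (I := I) (V := V) (W := W) (s := Set.univ)
    (x₀ := x₀)
  rw [I.range_eq_univ, Set.preimage_univ, Set.univ_inter] at hbracket
  have hinv : ((mfderiv I 𝓘(ℝ, E) (extChartAt I x₀) x₀).inverse : E →L[ℝ] E) =
      ContinuousLinearMap.id ℝ E := by
    rw [mfderiv_extChartAt_self]
    exact ContinuousLinearMap.inverse_id
  refine (hbracket.trans (DFunLike.congr_fun hinv _)).trans ?_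
  refine (congrFun (VectorField.lieBracketWithin_univ (𝕜 := ℝ) (E := E)) _).trans ?_
  refine ((hpull V).lieBracket_vectorField_eq (hpull W)).trans ?_
  rw [VectorField.lieBracket, vectorInChart_extChartAt_self, vectorInChart_extChartAt_self, hW]
  exact (congrArg _ (map_zero _)).trans (sub_zero _)

end Charts

section Pullback

variable {E H X E' : Type*} [NormedAddCommGroup E] [NormedSpace ℝ E] [TopologicalSpace H]
    {I : ModelWithCorners ℝ E H} [TopologicalSpace X] [ChartedSpace H X]
    [NormedAddCommGroup E'] [NormedSpace ℝ E']

namespace Form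

/-- The value of a form at `x`, regarded as an alternating map on the model space. -/
def val {n : ℕ} (η : Form I X n) (x : X) : E [⋀^Fin n]→L[ℝ] ℝ := η x

/-- The pullback of a form by a map from a normed space. -/
noncomputable def pull {n : ℕ} (η : Form I X n) (f : E' → X) (y : E') : E' [⋀^Fin n]→L[ℝ] ℝ :=
  (η.val (f y)).compContinuousLinearMap (modelDeriv 𝓘(ℝ, E') I f y)

variable [I.Boundaryless]

theorem inChart_eq_pull {n : ℕ} (η : Form I X n) (x₀ : X) :
    η.inChart x₀ = η.pull (extChartAt I x₀).symm := by
  funext y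
  unfold pull
  rw [← chartSymmDeriv_eq_modelDeriv]
  rfl

theorem Smooth.differentiableAt_inChart {n : ℕ} {η : Form I X n} (hη : η.Smooth) (x₀ : X) {y : E}
    (hy : y ∈ (extChartAt I x₀).target) : DifferentiableAt ℝ (η.inChart x₀) y :=
  ((hη x₀).contDiffAt ((isOpen_extChartAt_target x₀).mem_nhds hy)).differentiableAt (by simp)

variable [IsManifold I ∞ X]

theorem pull_eventuallyEq {n : ℕ} (η : Form I X n) {f : E' → X} {y₀ : E'}
    (hf : ContMDiffAt 𝓘(ℝ, E') I ∞ f y₀) :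
    η.pull f =ᶠ[𝓝 y₀] fun y =>
      (η.inChart (f y₀) (extChartAt I (f y₀) (f y))).compContinuousLinearMap
        (fderiv ℝ (fun y => extChartAt I (f y₀) (f y)) y) := by
  have hsource : ∀ᶠ y in 𝓝 y₀, f y ∈ (extChartAt I (f y₀)).source :=
    hf.continuousAt.eventually (extChartAt_source_mem_nhds (f y₀))
  have hsmooth : ∀ᶠ y in 𝓝 y₀, ContMDiffAt 𝓘(ℝ, E') I 1 f y :=
    (contMDiffAt_iff_contMDiffAt_nhds (by simp)).1 (hf.of_le (by exact_mod_cast le_top))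
  filter_upwards [hsource.eventually_nhds, hsmooth] with y hy hfy
  have hfy_mem := hy.self_of_nhds
  have hchart : MDifferentiableAt 𝓘(ℝ, E') 𝓘(ℝ, E) (fun y => extChartAt I (f y₀) (f y)) y :=
    (mdifferentiableAt_extChartAt (by simpa using hfy_mem)).comp y
      (hfy.mdifferentiableAt (by simp))
  have hfactor := modelDeriv_comp (f := fun y => extChartAt I (f y₀) (f y))
    (mdifferentiableAt_extChartAt_symm (f y₀) ((extChartAt I (f y₀)).map_source hfy_mem)) hchart
  have heq : (fun y => (extChartAt I (f y₀)).symm (extChartAt I (f y₀) (f y))) =ᶠ[𝓝 y] f := by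
    filter_upwards [hy] with y' hy' using (extChartAt I (f y₀)).left_inv hy'
  rw [modelDeriv_congr heq, modelDeriv_eq_fderiv] at hfactor
  rw [inChart_eq_pull]
  unfold pull
  rw [hfactor, (extChartAt I (f y₀)).left_inv hfy_mem]
  rfl

theorem Smooth.differentiableAt_pull {n : ℕ} {η : Form I X n} (hη : η.Smooth) {f : E' → X}
    {y₀ : E'} (hf : ContMDiffAt 𝓘(ℝ, E') I ∞ f y₀) : DifferentiableAt ℝ (η.pull f) y₀ := by
  have hchart : ContDiffAt ℝ ∞ (fun y => extChartAt I (f y₀) (f y)) y₀ :=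
    (contMDiffAt_extChartAt.comp y₀ hf).contDiffAt
  refine DifferentiableAt.congr_of_eventuallyEq ?_ (η.pull_eventuallyEq hf)
  refine DifferentiableAt.continuousAlternatingMapCompContinuousLinearMap ?_ ?_
  · exact (hη.differentiableAt_inChart (f y₀) (mem_extChartAt_target _)).comp
      (f := fun y => extChartAt I (f y₀) (f y)) y₀ (hchart.differentiableAt (by simp))
  · exact (hchart.fderiv_right (m := 1) (by norm_cast)).differentiableAt (by simp)

theorem Smooth.extDeriv_pull {n : ℕ} {η : Form I X n} (hη : η.Smooth) {f : E' → X} {y₀ : E'}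
    (hf : ContMDiffAt 𝓘(ℝ, E') I ∞ f y₀) :
    extDeriv (η.pull f) y₀ =
      (η.d.val (f y₀)).compContinuousLinearMap (modelDeriv 𝓘(ℝ, E') I f y₀) := by
  have hchart : ContDiffAt ℝ ∞ (fun y => extChartAt I (f y₀) (f y)) y₀ :=
    (contMDiffAt_extChartAt.comp y₀ hf).contDiffAt
  have hcomp := modelDeriv_comp (mdifferentiableAt_extChartAt (I := I) (mem_chart_source H (f y₀)))
    (hf.mdifferentiableAt (by simp))
  rw [modelDeriv_eq_fderiv] at hcomp
  rw [(η.pull_eventuallyEq hf).extDeriv_eq,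
    extDeriv_pullback (f := fun y => extChartAt I (f y₀) (f y))
      (hη.differentiableAt_inChart (f y₀) (mem_extChartAt_target _)) hchart
      (by rw [minSmoothness_of_isRCLikeNormedField]; exact WithTop.coe_le_coe.2 le_top), hcomp]
  unfold val d
  rw [I.range_eq_univ, extDerivWithin_univ]
  rfl

theorem inChart_self {n : ℕ} (η : Form I X n) (x₀ : X) (v : Fin n → E) :
    η.inChart x₀ (extChartAt I x₀ x₀) v = η.val x₀ v := by
  rw [inChart_eq_pull]
  unfold pull
  rw [modelDeriv_extChartAt_symm_self, extChartAt_to_inv]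
  rfl

theorem Smooth.extDeriv_inChart_self {n : ℕ} {η : Form I X n} (hη : η.Smooth) (x₀ : X)
    (v : Fin (n + 1) → E) :
    extDeriv (η.inChart x₀) (extChartAt I x₀ x₀) v = η.d.val x₀ v := by
  have hchart : ContMDiffAt 𝓘(ℝ, E) I ∞ (extChartAt I x₀).symm (extChartAt I x₀ x₀) :=
    (contMDiffOn_extChartAt_symm x₀).contMDiffAt
      ((isOpen_extChartAt_target x₀).mem_nhds (mem_extChartAt_target x₀))
  rw [inChart_eq_pull, hη.extDeriv_pull hchart, modelDeriv_extChartAt_symm_self,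
    extChartAt_to_inv]
  rfl

end Form

end Pullback

namespace FamilyData

variable {E H E' H' X S : Type*} [NormedAddCommGroup E] [NormedSpace ℝ E]
    [TopologicalSpace H] {I : ModelWithCorners ℝ E H} [TopologicalSpace X] [ChartedSpace H X]
    [NormedAddCommGroup E'] [NormedSpace ℝ E'] [TopologicalSpace H'] {J : ModelWithCorners ℝ E' H'}
    [TopologicalSpace S] [ChartedSpace H' S] (D : FamilyData I J X S)

/-- The differential of the projection maps `H_x` isomorphically onto the tangent space of the
base. -/
def HorBijectiveAt (x : X) : Prop :=
  Function.Bijective (fun h : D.hor x => mfderiv I J D.proj x (h : TangentSpace I x))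

/-- The projection onto the vertical tangent spaces, expressed in the preferred chart at `x₀`. -/
noncomputable def vertProjInChart (x₀ : X) (y : E) : E →ₗ[ℝ] E :=
  (modelDeriv I 𝓘(ℝ, E) (extChartAt I x₀) ((extChartAt I x₀).symm y)).toLinearMap ∘ₗ
    ((D.vert ((extChartAt I x₀).symm y)).subtype ∘ₗ D.vertProj ((extChartAt I x₀).symm y) :
      E →ₗ[ℝ] E) ∘ₗ
    (modelDeriv 𝓘(ℝ, E) I (extChartAt I x₀).symm y).toLinearMap

/-- The part of the structure of a geometric family on which the mean curvature form depends: the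
fibres may be noncompact, need not be diffeomorphic to each other, and carry metrics which need not
vary smoothly. -/
structure IsMetricFamily [IsManifold I ∞ X] (n : ℕ) : Prop where
  contMDiff_proj : ContMDiff I J ∞ D.proj
  horBijectiveAt : ∀ x : X, D.HorBijectiveAt x
  smooth_hor : ∀ (x₀ : X) (V : ∀ x : X, TangentSpace I x),
    ContMDiffAt I I.tangent ∞ (fun x => (⟨x, V x⟩ : TangentBundle I X)) x₀ →
    ContMDiffAt I I.tangent ∞ (fun x => (⟨x, D.vertProj x (V x)⟩ : TangentBundle I X)) x₀
  finrank_vert : ∀ x : X, Module.finrank ℝ (D.vert x) = n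
  metric_add : ∀ (x : X) (u v w : D.vert x),
    D.metric x (u + v) w = D.metric x u w + D.metric x v w
  metric_smul : ∀ (x : X) (c : ℝ) (u v : D.vert x), D.metric x (c • u) v = c * D.metric x u v
  metric_symm : ∀ (x : X) (u v : D.vert x), D.metric x u v = D.metric x v u
  metric_pos : ∀ (x : X) (u : D.vert x), u ≠ 0 → 0 < D.metric x u u

variable {D}

theorem mem_vert {x : X} {v : TangentSpace I x} : v ∈ D.vert x ↔ modelDeriv I J D.proj x v = 0 :=
  Iff.rfl

theorem horProj_add_vertProj (x : X) (v : TangentSpace I x) :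
    D.horProj x v + D.vertProj x v = v :=
  sub_add_cancel v (D.vertProj x v : TangentSpace I x)

theorem horLift_mem (x : X) (w : TangentSpace J (D.proj x)) : D.horLift x w ∈ D.hor x :=
  Subtype.property _

namespace HorBijectiveAt

theorem isCompl {x : X} (h : D.HorBijectiveAt x) : IsCompl (D.vert x) (D.hor x) := by
  refine ⟨Submodule.disjoint_def.2 fun v hvert hhor => ?_,
    Submodule.codisjoint_iff_exists_add_eq.2 fun v => ?_⟩
  · exact congrArg Subtype.val (h.1 (a₁ := ⟨v, hhor⟩) (a₂ := 0)
      ((mem_vert.1 hvert).trans (map_zero (mfderiv I J D.proj x)).symm))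
  · obtain ⟨u, hu⟩ := h.2 (mfderiv I J D.proj x v)
    refine ⟨v - u, u, ?_, u.2, sub_add_cancel _ _⟩
    exact (map_sub (mfderiv I J D.proj x) v u).trans (sub_eq_zero.2 hu.symm)

theorem vertProj_of_mem_vert {x : X} (h : D.HorBijectiveAt x) {v : TangentSpace I x}
    (hv : v ∈ D.vert x) : (D.vertProj x v : TangentSpace I x) = v := by
  rw [vertProj, dif_pos h.isCompl]
  exact congrArg Subtype.val (Submodule.projectionOnto_apply_left h.isCompl ⟨v, hv⟩)

theorem vertProj_eq_zero_iff {x : X} (h : D.HorBijectiveAt x) {v : TangentSpace I x} :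
    D.vertProj x v = 0 ↔ v ∈ D.hor x := by
  rw [vertProj, dif_pos h.isCompl]
  exact Submodule.projectionOnto_apply_eq_zero_iff h.isCompl

theorem vertProj_horProj {x : X} (h : D.HorBijectiveAt x) (v : TangentSpace I x) :
    D.vertProj x (D.horProj x v) = 0 :=
  (map_sub (D.vertProj x) v _).trans <| sub_eq_zero.2 <| Subtype.ext
    (h.vertProj_of_mem_vert (D.vertProj x v).2).symm

theorem horProj_mem {x : X} (h : D.HorBijectiveAt x) (v : TangentSpace I x) :
    D.horProj x v ∈ D.hor x :=
  h.vertProj_eq_zero_iff.1 (h.vertProj_horProj v)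

theorem modelDeriv_proj_horLift {x : X} (h : D.HorBijectiveAt x)
    (w : TangentSpace J (D.proj x)) : modelDeriv I J D.proj x (D.horLift x w) = w :=
  Function.invFun_eq (h.2 w)

theorem horLift_eq {x : X} (h : D.HorBijectiveAt x) {u : TangentSpace I x} (hu : u ∈ D.hor x)
    {w : TangentSpace J (D.proj x)} (huw : modelDeriv I J D.proj x u = w) : D.horLift x w = u :=
  congrArg Subtype.val (h.1 (a₁ := ⟨_, horLift_mem x w⟩) (a₂ := ⟨u, hu⟩)
    ((h.modelDeriv_proj_horLift w).trans huw.symm))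

theorem exists_linear_horLift {x : X} (h : D.HorBijectiveAt x) :
    ∃ L : E' →ₗ[ℝ] E, ∀ w : E', D.horLift x w = L w := by
  let projHor : D.hor x →ₗ[ℝ] E' :=
    (modelDeriv I J D.proj x).toLinearMap ∘ₗ ((D.hor x).subtype : D.hor x →ₗ[ℝ] E)
  let projHorEquiv := LinearEquiv.ofBijective projHor h
  exact ⟨((D.hor x).subtype : D.hor x →ₗ[ℝ] E) ∘ₗ projHorEquiv.symm.toLinearMap, fun w =>
    h.horLift_eq (projHorEquiv.symm w).2 (projHorEquiv.apply_symm_apply w)⟩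

end HorBijectiveAt

theorem IsMeanCurvature.d_cons {n : ℕ} {ν : Form I X n} {k : OneForm I X}
    (hk : D.IsMeanCurvature ν k) {x : X}
    (hfrob : ∀ e ∈ D.vert x, ∀ u, D.frobenius x u e = 0 ∧ D.frobenius x e u = 0)
    (hmetric : ∀ w, D.metric x 0 w = 0) {e : Fin n → D.vert x} (he : D.IsOrthonormal x e)
    (h : TangentSpace I x) :
    Form.d ν x (Fin.cons h fun i => (e i : TangentSpace I x)) =
      k x h * ν x fun i => (e i : TangentSpace I x) := by
  let v : Fin (n + 1) → TangentSpace I x := Fin.cons h fun i => e i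
  have hzero (j l : Fin (n + 1)) (hjl : j ≠ l) : D.frobenius x (v j) (v l) = 0 := by
    cases l using Fin.cases with
    | zero =>
      obtain ⟨j, rfl⟩ := Fin.exists_succ_eq.2 hjl
      exact (hfrob _ (e j).2 _).2
    | succ l => exact (hfrob _ (e l).2 _).1
  rw [hk.eqn x e he, wedgeOne_cons _ _ _ _ fun i => hk.vertical x _ (e i).2,
    Finset.sum_eq_zero fun i _ => wedgeTwoContract_eq_zero _ _ _ _ fun j l hjl => ?_, add_zero]
  · rfl
  · rw [hzero j l hjl, hmetric]

section Chart

theorem vertProjInChart_apply (x₀ : X) (y w : E) :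
    D.vertProjInChart x₀ y w =
      modelDeriv I 𝓘(ℝ, E) (extChartAt I x₀) ((extChartAt I x₀).symm y)
        (D.vertProj ((extChartAt I x₀).symm y)
          (modelDeriv 𝓘(ℝ, E) I (extChartAt I x₀).symm y w)).1 :=
  rfl

variable [IsManifold I ∞ X] [I.Boundaryless]

theorem vertProjInChart_extChartAt_self (x₀ : X) (w : E) :
    D.vertProjInChart x₀ (extChartAt I x₀ x₀) w = (D.vertProj x₀ w).1 := by
  have hself (x : X) (hx : x = x₀) :
      modelDeriv I 𝓘(ℝ, E) (extChartAt I x₀) x (D.vertProj x w).1 = (D.vertProj x₀ w).1 := by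
    subst hx
    rw [modelDeriv_extChartAt_self]
    rfl
  rw [vertProjInChart_apply, modelDeriv_extChartAt_symm_self]
  exact hself _ (extChartAt_to_inv x₀)

theorem vectorInChart_horExtend (x₀ : X) (e : E) {y : E} (hy : y ∈ (extChartAt I x₀).target) :
    vectorInChart (D.horExtend x₀ e) x₀ y = e - D.vertProjInChart x₀ y e := by
  have hconst : ((mfderiv I 𝓘(ℝ, E) (extChartAt I x₀) ((extChartAt I x₀).symm y)).inverse
      (mfderiv I 𝓘(ℝ, E) (extChartAt I x₀) x₀ e) : E) =
        modelDeriv 𝓘(ℝ, E) I (extChartAt I x₀).symm y e :=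
    (DFunLike.congr_fun (inverse_mfderiv_extChartAt x₀ hy) _).trans
      (congrArg _ (DFunLike.congr_fun (modelDeriv_extChartAt_self x₀) e))
  unfold vectorInChart horExtend
  refine (congrArg (fun v : E => modelDeriv I 𝓘(ℝ, E) (extChartAt I x₀)
    ((extChartAt I x₀).symm y) (D.horProj ((extChartAt I x₀).symm y) v)) hconst).trans ?_
  refine (map_sub (modelDeriv I 𝓘(ℝ, E) (extChartAt I x₀) ((extChartAt I x₀).symm y)) _ _).trans ?_
  exact congrArg (· - D.vertProjInChart x₀ y e)
    (DFunLike.congr_fun (modelDeriv_extChartAt_comp_symm x₀ hy) e)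

theorem HorBijectiveAt.vertProjInChart_idem {x₀ : X} {y : E} (hy : y ∈ (extChartAt I x₀).target)
    (h : D.HorBijectiveAt ((extChartAt I x₀).symm y)) (w : E) :
    D.vertProjInChart x₀ y (D.vertProjInChart x₀ y w) = D.vertProjInChart x₀ y w := by
  set v := D.vertProj ((extChartAt I x₀).symm y) (modelDeriv 𝓘(ℝ, E) I (extChartAt I x₀).symm y w)
  have hcancel := DFunLike.congr_fun (modelDeriv_extChartAt_symm_comp x₀ hy) v.1
  refine congrArg (modelDeriv I 𝓘(ℝ, E) (extChartAt I x₀) ((extChartAt I x₀).symm y)) ?_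
  exact (congrArg (fun u : E => (D.vertProj ((extChartAt I x₀).symm y) u).1) hcancel).trans
    (h.vertProj_of_mem_vert v.2)

-- `horExtend x₀ e` vanishes at `x₀`, so that only its derivative enters the Lie bracket.
theorem HorBijectiveAt.frobenius_eq_zero {x₀ : X} (h : D.HorBijectiveAt x₀) {e : E}
    (he : e ∈ D.vert x₀)
    (hderiv : ∀ b : E, D.vertProj x₀
      (fderiv ℝ (fun y => D.vertProjInChart x₀ y e) (extChartAt I x₀ x₀) b : E) = 0)
    (u : TangentSpace I x₀) : D.frobenius x₀ u e = 0 ∧ D.frobenius x₀ e u = 0 := by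
  have hchart : vectorInChart (D.horExtend x₀ e) x₀ =ᶠ[𝓝 (extChartAt I x₀ x₀)]
      fun y => e - D.vertProjInChart x₀ y e := by
    filter_upwards [eventually_mem_extChartAt_target x₀] with y hy
    exact vectorInChart_horExtend x₀ e hy
  have hzero : D.horExtend x₀ e x₀ = 0 := by
    rw [← vectorInChart_extChartAt_self (D.horExtend x₀ e)]
    refine hchart.self_of_nhds.trans (sub_eq_zero.2 ?_)
    exact ((vertProjInChart_extChartAt_self x₀ e).trans (h.vertProj_of_mem_vert he)).symm
  have hbracket : D.vertProj x₀
      (VectorField.mlieBracket I (D.horExtend x₀ u) (D.horExtend x₀ e) x₀) = 0 := by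
    rw [mlieBracket_eq_fderiv_of_eq_zero hzero, hchart.fderiv_eq, fderiv_const_sub]
    exact (map_neg (D.vertProj x₀) _).trans (neg_eq_zero.2 (hderiv _))
  constructor
  · unfold frobenius
    rw [hbracket, neg_zero]
  · unfold frobenius
    rw [VectorField.mlieBracket_swap_apply, map_neg, hbracket, neg_zero, neg_zero]

namespace IsMetricFamily

variable {n : ℕ}

theorem continuousAt_vertProjInChart_apply (hD : D.IsMetricFamily n) (x₀ : X) (w : E) :
    ContinuousAt (fun y => D.vertProjInChart x₀ y w) (extChartAt I x₀ x₀) := by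
  let constField (x : X) : TangentSpace I x :=
    (modelDeriv 𝓘(ℝ, E) I (extChartAt I x₀).symm (extChartAt I x₀ x) w : E)
  have hconst : ContMDiffAt I 𝓘(ℝ, E) ∞
      (fun x => modelDeriv I 𝓘(ℝ, E) (extChartAt I x₀) x (constField x)) x₀ := by
    refine (contMDiffAt_const (c := w)).congr_of_eventuallyEq ?_
    filter_upwards [extChartAt_source_mem_nhds (I := I) x₀] with x hx
    have hcancel :=
      DFunLike.congr_fun (modelDeriv_extChartAt_comp_symm x₀ ((extChartAt I x₀).map_source hx)) w
    rwa [(extChartAt I x₀).left_inv hx] at hcancel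
  have hvert := ((contMDiffAt_vectorField_iff _).1 (hD.smooth_hor x₀ constField
    ((contMDiffAt_vectorField_iff _).2 hconst))).continuousAt
  refine (ContinuousAt.comp_of_eq hvert (continuousAt_extChartAt_symm x₀)
    (extChartAt_to_inv x₀)).congr ?_
  filter_upwards [eventually_mem_extChartAt_target x₀] with y hy
  simp only [Function.comp_apply, constField]
  rw [(extChartAt I x₀).right_inv hy]
  rfl

-- For the projection `P = vertProjInChart x₀` this is the identity `P P' P = 0`, which results from
-- differentiating `P ^ 2 = P`.
theorem vertProj_fderiv_vertProjInChart [FiniteDimensional ℝ E] (hD : D.IsMetricFamily n) {x₀ : X}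
    {e : E} (he : e ∈ D.vert x₀) (b : E) :
    D.vertProj x₀ (fderiv ℝ (fun y => D.vertProjInChart x₀ y e) (extChartAt I x₀ x₀) b : E) =
      0 := by
  let P (y : E) : E →L[ℝ] E := LinearMap.toContinuousLinearMap (D.vertProjInChart x₀ y)
  have hP : ContinuousAt P (extChartAt I x₀ x₀) :=
    continuousAt_clm_apply.2 (hD.continuousAt_vertProjInChart_apply x₀)
  have hcompl : ∀ᶠ y in 𝓝 (extChartAt I x₀ x₀), P y (e - P y e) = 0 := by
    filter_upwards [eventually_mem_extChartAt_target x₀] with y hy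
    rw [map_sub]
    exact sub_eq_zero.2 ((hD.horBijectiveAt _).vertProjInChart_idem hy e).symm
  have hcentre : e - P (extChartAt I x₀ x₀) e = 0 :=
    sub_eq_zero.2 ((vertProjInChart_extChartAt_self x₀ e).trans
      ((hD.horBijectiveAt x₀).vertProj_of_mem_vert he)).symm
  have hderiv := apply_fderiv_eq_zero_of_eventually_apply_eq_zero hP hcentre hcompl b
  rw [fderiv_const_sub, neg_apply, map_neg, neg_eq_zero] at hderiv
  exact Subtype.ext ((vertProjInChart_extChartAt_self (E := E) x₀ _).symm.trans hderiv)

end IsMetricFamily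

end Chart

section Metric

variable [IsManifold I ∞ X] {n : ℕ}

theorem IsMetricFamily.metric_zero (hD : D.IsMetricFamily n) (x : X) (w : D.vert x) :
    D.metric x 0 w = 0 := by
  simpa using hD.metric_smul x 0 0 w

theorem IsMetricFamily.exists_orthonormal_basis [FiniteDimensional ℝ E] (hD : D.IsMetricFamily n)
    (x : X) : ∃ e : Module.Basis (Fin n) ℝ (D.vert x), D.IsOrthonormal x e := by
  have : FiniteDimensional ℝ (TangentSpace I x) := inferInstanceAs (FiniteDimensional ℝ E)
  exact exists_basis_orthonormal_of_finrank_eq (hD.finrank_vert x) (D.metric x) (hD.metric_add x)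
    (hD.metric_smul x) (hD.metric_symm x) (hD.metric_pos x)

end Metric

end FamilyData

section LocalProduct

variable {E H E' H' E'' H'' X S F : Type*} [NormedAddCommGroup E] [NormedSpace ℝ E]
    [TopologicalSpace H] {I : ModelWithCorners ℝ E H} [TopologicalSpace X] [ChartedSpace H X]
    [NormedAddCommGroup E'] [NormedSpace ℝ E'] [TopologicalSpace H'] {J : ModelWithCorners ℝ E' H'}
    [TopologicalSpace S] [ChartedSpace H' S]
    [NormedAddCommGroup E''] [NormedSpace ℝ E''] [TopologicalSpace H'']
    {K : ModelWithCorners ℝ E'' H''} [TopologicalSpace F] [ChartedSpace H'' F]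

theorem injOn_ker_modelDeriv_of_leftInverse {π : X → S} {fib : X → F} {inv : S × F → X} {x : X}
    (hπ : MDifferentiableAt I J π x) (hfib : MDifferentiableAt I K fib x)
    (hinv : MDifferentiableAt (J.prod K) I inv (π x, fib x))
    (hleft : ∀ᶠ y in 𝓝 x, inv (π y, fib y) = y) :
    Set.InjOn (modelDeriv I K fib x) (LinearMap.ker (modelDeriv I J π x : E →ₗ[ℝ] E') : Set E) := by
  have hid := modelDeriv_comp (f := fun y => (π y, fib y)) hinv (hπ.prodMk hfib)
  rw [modelDeriv_congr hleft, modelDeriv_id, modelDeriv_prodMk hπ hfib] at hid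
  intro u hu v hv huv
  have hprod : (modelDeriv I J π x).prod (modelDeriv I K fib x) u =
      (modelDeriv I J π x).prod (modelDeriv I K fib x) v :=
    Prod.ext (Eq.trans (b := (0 : E')) hu (Eq.symm hv)) huv
  exact (DFunLike.congr_fun hid u).trans ((congrArg _ hprod).trans (DFunLike.congr_fun hid v).symm)

theorem surjOn_ker_modelDeriv_of_rightInverse {π : X → S} {fib : X → F} {inv : S × F → X}
    {s : S} {f : F} (hπ : MDifferentiableAt I J π (inv (s, f)))
    (hfib : MDifferentiableAt I K fib (inv (s, f)))
    (hinv : MDifferentiableAt (J.prod K) I inv (s, f)) (hright : ∀ f', π (inv (s, f')) = s)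
    (hright' : ∀ f', fib (inv (s, f')) = f') :
    Set.SurjOn (modelDeriv I K fib (inv (s, f)))
      (LinearMap.ker (modelDeriv I J π (inv (s, f)) : E →ₗ[ℝ] E') : Set E) Set.univ := by
  have hslice : MDifferentiableAt K I (fun f' => inv (s, f')) f :=
    hinv.comp (f := fun f' : F => (s, f')) f (mdifferentiableAt_const.prodMk mdifferentiableAt_id)
  have hbase := modelDeriv_comp (f := fun f' => inv (s, f')) hπ hslice
  have hfibre := modelDeriv_comp (f := fun f' => inv (s, f')) hfib hslice
  simp only [hright, modelDeriv_const] at hbase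
  simp only [hright', modelDeriv_id] at hfibre
  exact fun w _ => ⟨modelDeriv K I (fun f' => inv (s, f')) f w,
    (DFunLike.congr_fun hbase w).symm, (DFunLike.congr_fun hfibre w).symm⟩

end LocalProduct

namespace FamilyData.IsGeometricFamily

variable {E H E' H' X S : Type*} [NormedAddCommGroup E] [NormedSpace ℝ E]
    [TopologicalSpace H] {I : ModelWithCorners ℝ E H} [TopologicalSpace X] [ChartedSpace H X]
    [NormedAddCommGroup E'] [NormedSpace ℝ E'] [TopologicalSpace H'] {J : ModelWithCorners ℝ E' H'}
    [TopologicalSpace S] [ChartedSpace H' S] {D : FamilyData I J X S} [IsManifold I ∞ X] {n : ℕ}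
    {F : Type*} [TopologicalSpace F] [ChartedSpace (EuclideanSpace ℝ (Fin n)) F]

theorem finrank_vert (hD : D.IsGeometricFamily n F) (x : X) : Module.finrank ℝ (D.vert x) = n := by
  obtain ⟨U, fib, inv, hU, hxU, hfib, hinv, hright, hleft⟩ := hD.locally_trivial (D.proj x)
  have hpreimage : D.proj ⁻¹' U ∈ 𝓝 x := (hU.preimage hD.contMDiff_proj.continuous).mem_nhds hxU
  have hfib_x : MDifferentiableAt I (𝓡 n) fib x :=
    (hfib.contMDiffAt hpreimage).mdifferentiableAt (by simp)
  have hproj_x : MDifferentiableAt I J D.proj x := hD.contMDiff_proj.mdifferentiable (by simp) x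
  have hinv_x : MDifferentiableAt (J.prod (𝓡 n)) I inv (D.proj x, fib x) :=
    (hinv.contMDiffAt ((hU.prod isOpen_univ).mem_nhds ⟨hxU, trivial⟩)).mdifferentiableAt (by simp)
  have hx : inv (D.proj x, fib x) = x := hleft x hxU
  let vertSet : Set E := LinearMap.ker (modelDeriv I J D.proj x : E →ₗ[ℝ] E')
  have hinj : Set.InjOn (modelDeriv I (𝓡 n) fib x) vertSet :=
    injOn_ker_modelDeriv_of_leftInverse hproj_x hfib_x hinv_x
      (Filter.eventually_of_mem hpreimage hleft)
  have hsurj : Set.SurjOn (modelDeriv I (𝓡 n) fib x) vertSet Set.univ := by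
    have hsurj_inv := surjOn_ker_modelDeriv_of_rightInverse (s := D.proj x) (f := fib x)
      (hx.symm ▸ hproj_x) (hx.symm ▸ hfib_x) hinv_x (fun f => (hright _ hxU f).1)
      (fun f => (hright _ hxU f).2)
    rwa [hx] at hsurj_inv
  let fibDeriv : D.vert x →ₗ[ℝ] EuclideanSpace ℝ (Fin n) :=
    (modelDeriv I (𝓡 n) fib x).toLinearMap ∘ₗ ((D.vert x).subtype : D.vert x →ₗ[ℝ] E)
  have hbij : Function.Bijective fibDeriv := by
    refine ⟨fun u v huv => Subtype.ext (hinj u.2 v.2 huv), fun w => ?_⟩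
    obtain ⟨v, hv, rfl⟩ := hsurj (Set.mem_univ w)
    exact ⟨⟨v, hv⟩, rfl⟩
  rw [(LinearEquiv.ofBijective fibDeriv hbij).finrank_eq, finrank_euclideanSpace_fin]

theorem isMetricFamily (hD : D.IsGeometricFamily n F) : D.IsMetricFamily n where
  contMDiff_proj := hD.contMDiff_proj
  horBijectiveAt := hD.hor_bijective
  smooth_hor := hD.smooth_hor
  finrank_vert := hD.finrank_vert
  metric_add := hD.metric_add
  metric_smul := hD.metric_smul
  metric_symm := hD.metric_symm
  metric_pos := hD.metric_pos

end FamilyData.IsGeometricFamily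

namespace PrincipalBundle

variable {EG EQ EM G Q M : Type*}
    [NormedAddCommGroup EG] [NormedSpace ℝ EG] [NormedAddCommGroup EQ] [NormedSpace ℝ EQ]
    [NormedAddCommGroup EM] [NormedSpace ℝ EM]
    [Group G] [TopologicalSpace G] [ChartedSpace EG G]
    [TopologicalSpace Q] [ChartedSpace EQ Q] [TopologicalSpace M] [ChartedSpace EM M]
    [MulAction Gᵐᵒᵖ Q] (P : PrincipalBundle EG EQ EM G Q M)

include P in
theorem contMDiff_op_smul (g : G) : ContMDiff 𝓘(ℝ, EQ) 𝓘(ℝ, EQ) ∞ (fun q : Q => op g • q) :=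
  P.contMDiff_act.comp (contMDiff_id.prodMk contMDiff_const)

section AssocManifold

variable {Y : Type*} [MulAction G Y]

theorem assocMk_act (g : G) (z : Q × Y) : P.assocMk (op g • z.1, g⁻¹ • z.2) = P.assocMk z :=
  (P.assocMk_eq.2 ⟨g, rfl⟩).symm

/-- The local trivialization used by the preferred chart of `Y_Q` at `y₀`. -/
noncomputable def trivAt (y₀ : P.Assoc Y) : LocalTriv EG EQ EM G P.proj :=
  (P.locally_trivial (P.assocBase y₀)).choose

theorem assocBase_mem_trivAt (y₀ : P.Assoc Y) : P.assocBase y₀ ∈ (P.trivAt y₀).base :=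
  (P.locally_trivial (P.assocBase y₀)).choose_spec

variable [TopologicalSpace Y]

theorem eventually_assocBase_mem_trivAt (y₀ : P.Assoc Y) :
    ∀ᶠ y in 𝓝 y₀, P.assocBase y ∈ (P.trivAt y₀).base :=
  ((P.trivAt y₀).isOpen_base.preimage P.continuous_assocBase).mem_nhds (P.assocBase_mem_trivAt y₀)

theorem eventually_proj_mem_trivAt (z : Q × Y) :
    ∀ᶠ w in 𝓝 z, P.proj w.1 ∈ (P.trivAt (P.assocMk z)).base :=
  P.isQuotientMap_assocMk.continuous.continuousAt.eventually
    (P.eventually_assocBase_mem_trivAt (P.assocMk z))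

variable [ContinuousSMul G Y] {EY : Type*} [NormedAddCommGroup EY] [NormedSpace ℝ EY]
    [ChartedSpace EY Y]

theorem extChartAt_assoc_apply (y₀ y : P.Assoc Y) :
    extChartAt (𝓘(ℝ, EM).prod 𝓘(ℝ, EY)) y₀ y =
      extChartAt (𝓘(ℝ, EM).prod 𝓘(ℝ, EY)) (assocFun (P.trivAt y₀) y₀)
        (assocFun (P.trivAt y₀) y) := rfl

theorem extChartAt_assoc_symm_apply (y₀ : P.Assoc Y) (p : EM × EY) :
    (extChartAt (𝓘(ℝ, EM).prod 𝓘(ℝ, EY)) y₀).symm p =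
      P.assocMk ((P.trivAt y₀).sec ((extChartAt 𝓘(ℝ, EM) (assocFun (P.trivAt y₀) y₀).1).symm p.1),
        (extChartAt 𝓘(ℝ, EY) (assocFun (P.trivAt y₀) y₀).2).symm p.2) := rfl

theorem contMDiffAt_assocFun (y₀ : P.Assoc Y) :
    ContMDiffAt (𝓘(ℝ, EM).prod 𝓘(ℝ, EY)) (𝓘(ℝ, EM).prod 𝓘(ℝ, EY)) ∞
      (assocFun (P.trivAt y₀) (Y := Y)) y₀ :=
  contMDiffAt_iff_target.2
    ⟨(assocHomeo (P.trivAt y₀) Y).continuousAt (P.assocBase_mem_trivAt y₀), contMDiffAt_extChartAt⟩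

variable [ContMDiffSMul 𝓘(ℝ, EG) 𝓘(ℝ, EY) ∞ G Y]

omit [ContinuousSMul G Y] in
theorem contMDiffAt_localTriv (t : LocalTriv EG EQ EM G P.proj) {z : Q × Y}
    (hz : P.proj z.1 ∈ t.base) :
    ContMDiffAt (𝓘(ℝ, EQ).prod 𝓘(ℝ, EY)) (𝓘(ℝ, EM).prod 𝓘(ℝ, EY)) ∞
      (fun z : Q × Y => (P.proj z.1, t.fib z.1 • z.2)) z := by
  have hfib : ContMDiffAt 𝓘(ℝ, EQ) 𝓘(ℝ, EG) ∞ t.fib z.1 := t.smooth_fib.contMDiffAt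
    ((t.isOpen_base.preimage P.contMDiff_proj.continuous).mem_nhds hz)
  exact (P.contMDiff_proj.contMDiffAt.comp z contMDiffAt_fst).prodMk
    ((hfib.comp z contMDiffAt_fst).smul contMDiffAt_snd)

theorem contMDiff_assocMk :
    ContMDiff (𝓘(ℝ, EQ).prod 𝓘(ℝ, EY)) (𝓘(ℝ, EM).prod 𝓘(ℝ, EY)) ∞ (P.assocMk (Y := Y)) := by
  intro z
  have hz : P.proj z.1 ∈ (P.trivAt (P.assocMk z)).base := P.assocBase_mem_trivAt (P.assocMk z)
  have hchart := contMDiffAt_extChartAt (I := 𝓘(ℝ, EM).prod 𝓘(ℝ, EY)) (n := ∞)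
    (x := assocFun (P.trivAt (P.assocMk z)) (P.assocMk z))
  rw [assocFun_mk _ _ hz] at hchart
  refine contMDiffAt_iff_target.2 ⟨P.isQuotientMap_assocMk.continuous.continuousAt, ?_⟩
  refine (hchart.comp z (P.contMDiffAt_localTriv _ hz)).congr_of_eventuallyEq ?_
  filter_upwards [P.eventually_proj_mem_trivAt z] with w hw
  simp only [Function.comp_apply, extChartAt_assoc_apply]
  rw [assocFun_mk _ _ hw, assocFun_mk _ _ hz]

theorem mdifferentiableAt_assocMk (z : Q × Y) :
    MDifferentiableAt (𝓘(ℝ, EQ).prod 𝓘(ℝ, EY)) (𝓘(ℝ, EM).prod 𝓘(ℝ, EY)) P.assocMk z :=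
  (P.contMDiff_assocMk z).mdifferentiableAt (by simp)

end AssocManifold

section AssocSec

variable {Y : Type*} [MulAction G Y]

/-- A local section of the quotient map `Q × Y → Y_Q` whose image contains `z`. -/
noncomputable def assocSec (z : Q × Y) (y : P.Assoc Y) : Q × Y :=
  let t := P.trivAt (P.assocMk z)
  (op (t.fib z.1) • t.sec (assocFun t y).1, (t.fib z.1)⁻¹ • (assocFun t y).2)

theorem assocSec_self (z : Q × Y) : P.assocSec z (P.assocMk z) = z := by
  have hz : P.proj z.1 ∈ (P.trivAt (P.assocMk z)).base := P.assocBase_mem_trivAt (P.assocMk z)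
  simp [assocSec, assocFun_mk _ z hz, (P.trivAt (P.assocMk z)).left_inv z.1 hz]

theorem assocSec_assocMk_act (z : Q × Y) {w : Q × Y}
    (hw : P.proj w.1 ∈ (P.trivAt (P.assocMk z)).base) :
    let t := P.trivAt (P.assocMk z)
    let g := (t.fib z.1)⁻¹ * t.fib w.1
    (op g • (P.assocSec z (P.assocMk w)).1, g⁻¹ • (P.assocSec z (P.assocMk w)).2) = w := by
  simp [assocSec, assocFun_mk _ w hw, smul_smul, ← op_mul, mul_assoc,
    (P.trivAt (P.assocMk z)).left_inv w.1 hw]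

variable [TopologicalSpace Y] [ContinuousSMul G Y]

theorem eventually_assocMk_assocSec (z : Q × Y) :
    ∀ᶠ y in 𝓝 (P.assocMk z), P.assocMk (P.assocSec z y) = y := by
  filter_upwards [P.eventually_assocBase_mem_trivAt (P.assocMk z)] with y hy
  exact (P.assocMk_act _ (_, _)).trans ((assocHomeo (P.trivAt (P.assocMk z)) Y).left_inv hy)

variable {EY : Type*} [NormedAddCommGroup EY] [NormedSpace ℝ EY] [ChartedSpace EY Y]
    [ContMDiffSMul 𝓘(ℝ, EG) 𝓘(ℝ, EY) ∞ G Y]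

theorem contMDiffAt_assocSec (z : Q × Y) :
    ContMDiffAt (𝓘(ℝ, EM).prod 𝓘(ℝ, EY)) (𝓘(ℝ, EQ).prod 𝓘(ℝ, EY)) ∞ (P.assocSec z)
      (P.assocMk z) := by
  let t := P.trivAt (P.assocMk z)
  have hfun := P.contMDiffAt_assocFun (EY := EY) (P.assocMk z)
  have hbase : (assocFun t (P.assocMk z)).1 ∈ t.base :=
    ((assocHomeo t Y).map_source (P.assocBase_mem_trivAt (P.assocMk z))).1
  have hsec : ContMDiffAt 𝓘(ℝ, EM) 𝓘(ℝ, EQ) ∞ t.sec (assocFun t (P.assocMk z)).1 :=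
    t.smooth_sec.contMDiffAt (t.isOpen_base.mem_nhds hbase)
  have hfst : ContMDiffAt (𝓘(ℝ, EM).prod 𝓘(ℝ, EY)) 𝓘(ℝ, EQ) ∞
      (fun y : P.Assoc Y => t.sec (assocFun t y).1) (P.assocMk z) :=
    hsec.comp (P.assocMk z) (contMDiffAt_fst.comp (P.assocMk z) hfun)
  have hsnd : ContMDiffAt (𝓘(ℝ, EM).prod 𝓘(ℝ, EY)) 𝓘(ℝ, EY) ∞
      (fun y : P.Assoc Y => (assocFun t y).2) (P.assocMk z) :=
    contMDiffAt_snd.comp (P.assocMk z) hfun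
  exact ((P.contMDiff_op_smul (t.fib z.1)).contMDiffAt.comp _ hfst).prodMk
    ((ContMDiffSMul.contMDiff_const_smul (I := 𝓘(ℝ, EG)) (t.fib z.1)⁻¹).contMDiffAt.comp _ hsnd)

theorem mdifferentiableAt_assocSec (z : Q × Y) :
    MDifferentiableAt (𝓘(ℝ, EM).prod 𝓘(ℝ, EY)) (𝓘(ℝ, EQ).prod 𝓘(ℝ, EY)) (P.assocSec z)
      (P.assocMk z) :=
  (P.contMDiffAt_assocSec z).mdifferentiableAt (by simp)

end AssocSec

section AssocMkDeriv

variable {Y EY : Type*} [MulAction G Y] [TopologicalSpace Y] [ContinuousSMul G Y]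
    [NormedAddCommGroup EY] [NormedSpace ℝ EY] [ChartedSpace EY Y]

/-- The differential `assocDeriv` of the quotient map `Q × Y → Y_Q`, regarded as a map between the
model spaces. -/
noncomputable def assocMkDeriv (z : Q × Y) : EQ × EY →L[ℝ] EM × EY :=
  modelDeriv (𝓘(ℝ, EQ).prod 𝓘(ℝ, EY)) (𝓘(ℝ, EM).prod 𝓘(ℝ, EY)) P.assocMk z

variable [ContMDiffSMul 𝓘(ℝ, EG) 𝓘(ℝ, EY) ∞ G Y]

omit [ContinuousSMul G Y] in
include P in
theorem modelDeriv_act (g : G) (z : Q × Y) :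
    modelDeriv (𝓘(ℝ, EQ).prod 𝓘(ℝ, EY)) (𝓘(ℝ, EQ).prod 𝓘(ℝ, EY))
      (fun p : Q × Y => ((op g • p.1, g⁻¹ • p.2) : Q × Y)) z =
      (modelDeriv 𝓘(ℝ, EQ) 𝓘(ℝ, EQ) (fun q : Q => op g • q) z.1).prodMap
        (modelDeriv 𝓘(ℝ, EY) 𝓘(ℝ, EY) (fun y : Y => g⁻¹ • y) z.2) :=
  mfderiv_prodMap ((P.contMDiff_op_smul g).mdifferentiable (by simp) z.1)
    ((ContMDiffSMul.contMDiff_const_smul (n := ∞) (I := 𝓘(ℝ, EG)) g⁻¹).mdifferentiable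
      (by simp) z.2)

section Generator

variable [LieGroup 𝓘(ℝ, EG) ∞ G]

omit [ContinuousSMul G Y] in
include P in
theorem contMDiff_act_prod :
    ContMDiff ((𝓘(ℝ, EQ).prod 𝓘(ℝ, EY)).prod 𝓘(ℝ, EG)) (𝓘(ℝ, EQ).prod 𝓘(ℝ, EY)) ∞
      (fun p : (Q × Y) × G => ((op p.2 • p.1.1, p.2⁻¹ • p.1.2) : Q × Y)) :=
  (P.contMDiff_act.comp ((contMDiff_fst.comp contMDiff_fst).prodMk contMDiff_snd)).prodMk
    (((contMDiff_inv 𝓘(ℝ, EG) ∞).comp contMDiff_snd).smul (contMDiff_snd.comp contMDiff_fst))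

omit [ContinuousSMul G Y] in
include P in
theorem mdifferentiableAt_orbit (z : Q × Y) (g : G) :
    MDifferentiableAt 𝓘(ℝ, EG) (𝓘(ℝ, EQ).prod 𝓘(ℝ, EY))
      (fun g : G => ((op g • z.1, g⁻¹ • z.2) : Q × Y)) g :=
  (P.contMDiff_act_prod.comp (contMDiff_const.prodMk contMDiff_id)).mdifferentiable (by simp) g

omit [ContinuousSMul G Y] in
include P in
theorem generator_eq_modelDeriv_act (v : GroupLieAlgebra 𝓘(ℝ, EG) G) (z : Q × Y) :
    (generator EQ v z : EQ × EY) =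
      modelDeriv ((𝓘(ℝ, EQ).prod 𝓘(ℝ, EY)).prod 𝓘(ℝ, EG)) (𝓘(ℝ, EQ).prod 𝓘(ℝ, EY))
        (fun p : (Q × Y) × G => ((op p.2 • p.1.1, p.2⁻¹ • p.1.2) : Q × Y)) (z, 1) (0, v) := by
  have hconst : MDifferentiableAt 𝓘(ℝ, EG) (𝓘(ℝ, EQ).prod 𝓘(ℝ, EY)) (fun _ : G => z) 1 :=
    mdifferentiableAt_const
  have hid : MDifferentiableAt 𝓘(ℝ, EG) 𝓘(ℝ, EG) (fun g : G => g) 1 := mdifferentiableAt_id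
  have hcomp := modelDeriv_comp ((P.contMDiff_act_prod (Y := Y) (EY := EY)).mdifferentiable
    (by simp) _) (hconst.prodMk hid)
  rw [modelDeriv_prodMk hconst hid, modelDeriv_const, modelDeriv_id] at hcomp
  exact DFunLike.congr_fun hcomp v

omit [ContinuousSMul G Y] in
include P in
theorem generator_fst (v : GroupLieAlgebra 𝓘(ℝ, EG) G) (z : Q × Y) :
    (generator EQ v z : EQ × EY).1 =
      modelDeriv 𝓘(ℝ, EG) 𝓘(ℝ, EQ) (fun g : G => op g • z.1) 1 v := by
  have hcomp := modelDeriv_comp (g := fun p : Q × Y => p.1) mdifferentiableAt_fst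
    (P.mdifferentiableAt_orbit (EY := EY) z 1)
  rw [modelDeriv_fst] at hcomp
  exact (DFunLike.congr_fun hcomp v).symm

end Generator

theorem assocMkDeriv_act (g : G) (z : Q × Y) (w : EQ × EY) :
    P.assocMkDeriv (op g • z.1, g⁻¹ • z.2)
      (modelDeriv 𝓘(ℝ, EQ) 𝓘(ℝ, EQ) (fun q : Q => op g • q) z.1 w.1,
        modelDeriv 𝓘(ℝ, EY) 𝓘(ℝ, EY) (fun y : Y => g⁻¹ • y) z.2 w.2) = P.assocMkDeriv z w := by
  have hact : ContMDiff (𝓘(ℝ, EQ).prod 𝓘(ℝ, EY)) (𝓘(ℝ, EQ).prod 𝓘(ℝ, EY)) ∞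
      (fun p : Q × Y => ((op g • p.1, g⁻¹ • p.2) : Q × Y)) :=
    (P.contMDiff_op_smul g).prodMap (ContMDiffSMul.contMDiff_const_smul (I := 𝓘(ℝ, EG)) g⁻¹)
  have hcomp := modelDeriv_comp (P.mdifferentiableAt_assocMk (EY := EY) _)
    (hact.mdifferentiable (by simp) z)
  simp only [assocMk_act, P.modelDeriv_act] at hcomp
  exact (DFunLike.congr_fun hcomp w).symm

theorem assocMkDeriv_surjective (z : Q × Y) :
    Function.Surjective (P.assocMkDeriv (EY := EY) z) := by
  intro w
  have hmk := P.mdifferentiableAt_assocMk (EY := EY) (P.assocSec z (P.assocMk z))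
  have hcomp := modelDeriv_comp hmk (P.mdifferentiableAt_assocSec z)
  rw [modelDeriv_congr (P.eventually_assocMk_assocSec z), modelDeriv_id, assocSec_self] at hcomp
  exact ⟨_, (DFunLike.congr_fun hcomp w).symm⟩

variable [LieGroup 𝓘(ℝ, EG) ∞ G]

theorem assocMkDeriv_generator (v : GroupLieAlgebra 𝓘(ℝ, EG) G) (z : Q × Y) :
    P.assocMkDeriv z (generator EQ v z : EQ × EY) = 0 := by
  have hmk := P.mdifferentiableAt_assocMk (EY := EY) (op (1 : G) • z.1, (1 : G)⁻¹ • z.2)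
  have hcomp := modelDeriv_comp (f := fun g : G => ((op g • z.1, g⁻¹ • z.2) : Q × Y)) hmk
    (P.mdifferentiableAt_orbit z 1)
  simp only [assocMk_act, modelDeriv_const] at hcomp
  simp only [op_one, inv_one, one_smul] at hcomp
  exact (DFunLike.congr_fun hcomp v).symm

/- Near `z` one has `p = σ [p] · γ p` with `σ` a local section of the quotient map and `γ z = 1`. -/
theorem exists_generator_eq_of_assocMkDeriv_eq_zero {z : Q × Y} {w : EQ × EY}
    (hw : P.assocMkDeriv z w = 0) :
    ∃ v : GroupLieAlgebra 𝓘(ℝ, EG) G, (generator EQ v z : EQ × EY) = w := by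
  let t := P.trivAt (P.assocMk z)
  let γ : Q × Y → G := fun p => (t.fib z.1)⁻¹ * t.fib p.1
  have hfib : ContMDiffAt 𝓘(ℝ, EQ) 𝓘(ℝ, EG) ∞ t.fib z.1 := t.smooth_fib.contMDiffAt
    ((t.isOpen_base.preimage P.contMDiff_proj.continuous).mem_nhds
      (P.assocBase_mem_trivAt (P.assocMk z)))
  have hγ : MDifferentiableAt (𝓘(ℝ, EQ).prod 𝓘(ℝ, EY)) 𝓘(ℝ, EG) γ z :=
    (contMDiffAt_const.mul (hfib.comp z contMDiffAt_fst)).mdifferentiableAt (by simp)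
  have hσ : MDifferentiableAt (𝓘(ℝ, EQ).prod 𝓘(ℝ, EY)) (𝓘(ℝ, EQ).prod 𝓘(ℝ, EY))
      (fun p => P.assocSec z (P.assocMk p)) z :=
    (P.mdifferentiableAt_assocSec z).comp z (P.mdifferentiableAt_assocMk z)
  have hcomp := modelDeriv_comp (x := z) (f := fun p => (P.assocSec z (P.assocMk p), γ p))
    ((P.contMDiff_act_prod (Y := Y) (EY := EY)).mdifferentiable (by simp) _) (hσ.prodMk hγ)
  have hid : (fun p => (op (γ p) • (P.assocSec z (P.assocMk p)).1,
      (γ p)⁻¹ • (P.assocSec z (P.assocMk p)).2)) =ᶠ[𝓝 z] fun p => p := by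
    filter_upwards [P.eventually_proj_mem_trivAt z] with p hp
    exact P.assocSec_assocMk_act z hp
  have hγz : γ z = 1 := inv_mul_cancel _
  rw [modelDeriv_congr hid, modelDeriv_id, modelDeriv_prodMk hσ hγ, hγz, assocSec_self] at hcomp
  have hσw : modelDeriv (𝓘(ℝ, EQ).prod 𝓘(ℝ, EY)) (𝓘(ℝ, EQ).prod 𝓘(ℝ, EY))
      (fun p => P.assocSec z (P.assocMk p)) z w = 0 := by
    rw [modelDeriv_comp (P.mdifferentiableAt_assocSec z) (P.mdifferentiableAt_assocMk z)]
    exact (congrArg (modelDeriv _ _ (P.assocSec z) (P.assocMk z)) hw).trans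
      (ContinuousLinearMap.map_zero _)
  refine ⟨(modelDeriv (𝓘(ℝ, EQ).prod 𝓘(ℝ, EY)) 𝓘(ℝ, EG) γ z w : EG), ?_⟩
  have hcompw := DFunLike.congr_fun hcomp w
  simp only [ContinuousLinearMap.comp_apply, ContinuousLinearMap.prod_apply, hσw] at hcompw
  exact (P.generator_eq_modelDeriv_act _ z).trans hcompw.symm

end AssocMkDeriv

section AssocMap

variable {Y EY Z EZ : Type*} [MulAction G Y] [TopologicalSpace Y] [ContinuousSMul G Y]
    [NormedAddCommGroup EY] [NormedSpace ℝ EY] [ChartedSpace EY Y]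
    [ContMDiffSMul 𝓘(ℝ, EG) 𝓘(ℝ, EY) ∞ G Y]
    [MulAction G Z] [TopologicalSpace Z] [ContinuousSMul G Z]
    [NormedAddCommGroup EZ] [NormedSpace ℝ EZ] [ChartedSpace EZ Z]
    [ContMDiffSMul 𝓘(ℝ, EG) 𝓘(ℝ, EZ) ∞ G Z]
    {f : Y → Z} (hf : ∀ (g : G) (y : Y), f (g • y) = g • f y)

theorem mdifferentiableAt_assocMap {z : Q × Y} (hfz : MDifferentiableAt 𝓘(ℝ, EY) 𝓘(ℝ, EZ) f z.2) :
    MDifferentiableAt (𝓘(ℝ, EM).prod 𝓘(ℝ, EY)) (𝓘(ℝ, EM).prod 𝓘(ℝ, EZ)) (P.assocMap f hf)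
      (P.assocMk z) := by
  have hσ := P.mdifferentiableAt_assocSec (EY := EY) z
  have hfst : MDifferentiableAt (𝓘(ℝ, EM).prod 𝓘(ℝ, EY)) 𝓘(ℝ, EQ)
      (fun y => (P.assocSec z y).1) (P.assocMk z) := mdifferentiableAt_fst.comp _ hσ
  have hsnd : MDifferentiableAt (𝓘(ℝ, EM).prod 𝓘(ℝ, EY)) 𝓘(ℝ, EY)
      (fun y => (P.assocSec z y).2) (P.assocMk z) := mdifferentiableAt_snd.comp _ hσ
  rw [← P.assocSec_self z] at hfz
  refine ((P.mdifferentiableAt_assocMk _).comp (P.assocMk z)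
    (hfst.prodMk (hfz.comp (P.assocMk z) hsnd))).congr_of_eventuallyEq ?_
  filter_upwards [P.eventually_assocMk_assocSec z] with y hy
  exact (congrArg (P.assocMap f hf) hy).symm

theorem modelDeriv_assocMap {z : Q × Y} (hfz : MDifferentiableAt 𝓘(ℝ, EY) 𝓘(ℝ, EZ) f z.2)
    (w : EQ × EY) :
    modelDeriv (𝓘(ℝ, EM).prod 𝓘(ℝ, EY)) (𝓘(ℝ, EM).prod 𝓘(ℝ, EZ)) (P.assocMap f hf) (P.assocMk z)
        (P.assocMkDeriv z w) =
      P.assocMkDeriv (z.1, f z.2) (w.1, modelDeriv 𝓘(ℝ, EY) 𝓘(ℝ, EZ) f z.2 w.2) := by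
  have hmap := modelDeriv_comp (P.mdifferentiableAt_assocMap hf hfz)
    (P.mdifferentiableAt_assocMk (EY := EY) z)
  have hid : MDifferentiableAt 𝓘(ℝ, EQ) 𝓘(ℝ, EQ) (fun q : Q => q) z.1 := mdifferentiableAt_id
  have hprod : modelDeriv (𝓘(ℝ, EQ).prod 𝓘(ℝ, EY)) (𝓘(ℝ, EQ).prod 𝓘(ℝ, EZ))
      (fun p : Q × Y => (p.1, f p.2)) z =
      (modelDeriv 𝓘(ℝ, EQ) 𝓘(ℝ, EQ) (fun q : Q => q) z.1).prodMap
        (modelDeriv 𝓘(ℝ, EY) 𝓘(ℝ, EZ) f z.2) := mfderiv_prodMap hid hfz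
  have hmk := modelDeriv_comp (f := fun p : Q × Y => (p.1, f p.2))
    (P.mdifferentiableAt_assocMk (EY := EZ) (z.1, f z.2)) (hid.prodMap hfz)
  rw [hprod, modelDeriv_id] at hmk
  exact DFunLike.congr_fun (hmap.symm.trans hmk) w

end AssocMap

end PrincipalBundle

namespace FamilyData.IsInvariant

variable {E H E' H' G X S : Type*} [NormedAddCommGroup E] [NormedSpace ℝ E]
    [TopologicalSpace H] {I : ModelWithCorners ℝ E H} [TopologicalSpace X] [ChartedSpace H X]
    [NormedAddCommGroup E'] [NormedSpace ℝ E'] [TopologicalSpace H'] {J : ModelWithCorners ℝ E' H'}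
    [TopologicalSpace S] [ChartedSpace H' S] {D : FamilyData I J X S}
    [Group G] [MulAction G X] [MulAction G S]

theorem smul_mem_hor (hG : D.IsInvariant G) (g : G) {x : X} {v : E} (hv : v ∈ D.hor x) :
    modelDeriv I I (fun x : X => g • x) x v ∈ D.hor (g • x) := by
  rw [← hG.hor_smul g x]
  exact ⟨v, hv, rfl⟩

theorem modelDeriv_proj_smul (hG : D.IsInvariant G) {g : G} {x : X}
    (hπ : MDifferentiable I J D.proj) (hX : MDifferentiableAt I I (fun x : X => g • x) x)
    (hS : MDifferentiableAt J J (fun s : S => g • s) (D.proj x)) (v : E) :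
    modelDeriv I J D.proj (g • x) (modelDeriv I I (fun x : X => g • x) x v) =
      modelDeriv J J (fun s : S => g • s) (D.proj x) (modelDeriv I J D.proj x v) := by
  have hleft := modelDeriv_comp (hπ (g • x)) hX
  have hright := modelDeriv_comp hS (hπ x)
  simp only [hG.proj_smul] at hleft
  exact DFunLike.congr_fun (hleft.symm.trans hright) v

theorem smul_mem_vert (hG : D.IsInvariant G) {g : G} {x : X} (hπ : MDifferentiable I J D.proj)
    (hX : MDifferentiableAt I I (fun x : X => g • x) x)
    (hS : MDifferentiableAt J J (fun s : S => g • s) (D.proj x)) {v : E} (hv : v ∈ D.vert x) :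
    modelDeriv I I (fun x : X => g • x) x v ∈ D.vert (g • x) :=
  mem_vert.2 ((hG.modelDeriv_proj_smul hπ hX hS v).trans
    ((congrArg _ (mem_vert.1 hv)).trans (ContinuousLinearMap.map_zero _)))

end FamilyData.IsInvariant

namespace PrincipalBundle

variable {EG EQ EM G Q M : Type*}
    [NormedAddCommGroup EG] [NormedSpace ℝ EG] [NormedAddCommGroup EQ] [NormedSpace ℝ EQ]
    [NormedAddCommGroup EM] [NormedSpace ℝ EM]
    [Group G] [TopologicalSpace G] [ChartedSpace EG G]
    [TopologicalSpace Q] [ChartedSpace EQ Q] [TopologicalSpace M] [ChartedSpace EM M]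
    [MulAction Gᵐᵒᵖ Q] {P : PrincipalBundle EG EQ EM G Q M} (Φ : P.Connection)

namespace Connection

/-- The connection form, regarded as a map between the model spaces. -/
noncomputable def modelForm (q : Q) : EQ →L[ℝ] EG := Φ.form q

theorem modelForm_act_eq_zero (g : G) {q : Q} {a : EQ} (ha : Φ.modelForm q a = 0) :
    Φ.modelForm (op g • q) (modelDeriv 𝓘(ℝ, EQ) 𝓘(ℝ, EQ) (fun q : Q => op g • q) q a) = 0 :=
  (Φ.equivariant g q a).trans ((congrArg
    (modelDeriv 𝓘(ℝ, EG) 𝓘(ℝ, EG) (fun h : G => g⁻¹ * h * g) 1) ha).trans (map_zero _))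

variable {Y EY : Type*} [MulAction G Y] [TopologicalSpace Y]
    [NormedAddCommGroup EY] [NormedSpace ℝ EY] [ChartedSpace EY Y]

/-- The component in `ker Φ ⊕ TY` of a tangent vector of `Q × Y`, along the vector fields generated
by `𝔤`. -/
noncomputable def horPart (z : Q × Y) (w : EQ × EY) : EQ × EY :=
  w - modelDeriv 𝓘(ℝ, EG) (𝓘(ℝ, EQ).prod 𝓘(ℝ, EY))
    (fun g : G => ((op g • z.1, g⁻¹ • z.2) : Q × Y)) 1 (Φ.modelForm z.1 w.1)

variable [ContMDiffSMul 𝓘(ℝ, EG) 𝓘(ℝ, EY) ∞ G Y] [LieGroup 𝓘(ℝ, EG) ∞ G]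

theorem modelForm_generator_fst (v : GroupLieAlgebra 𝓘(ℝ, EG) G) (z : Q × Y) :
    Φ.modelForm z.1 (generator EQ v z : EQ × EY).1 = v := by
  rw [P.generator_fst]
  exact Φ.form_generator z.1 v

theorem modelForm_horPart_fst (z : Q × Y) (w : EQ × EY) :
    Φ.modelForm z.1 (Φ.horPart z w).1 = 0 :=
  (map_sub (Φ.modelForm z.1) _ _).trans (sub_eq_zero.2 (Φ.modelForm_generator_fst _ z).symm)

variable [ContinuousSMul G Y]

theorem assocMkDeriv_horPart (z : Q × Y) (w : EQ × EY) :
    P.assocMkDeriv z (Φ.horPart z w) = P.assocMkDeriv z w := by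
  rw [horPart, map_sub]
  exact (congrArg _ (P.assocMkDeriv_generator _ z)).trans (sub_zero _)

theorem eq_zero_of_assocMkDeriv_eq_zero {z : Q × Y} {w : EQ × EY} (hform : Φ.modelForm z.1 w.1 = 0)
    (hw : P.assocMkDeriv z w = 0) : w = 0 := by
  obtain ⟨v, rfl⟩ := P.exists_generator_eq_of_assocMkDeriv_eq_zero hw
  rw [Φ.modelForm_generator_fst] at hform
  rw [hform]
  exact map_zero (modelDeriv 𝓘(ℝ, EG) (𝓘(ℝ, EQ).prod 𝓘(ℝ, EY))
    (fun g : G => ((op g • z.1, g⁻¹ • z.2) : Q × Y)) 1)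

theorem exists_assocMkDeriv_eq (z : Q × Y) (w : EM × EY) :
    ∃ w' : EQ × EY, Φ.modelForm z.1 w'.1 = 0 ∧ P.assocMkDeriv z w' = w := by
  obtain ⟨w', rfl⟩ := P.assocMkDeriv_surjective z w
  exact ⟨Φ.horPart z w', Φ.modelForm_horPart_fst z w', Φ.assocMkDeriv_horPart z w'⟩

include Φ in
theorem assocMkDeriv_zero_prod_injective (z : Q × Y) :
    Function.Injective fun v : EY => P.assocMkDeriv z ((0, v) : EQ × EY) := by
  refine fun v v' h => sub_eq_zero.1 (congrArg Prod.snd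
    (Φ.eq_zero_of_assocMkDeriv_eq_zero (z := z) (w := (0, v - v')) (map_zero _) ?_))
  rw [← sub_zero (0 : EQ), ← Prod.mk_sub_mk, map_sub]
  exact sub_eq_zero.2 h

include Φ in
theorem invFun_assocMkDeriv {z : Q × Y} (g : G) (V : Submodule ℝ EY) {u : EY} (u' : V)
    (hu : u'.1 = modelDeriv 𝓘(ℝ, EY) 𝓘(ℝ, EY) (fun y : Y => g⁻¹ • y) z.2 u) :
    Function.invFun (fun w : V => P.assocMkDeriv (op g • z.1, g⁻¹ • z.2) ((0, w.1) : EQ × EY))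
      (P.assocMkDeriv z ((0, u) : EQ × EY)) = u' := by
  have hinj : Function.Injective fun w : V =>
      P.assocMkDeriv (op g • z.1, g⁻¹ • z.2) ((0, w.1) : EQ × EY) :=
    (Φ.assocMkDeriv_zero_prod_injective _).comp Subtype.val_injective
  have hact := P.assocMkDeriv_act g z ((0, u) : EQ × EY)
  rw [map_zero, ← hu] at hact
  rw [← hact]
  exact Function.leftInverse_invFun hinj u'

end Connection

section AssocFamily

variable {EX ES X S : Type*} [NormedAddCommGroup EX] [NormedSpace ℝ EX]
    [NormedAddCommGroup ES] [NormedSpace ℝ ES]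
    [TopologicalSpace X] [ChartedSpace EX X] [TopologicalSpace S] [ChartedSpace ES S]
    [MulAction G X] [ContinuousSMul G X] [ContMDiffSMul 𝓘(ℝ, EG) 𝓘(ℝ, EX) ∞ G X]
    [MulAction G S] {D : FamilyData 𝓘(ℝ, EX) 𝓘(ℝ, ES) X S} (hG : D.IsInvariant G)

variable {Φ}

include hG in
theorem exists_hor_of_assocMk_eq {z z' : Q × X} (h : P.assocMk z = P.assocMk z') {w : EM × EX}
    (hw : ∃ u : EQ × EX, Φ.modelForm z.1 u.1 = 0 ∧ u.2 ∈ D.hor z.2 ∧ P.assocMkDeriv z u = w) :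
    ∃ u : EQ × EX, Φ.modelForm z'.1 u.1 = 0 ∧ u.2 ∈ D.hor z'.2 ∧ P.assocMkDeriv z' u = w := by
  obtain ⟨g, rfl⟩ := P.assocMk_eq.1 h
  obtain ⟨u, hform, hhor, rfl⟩ := hw
  exact ⟨_, Φ.modelForm_act_eq_zero g hform, hG.smul_mem_hor g⁻¹ hhor, P.assocMkDeriv_act g z u⟩

variable [ContinuousSMul G S]

theorem mem_assocFamily_hor {z : Q × X} {w : EM × EX} :
    w ∈ (assocFamily Φ D hG).hor (P.assocMk z) ↔
      ∃ u : EQ × EX, Φ.modelForm z.1 u.1 = 0 ∧ u.2 ∈ D.hor z.2 ∧ P.assocMkDeriv z u = w := by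
  have hout : w ∈ (assocFamily Φ D hG).hor (P.assocMk z) ↔ ∃ u : EQ × EX,
      Φ.modelForm (P.assocOut (P.assocMk z)).1 u.1 = 0 ∧
        u.2 ∈ D.hor (P.assocOut (P.assocMk z)).2 ∧
        P.assocMkDeriv (P.assocOut (P.assocMk z)) u = w :=
    ⟨fun ⟨u, ⟨hform, hhor⟩, hu⟩ => ⟨u, hform, hhor, hu⟩,
      fun ⟨u, hform, hhor, hu⟩ => ⟨u, ⟨hform, hhor⟩, hu⟩⟩
  exact hout.trans ⟨exists_hor_of_assocMk_eq hG (P.assocMk_out _),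
    exists_hor_of_assocMk_eq hG (P.assocMk_out _).symm⟩

variable [ContMDiffSMul 𝓘(ℝ, EG) 𝓘(ℝ, ES) ∞ G S]

theorem modelDeriv_assocFamily_proj (hπ : MDifferentiable 𝓘(ℝ, EX) 𝓘(ℝ, ES) D.proj) (z : Q × X)
    (w : EQ × EX) :
    modelDeriv (𝓘(ℝ, EM).prod 𝓘(ℝ, EX)) (𝓘(ℝ, EM).prod 𝓘(ℝ, ES)) (assocFamily Φ D hG).proj
        (P.assocMk z) (P.assocMkDeriv z w) =
      P.assocMkDeriv (z.1, D.proj z.2) (w.1, modelDeriv 𝓘(ℝ, EX) 𝓘(ℝ, ES) D.proj z.2 w.2) :=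
  P.modelDeriv_assocMap hG.proj_smul (hπ z.2) w

variable [LieGroup 𝓘(ℝ, EG) ∞ G]

theorem mem_assocFamily_vert (hπ : MDifferentiable 𝓘(ℝ, EX) 𝓘(ℝ, ES) D.proj) {z : Q × X}
    {w : EM × EX} :
    w ∈ (assocFamily Φ D hG).vert (P.assocMk z) ↔
      ∃ v : EX, v ∈ D.vert z.2 ∧ P.assocMkDeriv z ((0, v) : EQ × EX) = w := by
  constructor
  · intro hw
    obtain ⟨⟨a, v⟩, hform, rfl⟩ := Φ.exists_assocMkDeriv_eq z w
    have hzero := Φ.eq_zero_of_assocMkDeriv_eq_zero (z := (z.1, D.proj z.2))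
      (w := (a, modelDeriv 𝓘(ℝ, EX) 𝓘(ℝ, ES) D.proj z.2 v)) hform
      ((modelDeriv_assocFamily_proj hG hπ z (a, v)).symm.trans hw)
    obtain ⟨rfl, hv⟩ := Prod.mk_eq_zero.1 hzero
    exact ⟨v, hv, rfl⟩
  · rintro ⟨v, hv, rfl⟩
    refine (modelDeriv_assocFamily_proj hG hπ z (0, v)).trans ?_
    rw [FamilyData.mem_vert.1 hv]
    exact map_zero (P.assocMkDeriv _)

theorem assocFamily_horBijectiveAt (hπ : MDifferentiable 𝓘(ℝ, EX) 𝓘(ℝ, ES) D.proj) {z : Q × X}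
    (hb : D.HorBijectiveAt z.2) : (assocFamily Φ D hG).HorBijectiveAt (P.assocMk z) := by
  constructor
  · rintro ⟨w, hw⟩ ⟨w', hw'⟩ h
    refine Subtype.ext (sub_eq_zero.1 ?_)
    obtain ⟨⟨a, v⟩, hform, hhor, huw⟩ := (mem_assocFamily_hor hG).1 (Submodule.sub_mem _ hw hw')
    have hproj : P.assocMkDeriv (z.1, D.proj z.2)
        (a, modelDeriv 𝓘(ℝ, EX) 𝓘(ℝ, ES) D.proj z.2 v) = 0 := by
      refine (modelDeriv_assocFamily_proj (Φ := Φ) hG hπ z (a, v)).symm.trans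
        ((congrArg _ huw).trans ?_)
      exact (map_sub (modelDeriv (𝓘(ℝ, EM).prod 𝓘(ℝ, EX)) (𝓘(ℝ, EM).prod 𝓘(ℝ, ES))
        (assocFamily Φ D hG).proj (P.assocMk z)) (w : EM × EX) w').trans (sub_eq_zero.2 h)
    obtain ⟨ha, hπv⟩ := Prod.mk_eq_zero.1 (Φ.eq_zero_of_assocMkDeriv_eq_zero
      (z := (z.1, D.proj z.2)) (w := (a, modelDeriv 𝓘(ℝ, EX) 𝓘(ℝ, ES) D.proj z.2 v)) hform hproj)
    have hv : (⟨v, hhor⟩ : D.hor z.2) = 0 :=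
      hb.1 (hπv.trans (map_zero (modelDeriv 𝓘(ℝ, EX) 𝓘(ℝ, ES) D.proj z.2)).symm)
    have hav : ((a, v) : EQ × EX) = 0 := Prod.ext ha (congrArg Subtype.val hv)
    exact huw.symm.trans ((congrArg (P.assocMkDeriv z) hav).trans (map_zero _))
  · intro w
    obtain ⟨⟨a, s⟩, hform, hs⟩ := Φ.exists_assocMkDeriv_eq (z.1, D.proj z.2) w
    obtain ⟨⟨v, hv⟩, rfl⟩ := hb.2 s
    exact ⟨⟨P.assocMkDeriv z (a, v), (mem_assocFamily_hor hG).2 ⟨(a, v), hform, hv, rfl⟩⟩,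
      (modelDeriv_assocFamily_proj hG hπ z (a, v)).trans hs⟩

theorem assocFamily_vertProj (hπ : MDifferentiable 𝓘(ℝ, EX) 𝓘(ℝ, ES) D.proj) {z : Q × X}
    (hb : D.HorBijectiveAt z.2) {w : EQ × EX} (hw : Φ.modelForm z.1 w.1 = 0) :
    ((assocFamily Φ D hG).vertProj (P.assocMk z) (P.assocMkDeriv z w)).1 =
      P.assocMkDeriv z ((0, (D.vertProj z.2 w.2).1) : EQ × EX) := by
  have hQ := assocFamily_horBijectiveAt (Φ := Φ) hG hπ hb
  let vertPart : EM × EX := P.assocMkDeriv z ((0, (D.vertProj z.2 w.2).1) : EQ × EX)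
  let horPart : EM × EX := P.assocMkDeriv z ((w.1, D.horProj z.2 w.2) : EQ × EX)
  have hvert : vertPart ∈ (assocFamily Φ D hG).vert (P.assocMk z) :=
    (mem_assocFamily_vert hG hπ).2 ⟨_, (D.vertProj z.2 w.2).2, rfl⟩
  have hhor : horPart ∈ (assocFamily Φ D hG).hor (P.assocMk z) :=
    (mem_assocFamily_hor hG).2 ⟨(w.1, D.horProj z.2 w.2), hw, hb.horProj_mem w.2, rfl⟩
  have hsum : P.assocMkDeriv z w = vertPart + horPart := by
    refine Eq.trans ?_ (map_add (P.assocMkDeriv z) _ _)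
    exact congrArg _ (Prod.ext (zero_add _).symm
      ((add_comm _ _).trans (FamilyData.horProj_add_vertProj z.2 w.2)).symm)
  rw [hsum]
  refine (congrArg Subtype.val
    (map_add ((assocFamily Φ D hG).vertProj (P.assocMk z)) vertPart horPart)).trans ?_
  refine (congrArg₂ (· + ·) (hQ.vertProj_of_mem_vert hvert)
    (congrArg Subtype.val (hQ.vertProj_eq_zero_iff.2 hhor))).trans (add_zero _)

theorem assocFamily_metric (hπ : MDifferentiable 𝓘(ℝ, EX) 𝓘(ℝ, ES) D.proj) (z : Q × X)
    (u v : (assocFamily Φ D hG).vert (P.assocMk z)) (u' v' : D.vert z.2)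
    (hu : P.assocMkDeriv z ((0, u'.1) : EQ × EX) = u.1)
    (hv : P.assocMkDeriv z ((0, v'.1) : EQ × EX) = v.1) :
    (assocFamily Φ D hG).metric (P.assocMk z) u v = D.metric z.2 u' v' := by
  obtain ⟨g, hg⟩ := P.assocMk_eq.1 (P.assocMk_out (P.assocMk z)).symm
  have hX : MDifferentiableAt 𝓘(ℝ, EX) 𝓘(ℝ, EX) (fun x : X => g⁻¹ • x) z.2 :=
    (ContMDiffSMul.contMDiff_const_smul (I := 𝓘(ℝ, EG)) (n := ∞) g⁻¹).mdifferentiable (by simp) _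
  have hS : MDifferentiableAt 𝓘(ℝ, ES) 𝓘(ℝ, ES) (fun s : S => g⁻¹ • s) (D.proj z.2) :=
    (ContMDiffSMul.contMDiff_const_smul (I := 𝓘(ℝ, EG)) (n := ∞) g⁻¹).mdifferentiable (by simp) _
  let smulVert (w : D.vert z.2) : D.vert (g⁻¹ • z.2) :=
    ⟨modelDeriv 𝓘(ℝ, EX) 𝓘(ℝ, EX) (fun x : X => g⁻¹ • x) z.2 w.1, hG.smul_mem_vert hπ hX hS w.2⟩
  have hrep (z' : Q × X) (hz' : z' = (op g • z.1, g⁻¹ • z.2)) :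
      D.metric z'.2
        (Function.invFun (fun w : D.vert z'.2 => P.assocMkDeriv z' ((0, w.1) : EQ × EX)) u.1)
        (Function.invFun (fun w : D.vert z'.2 => P.assocMkDeriv z' ((0, w.1) : EQ × EX)) v.1) =
      D.metric z.2 u' v' := by
    subst hz'
    rw [← hu, ← hv]
    refine (congrArg₂ (D.metric _) (Φ.invFun_assocMkDeriv (EY := EX) g (D.vert _) (smulVert u') rfl)
      (Φ.invFun_assocMkDeriv (EY := EX) g (D.vert _) (smulVert v') rfl)).trans ?_
    exact hG.metric_smul g⁻¹ z.2 u' v' (smulVert u') (smulVert v') rfl rfl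
  exact hrep _ hg

end AssocFamily

end PrincipalBundle

namespace PrincipalBundle

variable {EG EQ EM EX G Q M X : Type*}
    [NormedAddCommGroup EG] [NormedSpace ℝ EG] [NormedAddCommGroup EQ] [NormedSpace ℝ EQ]
    [NormedAddCommGroup EM] [NormedSpace ℝ EM] [NormedAddCommGroup EX] [NormedSpace ℝ EX]
    [Group G] [TopologicalSpace G] [ChartedSpace EG G]
    [TopologicalSpace Q] [ChartedSpace EQ Q] [TopologicalSpace M] [ChartedSpace EM M]
    [MulAction G X] [MulAction Gᵐᵒᵖ Q] (P : PrincipalBundle EG EQ EM G Q M)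

section Chart

theorem assocFun_fst (t : LocalTriv EG EQ EM G P.proj) (y : P.Assoc X) :
    (assocFun t y).1 = P.assocBase y := by
  conv_rhs => rw [← P.assocMk_out y]
  rfl

theorem eventually_mdifferentiableAt_sec [IsManifold 𝓘(ℝ, EM) ∞ M] (y₀ : P.Assoc X) :
    ∀ᶠ m in 𝓝 (extChartAt 𝓘(ℝ, EM) (assocFun (P.trivAt y₀) y₀).1 (assocFun (P.trivAt y₀) y₀).1),
      MDifferentiableAt 𝓘(ℝ, EM) 𝓘(ℝ, EQ) (fun m => (P.trivAt y₀).sec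
        ((extChartAt 𝓘(ℝ, EM) (assocFun (P.trivAt y₀) y₀).1).symm m)) m := by
  set t := P.trivAt y₀
  set m₀ := (assocFun t y₀).1 with hm₀
  have hbase : ∀ᶠ m in 𝓝 (extChartAt 𝓘(ℝ, EM) m₀ m₀),
      (extChartAt 𝓘(ℝ, EM) m₀).symm m ∈ t.base := by
    refine (continuousAt_extChartAt_symm m₀).eventually (t.isOpen_base.mem_nhds ?_)
    rw [extChartAt_to_inv, hm₀, P.assocFun_fst]
    exact P.assocBase_mem_trivAt y₀
  filter_upwards [eventually_mem_extChartAt_target m₀, hbase] with m hm hmt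
  exact ((t.smooth_sec.contMDiffAt (t.isOpen_base.mem_nhds hmt)).mdifferentiableAt
    (by simp)).comp m (mdifferentiableAt_extChartAt_symm m₀ hm)

variable [TopologicalSpace X] [ChartedSpace EX X]

/-- The lift to `Q × X` of the inverse of the preferred chart of `X_Q` at `y₀` which is given by the
local section of `Q → M`. -/
noncomputable def assocChartLift (y₀ : P.Assoc X) (p : EM × EX) : Q × X :=
  ((P.trivAt y₀).sec ((extChartAt 𝓘(ℝ, EM) (assocFun (P.trivAt y₀) y₀).1).symm p.1),
    (extChartAt 𝓘(ℝ, EX) (assocFun (P.trivAt y₀) y₀).2).symm p.2)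

variable [ContinuousSMul G X]

theorem assocMk_assocChartLift (y₀ : P.Assoc X) (p : EM × EX) :
    P.assocMk (P.assocChartLift y₀ p) = (extChartAt (𝓘(ℝ, EM).prod 𝓘(ℝ, EX)) y₀).symm p :=
  (P.extChartAt_assoc_symm_apply y₀ p).symm

variable [ContMDiffSMul 𝓘(ℝ, EG) 𝓘(ℝ, EX) ∞ G X] [IsManifold 𝓘(ℝ, EX) ∞ X]

theorem modelDeriv_assocMk_prodMk {A : Type*} [NormedAddCommGroup A] [NormedSpace ℝ A] {s : A → Q}
    (x₀ : X) {p : A × EX} (hs : MDifferentiableAt 𝓘(ℝ, A) 𝓘(ℝ, EQ) s p.1)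
    (hp : p.2 ∈ (extChartAt 𝓘(ℝ, EX) x₀).target) (w : A × EX) :
    modelDeriv 𝓘(ℝ, A × EX) (𝓘(ℝ, EM).prod 𝓘(ℝ, EX))
      (fun p => P.assocMk (s p.1, (extChartAt 𝓘(ℝ, EX) x₀).symm p.2)) p w =
    P.assocMkDeriv (s p.1, (extChartAt 𝓘(ℝ, EX) x₀).symm p.2)
      (modelDeriv 𝓘(ℝ, A) 𝓘(ℝ, EQ) s p.1 w.1,
        modelDeriv 𝓘(ℝ, EX) 𝓘(ℝ, EX) (extChartAt 𝓘(ℝ, EX) x₀).symm p.2 w.2) := by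
  have hfst : MDifferentiableAt 𝓘(ℝ, A × EX) 𝓘(ℝ, A) (fun p : A × EX => p.1) p :=
    differentiableAt_fst.mdifferentiableAt
  have hsnd : MDifferentiableAt 𝓘(ℝ, A × EX) 𝓘(ℝ, EX) (fun p : A × EX => p.2) p :=
    differentiableAt_snd.mdifferentiableAt
  have hchart := mdifferentiableAt_extChartAt_symm (I := 𝓘(ℝ, EX)) x₀ hp
  have hs' : MDifferentiableAt 𝓘(ℝ, A × EX) 𝓘(ℝ, EQ) (fun p : A × EX => s p.1) p :=
    hs.comp p hfst
  have hchart' : MDifferentiableAt 𝓘(ℝ, A × EX) 𝓘(ℝ, EX)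
    (fun p : A × EX => (extChartAt 𝓘(ℝ, EX) x₀).symm p.2) p := hchart.comp p hsnd
  rw [modelDeriv_comp (g := P.assocMk (Y := X))
      (f := fun p : A × EX => (s p.1, (extChartAt 𝓘(ℝ, EX) x₀).symm p.2))
      (P.mdifferentiableAt_assocMk (EY := EX) _) (hs'.prodMk hchart'),
    modelDeriv_prodMk hs' hchart', modelDeriv_comp (f := fun p : A × EX => p.1) hs hfst,
    modelDeriv_comp (f := fun p : A × EX => p.2) hchart hsnd, modelDeriv_eq_fderiv,
    modelDeriv_eq_fderiv, fderiv_fst, fderiv_snd]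
  rfl

variable [IsManifold 𝓘(ℝ, EM) ∞ M]

theorem eventually_modelDeriv_extChartAt_assoc_symm (y₀ : P.Assoc X) :
    ∀ᶠ p in 𝓝 (extChartAt (𝓘(ℝ, EM).prod 𝓘(ℝ, EX)) y₀ y₀), ∀ b : EX,
      modelDeriv 𝓘(ℝ, EM × EX) (𝓘(ℝ, EM).prod 𝓘(ℝ, EX))
        (extChartAt (𝓘(ℝ, EM).prod 𝓘(ℝ, EX)) y₀).symm p (0, b) =
      P.assocMkDeriv (P.assocChartLift y₀ p) ((0, modelDeriv 𝓘(ℝ, EX) 𝓘(ℝ, EX)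
        (extChartAt 𝓘(ℝ, EX) (assocFun (P.trivAt y₀) y₀).2).symm p.2 b) : EQ × EX) := by
  let c := extChartAt (𝓘(ℝ, EM).prod 𝓘(ℝ, EX)) y₀
  have hsec := (continuousAt_fst (p := c y₀)).tendsto.eventually
    (P.eventually_mdifferentiableAt_sec y₀)
  have htarget := (continuousAt_snd (p := c y₀)).tendsto.eventually
    (eventually_mem_extChartAt_target (I := 𝓘(ℝ, EX)) (assocFun (P.trivAt y₀) y₀).2)
  filter_upwards [hsec, htarget] with p hp hpX b
  refine (P.modelDeriv_assocMk_prodMk _ hp hpX (0, b)).trans ?_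
  rw [map_zero]
  rfl

theorem assocMkDeriv_assocChartLift_self (y₀ : P.Assoc X) (b : EX) :
    P.assocMkDeriv (P.assocChartLift y₀ (extChartAt (𝓘(ℝ, EM).prod 𝓘(ℝ, EX)) y₀ y₀))
      ((0, b) : EQ × EX) = (0, b) := by
  have hderiv := (P.eventually_modelDeriv_extChartAt_assoc_symm y₀).self_of_nhds b
  rw [modelDeriv_extChartAt_symm_self] at hderiv
  refine Eq.trans ?_ hderiv.symm
  exact congrArg (fun L : EX →L[ℝ] EX => P.assocMkDeriv
    (P.assocChartLift y₀ (extChartAt (𝓘(ℝ, EM).prod 𝓘(ℝ, EX)) y₀ y₀)) ((0, L b) : EQ × EX))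
    (modelDeriv_extChartAt_symm_self (I := 𝓘(ℝ, EX)) (assocFun (P.trivAt y₀) y₀).2).symm

end Chart

section Frobenius

variable [TopologicalSpace X] [ChartedSpace EX X] [ContinuousSMul G X]
    [ContMDiffSMul 𝓘(ℝ, EG) 𝓘(ℝ, EX) ∞ G X] [IsManifold 𝓘(ℝ, EX) ∞ X]
    [IsManifold 𝓘(ℝ, EM) ∞ M] [LieGroup 𝓘(ℝ, EG) ∞ G]
    {ES S : Type*} [NormedAddCommGroup ES] [NormedSpace ℝ ES] [TopologicalSpace S]
    [ChartedSpace ES S] [MulAction G S] [ContinuousSMul G S]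
    [ContMDiffSMul 𝓘(ℝ, EG) 𝓘(ℝ, ES) ∞ G S]
    {P} {Φ : P.Connection} {D : FamilyData 𝓘(ℝ, EX) 𝓘(ℝ, ES) X S} (hG : D.IsInvariant G)

theorem eventually_assocFamily_vertProjInChart (hπ : MDifferentiable 𝓘(ℝ, EX) 𝓘(ℝ, ES) D.proj)
    (hb : ∀ x, D.HorBijectiveAt x) (y₀ : P.Assoc X) (w : EX) :
    ∀ᶠ p in 𝓝 (extChartAt (𝓘(ℝ, EM).prod 𝓘(ℝ, EX)) y₀ y₀),
      (assocFamily Φ D hG).vertProjInChart y₀ p ((0, w) : EM × EX) =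
        (0, D.vertProjInChart (assocFun (P.trivAt y₀) y₀).2 p.2 w) := by
  set c := extChartAt (𝓘(ℝ, EM).prod 𝓘(ℝ, EX)) y₀
  set x₀ := (assocFun (P.trivAt y₀) y₀).2
  have htarget := (continuousAt_snd (p := c y₀)).tendsto.eventually
    (eventually_mem_extChartAt_target (I := 𝓘(ℝ, EX)) x₀)
  filter_upwards [eventually_mem_extChartAt_target (I := 𝓘(ℝ, EM).prod 𝓘(ℝ, EX)) y₀, htarget,
    P.eventually_modelDeriv_extChartAt_assoc_symm y₀] with p hp hpX hderiv
  set z := P.assocChartLift y₀ p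
  set v : EX := (D.vertProj z.2
    (modelDeriv 𝓘(ℝ, EX) 𝓘(ℝ, EX) (extChartAt 𝓘(ℝ, EX) x₀).symm p.2 w)).1
  have hproj : ((assocFamily Φ D hG).vertProj (P.assocMk z) (modelDeriv 𝓘(ℝ, EM × EX)
      (𝓘(ℝ, EM).prod 𝓘(ℝ, EX)) c.symm p (0, w))).1 = P.assocMkDeriv z ((0, v) : EQ × EX) := by
    rw [hderiv w]
    exact assocFamily_vertProj hG hπ (hb z.2) (map_zero _)
  have hlift : P.assocMkDeriv z ((0, v) : EQ × EX) = modelDeriv 𝓘(ℝ, EM × EX)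
      (𝓘(ℝ, EM).prod 𝓘(ℝ, EX)) c.symm p (0, D.vertProjInChart x₀ p.2 w) := by
    rw [hderiv]
    exact congrArg (fun v : EX => P.assocMkDeriv z ((0, v) : EQ × EX))
      (DFunLike.congr_fun (modelDeriv_extChartAt_symm_comp x₀ hpX) v).symm
  refine (congrArg (modelDeriv (𝓘(ℝ, EM).prod 𝓘(ℝ, EX)) 𝓘(ℝ, EM × EX) c (c.symm p))
    (hproj.trans hlift)).trans ?_
  exact DFunLike.congr_fun (modelDeriv_extChartAt_comp_symm y₀ hp) _

variable [FiniteDimensional ℝ EX] {n : ℕ}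

theorem assocFamily_frobenius_eq_zero (hD : D.IsMetricFamily n) (y₀ : P.Assoc X) {e : EM × EX}
    (he : e ∈ (assocFamily Φ D hG).vert y₀)
    (u : TangentSpace (𝓘(ℝ, EM).prod 𝓘(ℝ, EX)) y₀) :
    (assocFamily Φ D hG).frobenius y₀ u e = 0 ∧ (assocFamily Φ D hG).frobenius y₀ e u = 0 := by
  have hπ : MDifferentiable 𝓘(ℝ, EX) 𝓘(ℝ, ES) D.proj := hD.contMDiff_proj.mdifferentiable (by simp)
  obtain ⟨x₀, hchart, hproj, z, rfl, rfl, hid⟩ : ∃ x₀ : X,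
      (extChartAt (𝓘(ℝ, EM).prod 𝓘(ℝ, EX)) y₀ y₀).2 = extChartAt 𝓘(ℝ, EX) x₀ x₀ ∧
      (∀ w : EX, (fun p => (assocFamily Φ D hG).vertProjInChart y₀ p ((0, w) : EM × EX))
        =ᶠ[𝓝 (extChartAt (𝓘(ℝ, EM).prod 𝓘(ℝ, EX)) y₀ y₀)]
          fun p => (0, D.vertProjInChart x₀ p.2 w)) ∧
      ∃ z : Q × X, z.2 = x₀ ∧ P.assocMk z = y₀ ∧
        ∀ b : EX, P.assocMkDeriv z ((0, b) : EQ × EX) = (0, b) :=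
    ⟨(assocFun (P.trivAt y₀) y₀).2, rfl,
      eventually_assocFamily_vertProjInChart hG hπ hD.horBijectiveAt y₀, _,
      extChartAt_to_inv (I := 𝓘(ℝ, EX)) _,
      (P.assocMk_assocChartLift y₀ _).trans (extChartAt_to_inv y₀),
      P.assocMkDeriv_assocChartLift_self y₀⟩
  obtain ⟨e', he', rfl⟩ := (mem_assocFamily_vert hG hπ).1 he
  refine (assocFamily_horBijectiveAt hG hπ (hD.horBijectiveAt z.2)).frobenius_eq_zero he
    (fun b => Subtype.ext ?_) u
  have hderiv : fderiv ℝ (fun p => (assocFamily Φ D hG).vertProjInChart (P.assocMk z) p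
      (P.assocMkDeriv z ((0, e') : EQ × EX)))
      (extChartAt (𝓘(ℝ, EM).prod 𝓘(ℝ, EX)) (P.assocMk z) (P.assocMk z)) b =
      P.assocMkDeriv z ((0, fderiv ℝ (fun y => D.vertProjInChart z.2 y e')
        (extChartAt 𝓘(ℝ, EX) z.2 z.2) b.2) : EQ × EX) := by
    rw [hid, hid, (hproj e').fderiv_eq,
      fderiv_comp_snd_apply (fun x => ((0 : EM), D.vertProjInChart z.2 x e')),
      fderiv_prodMk_zero_apply, hchart]
  rw [hderiv]
  refine (assocFamily_vertProj hG hπ (hD.horBijectiveAt z.2) (map_zero _)).trans ?_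
  refine (congrArg (fun v : D.vert z.2 => P.assocMkDeriv z ((0, v.1) : EQ × EX))
    (hD.vertProj_fderiv_vertProjInChart he' b.2)).trans (map_zero (P.assocMkDeriv z))

end Frobenius

end PrincipalBundle

namespace FamilyData

variable {E H E' H' X S : Type*} [NormedAddCommGroup E] [NormedSpace ℝ E]
    [TopologicalSpace H] {I : ModelWithCorners ℝ E H} [TopologicalSpace X] [ChartedSpace H X]
    [NormedAddCommGroup E'] [NormedSpace ℝ E'] [TopologicalSpace H'] {J : ModelWithCorners ℝ E' H'}
    [TopologicalSpace S] [ChartedSpace H' S] {D : FamilyData I J X S}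

namespace IsVolumeForm

variable {n : ℕ} {ν : Form I X n} (hν : D.IsVolumeForm ν) {x : X}

include hν

theorem apply_eq_vertProj (h : D.HorBijectiveAt x) (v : Fin n → TangentSpace I x) :
    ν x v = ν x fun i => (D.vertProj x (v i) : TangentSpace I x) := by
  refine Eq.trans (congrArg (ν x) (funext fun i => ?_))
    (map_add_of_forall_mem_eq_zero (ν x).toMultilinearMap (D.hor x) (hν.horizontal x) _
      (fun i => D.horProj x (v i)) fun i => h.horProj_mem (v i))
  exact ((add_comm _ _).trans (horProj_add_vertProj x (v i))).symm

theorem apply_ne_zero {e : Fin n → D.vert x} (he : D.IsOrthonormal x e) :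
    ν x (fun i => (e i : TangentSpace I x)) ≠ 0 := by
  rcases hν.orthonormal x e he with h | h <;> rw [h]
  exacts [one_ne_zero, neg_ne_zero.2 one_ne_zero]

end IsVolumeForm

end FamilyData

namespace PrincipalBundle

variable {EG EQ EM EX ES G Q M X S : Type*}
    [NormedAddCommGroup EG] [NormedSpace ℝ EG] [NormedAddCommGroup EQ] [NormedSpace ℝ EQ]
    [NormedAddCommGroup EM] [NormedSpace ℝ EM] [NormedAddCommGroup EX] [NormedSpace ℝ EX]
    [NormedAddCommGroup ES] [NormedSpace ℝ ES]
    [Group G] [TopologicalSpace G] [ChartedSpace EG G]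
    [TopologicalSpace Q] [ChartedSpace EQ Q] [TopologicalSpace M] [ChartedSpace EM M]
    [TopologicalSpace X] [ChartedSpace EX X] [TopologicalSpace S] [ChartedSpace ES S]
    [MulAction G X] [ContinuousSMul G X] [MulAction Gᵐᵒᵖ Q]
    {P : PrincipalBundle EG EQ EM G Q M} {Φ : P.Connection} {n : ℕ}
    {ν : Form 𝓘(ℝ, EX) X n} {νQ : Form (𝓘(ℝ, EM).prod 𝓘(ℝ, EX)) (P.Assoc X) n}

/-- On the tangent vectors of `Q × X` with values in `ker Φ ⊕ TX`, the pullback of the form `η` on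
`X_Q` is `c` times the pullback of the form `ν` on `X`. -/
def Connection.IsHorPullback (Φ : P.Connection) (η : Form (𝓘(ℝ, EM).prod 𝓘(ℝ, EX)) (P.Assoc X) n)
    (ν : Form 𝓘(ℝ, EX) X n) (c : Q × X → ℝ) : Prop :=
  ∀ (z : Q × X) (a : Fin n → EQ) (v : Fin n → EX), (∀ i, Φ.modelForm z.1 (a i) = 0) →
    η.val (P.assocMk z) (fun i => P.assocMkDeriv z (a i, v i)) = c z * ν.val z.2 v

section VolumeForm

variable [ContMDiffSMul 𝓘(ℝ, EG) 𝓘(ℝ, EX) ∞ G X] [LieGroup 𝓘(ℝ, EG) ∞ G]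
    [MulAction G S] [ContinuousSMul G S] [ContMDiffSMul 𝓘(ℝ, EG) 𝓘(ℝ, ES) ∞ G S]
    {D : FamilyData 𝓘(ℝ, EX) 𝓘(ℝ, ES) X S} (hG : D.IsInvariant G)
    (hπ : MDifferentiable 𝓘(ℝ, EX) 𝓘(ℝ, ES) D.proj)

/-- The vertical tangent vector of `X_Q` at `[q, x]` represented by a vertical tangent vector of `X`
at `x`. -/
noncomputable def assocVert (z : Q × X) (e : D.vert z.2) :
    (assocFamily Φ D hG).vert (P.assocMk z) :=
  ⟨P.assocMkDeriv z ((0, e.1) : EQ × EX), (mem_assocFamily_vert hG hπ).2 ⟨e.1, e.2, rfl⟩⟩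

theorem isOrthonormal_assocVert {z : Q × X} {e : Fin n → D.vert z.2}
    (he : D.IsOrthonormal z.2 e) :
    (assocFamily Φ D hG).IsOrthonormal (P.assocMk z) fun i => assocVert hG hπ z (e i) :=
  fun i j => (assocFamily_metric hG hπ z _ _ (e i) (e j) rfl rfl).trans (he i j)

include hπ in
theorem assocFamily_volumeForm_apply (hνQ : (assocFamily Φ D hG).IsVolumeForm νQ) {z : Q × X}
    (hb : D.HorBijectiveAt z.2) {a : Fin n → EQ} (v : Fin n → EX)
    (ha : ∀ i, Φ.modelForm z.1 (a i) = 0) :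
    νQ.val (P.assocMk z) (fun i => P.assocMkDeriv z (a i, v i)) =
      νQ.val (P.assocMk z) fun i =>
        P.assocMkDeriv z ((0, (D.vertProj z.2 (v i)).1) : EQ × EX) :=
  (hνQ.apply_eq_vertProj (assocFamily_horBijectiveAt hG hπ hb) _).trans <|
    congrArg (νQ.val (P.assocMk z)) <| funext fun i =>
      assocFamily_vertProj hG hπ hb (w := (a i, v i)) (ha i)

variable [IsManifold 𝓘(ℝ, EX) ∞ X]

theorem assocFamily_metric_zero (hD : D.IsMetricFamily n) (z : Q × X)
    (w : (assocFamily Φ D hG).vert (P.assocMk z)) :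
    (assocFamily Φ D hG).metric (P.assocMk z) 0 w = 0 := by
  obtain ⟨v, hv, hvw⟩ :=
    (mem_assocFamily_vert hG (hD.contMDiff_proj.mdifferentiable (by simp))).1 w.2
  exact (assocFamily_metric hG (hD.contMDiff_proj.mdifferentiable (by simp)) z 0 w 0 ⟨v, hv⟩
    (map_zero (P.assocMkDeriv z)) hvw).trans (hD.metric_zero z.2 _)

theorem exists_isHorPullback_volumeForm [FiniteDimensional ℝ EX] (hD : D.IsMetricFamily n)
    (hν : D.IsVolumeForm ν) (hνQ : (assocFamily Φ D hG).IsVolumeForm νQ) :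
    ∃ c : Q × X → ℝ, (∀ z, c z = 1 ∨ c z = -1) ∧ Φ.IsHorPullback νQ ν c := by
  have hπ : MDifferentiable 𝓘(ℝ, EX) 𝓘(ℝ, ES) D.proj := hD.contMDiff_proj.mdifferentiable (by simp)
  suffices hpoint : ∀ z : Q × X, ∃ c : ℝ, (c = 1 ∨ c = -1) ∧
      ∀ (a : Fin n → EQ) (v : Fin n → EX), (∀ i, Φ.modelForm z.1 (a i) = 0) →
        νQ.val (P.assocMk z) (fun i => P.assocMkDeriv z (a i, v i)) = c * ν.val z.2 v by
    choose c hsign hc using hpoint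
    exact ⟨c, hsign, hc⟩
  intro z
  obtain ⟨e, he⟩ := hD.exists_orthonormal_basis z.2
  let incl : D.vert z.2 →ₗ[ℝ] EX := (D.vert z.2).subtype
  let inclQ : D.vert z.2 →ₗ[ℝ] EM × EX :=
    (P.assocMkDeriv (EY := EX) z).toLinearMap ∘ₗ LinearMap.inr ℝ EQ EX ∘ₗ incl
  obtain ⟨c, hsign, hbasis⟩ : ∃ c : ℝ, (c = 1 ∨ c = -1) ∧
      νQ.val (P.assocMk z) (fun i => inclQ (e i)) = c * ν.val z.2 fun i => incl (e i) := by
    have hνe : ν.val z.2 (fun i => incl (e i)) = 1 ∨ ν.val z.2 (fun i => incl (e i)) = -1 :=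
      hν.orthonormal z.2 e he
    have hνQe : νQ.val (P.assocMk z) (fun i => inclQ (e i)) = 1 ∨
        νQ.val (P.assocMk z) (fun i => inclQ (e i)) = -1 :=
      hνQ.orthonormal (P.assocMk z) _ (isOrthonormal_assocVert hG hπ he)
    rcases hνe with h | h <;> rcases hνQe with hQ | hQ <;> rw [h, hQ]
    exacts [⟨1, by simp⟩, ⟨-1, by simp⟩, ⟨-1, by simp⟩, ⟨1, by simp⟩]
  refine ⟨c, hsign, fun a v ha => ?_⟩
  calc νQ.val (P.assocMk z) (fun i => P.assocMkDeriv z (a i, v i))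
      = νQ.val (P.assocMk z) (fun i => inclQ (D.vertProj z.2 (v i))) :=
        assocFamily_volumeForm_apply hG hπ hνQ (hD.horBijectiveAt z.2) v ha
    _ = c * ν.val z.2 (fun i => incl (D.vertProj z.2 (v i))) :=
        alternatingMap_eq_mul_of_basis e
          ((νQ.val (P.assocMk z)).toAlternatingMap.compLinearMap inclQ)
          ((ν.val z.2).toAlternatingMap.compLinearMap incl) hbasis _
    _ = c * ν.val z.2 v :=
        congrArg (c * ·) (hν.apply_eq_vertProj (hD.horBijectiveAt z.2) v).symm

end VolumeForm

section Curvature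

/-- The quotient map `Q × X → X_Q`, read in the preferred charts of `Q` and `X` at `z₀`. -/
noncomputable def assocMkInChart (P : PrincipalBundle EG EQ EM G Q M) (z₀ : Q × X)
    (p : EQ × EX) : P.Assoc X :=
  P.assocMk ((extChartAt 𝓘(ℝ, EQ) z₀.1).symm p.1, (extChartAt 𝓘(ℝ, EX) z₀.2).symm p.2)

variable (z₀ : Q × X)

omit [ContinuousSMul G X] in
theorem assocMkInChart_self :
    P.assocMkInChart z₀ (extChartAt 𝓘(ℝ, EQ) z₀.1 z₀.1, extChartAt 𝓘(ℝ, EX) z₀.2 z₀.2) =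
      P.assocMk z₀ :=
  congrArg P.assocMk (Prod.ext (extChartAt_to_inv z₀.1) (extChartAt_to_inv z₀.2))

variable [ContMDiffSMul 𝓘(ℝ, EG) 𝓘(ℝ, EX) ∞ G X]
    [IsManifold 𝓘(ℝ, EQ) ∞ Q] [IsManifold 𝓘(ℝ, EX) ∞ X]

theorem contMDiffAt_assocMkInChart :
    ContMDiffAt 𝓘(ℝ, EQ × EX) (𝓘(ℝ, EM).prod 𝓘(ℝ, EX)) ∞ (P.assocMkInChart z₀)
      (extChartAt 𝓘(ℝ, EQ) z₀.1 z₀.1, extChartAt 𝓘(ℝ, EX) z₀.2 z₀.2) := by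
  let p₀ : EQ × EX := (extChartAt 𝓘(ℝ, EQ) z₀.1 z₀.1, extChartAt 𝓘(ℝ, EX) z₀.2 z₀.2)
  have hQ : ContMDiffAt 𝓘(ℝ, EQ) 𝓘(ℝ, EQ) ∞ (extChartAt 𝓘(ℝ, EQ) z₀.1).symm p₀.1 :=
    (contMDiffOn_extChartAt_symm z₀.1).contMDiffAt
      ((isOpen_extChartAt_target z₀.1).mem_nhds (mem_extChartAt_target z₀.1))
  have hX : ContMDiffAt 𝓘(ℝ, EX) 𝓘(ℝ, EX) ∞ (extChartAt 𝓘(ℝ, EX) z₀.2).symm p₀.2 :=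
    (contMDiffOn_extChartAt_symm z₀.2).contMDiffAt
      ((isOpen_extChartAt_target z₀.2).mem_nhds (mem_extChartAt_target z₀.2))
  exact (P.contMDiff_assocMk _).comp p₀ ((hQ.comp p₀ contDiffAt_fst.contMDiffAt).prodMk
    (hX.comp p₀ contDiffAt_snd.contMDiffAt))

variable {z₀} {p : EQ × EX}

theorem modelDeriv_assocMkInChart (hpQ : p.1 ∈ (extChartAt 𝓘(ℝ, EQ) z₀.1).target)
    (hpX : p.2 ∈ (extChartAt 𝓘(ℝ, EX) z₀.2).target) (w : EQ × EX) :
    modelDeriv 𝓘(ℝ, EQ × EX) (𝓘(ℝ, EM).prod 𝓘(ℝ, EX)) (P.assocMkInChart z₀) p w =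
      P.assocMkDeriv
        ((extChartAt 𝓘(ℝ, EQ) z₀.1).symm p.1, (extChartAt 𝓘(ℝ, EX) z₀.2).symm p.2)
        (modelDeriv 𝓘(ℝ, EQ) 𝓘(ℝ, EQ) (extChartAt 𝓘(ℝ, EQ) z₀.1).symm p.1 w.1,
          modelDeriv 𝓘(ℝ, EX) 𝓘(ℝ, EX) (extChartAt 𝓘(ℝ, EX) z₀.2).symm p.2 w.2) :=
  P.modelDeriv_assocMk_prodMk z₀.2 (mdifferentiableAt_extChartAt_symm z₀.1 hpQ) hpX w

theorem modelDeriv_assocMkInChart_self (w : EQ × EX) :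
    modelDeriv 𝓘(ℝ, EQ × EX) (𝓘(ℝ, EM).prod 𝓘(ℝ, EX)) (P.assocMkInChart z₀)
      (extChartAt 𝓘(ℝ, EQ) z₀.1 z₀.1, extChartAt 𝓘(ℝ, EX) z₀.2 z₀.2) w = P.assocMkDeriv z₀ w := by
  rw [modelDeriv_assocMkInChart (mem_extChartAt_target z₀.1) (mem_extChartAt_target z₀.2),
    modelDeriv_extChartAt_symm_self, modelDeriv_extChartAt_symm_self]
  exact congrArg (P.assocMkDeriv · w)
    (Prod.ext (extChartAt_to_inv z₀.1) (extChartAt_to_inv z₀.2))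

namespace Connection.IsHorPullback

variable {c : Q × X → ℝ} (hc : Φ.IsHorPullback νQ ν c)

include hc

theorem pull_assocMkInChart_apply (hpQ : p.1 ∈ (extChartAt 𝓘(ℝ, EQ) z₀.1).target)
    (hpX : p.2 ∈ (extChartAt 𝓘(ℝ, EX) z₀.2).target) {a : Fin n → EQ} (v : Fin n → EX)
    (ha : ∀ i, Φ.modelForm ((extChartAt 𝓘(ℝ, EQ) z₀.1).symm p.1)
      (modelDeriv 𝓘(ℝ, EQ) 𝓘(ℝ, EQ) (extChartAt 𝓘(ℝ, EQ) z₀.1).symm p.1 (a i)) = 0) :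
    νQ.pull (P.assocMkInChart z₀) p (fun i => (a i, v i)) =
      c ((extChartAt 𝓘(ℝ, EQ) z₀.1).symm p.1, (extChartAt 𝓘(ℝ, EX) z₀.2).symm p.2) *
        ν.inChart z₀.2 p.2 v := by
  rw [Form.inChart_eq_pull]
  exact (congrArg (νQ.val (P.assocMkInChart z₀ p)) (funext fun i =>
    modelDeriv_assocMkInChart hpQ hpX (a i, v i))).trans (hc _ _ _ ha)

variable (hsign : ∀ z, c z = 1 ∨ c z = -1) (hν : ν.Smooth) (hνQ : νQ.Smooth)
    {e : Fin n → EX} (he : ν.val z₀.2 e ≠ 0)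

include hsign hν hνQ he

variable [IsManifold 𝓘(ℝ, EM) ∞ M]

theorem eventually_pull_assocMkInChart :
    ∀ᶠ p in 𝓝 (extChartAt 𝓘(ℝ, EQ) z₀.1 z₀.1, extChartAt 𝓘(ℝ, EX) z₀.2 z₀.2),
      ∀ (a : Fin n → EQ) (v : Fin n → EX),
      (∀ i, Φ.modelForm ((extChartAt 𝓘(ℝ, EQ) z₀.1).symm p.1)
        (modelDeriv 𝓘(ℝ, EQ) 𝓘(ℝ, EQ) (extChartAt 𝓘(ℝ, EQ) z₀.1).symm p.1 (a i)) = 0) →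
      νQ.pull (P.assocMkInChart z₀) p (fun i => (a i, v i)) = c z₀ * ν.inChart z₀.2 p.2 v := by
  set p₀ : EQ × EX := (extChartAt 𝓘(ℝ, EQ) z₀.1 z₀.1, extChartAt 𝓘(ℝ, EX) z₀.2 z₀.2)
  let toQX (p : EQ × EX) : Q × X :=
    ((extChartAt 𝓘(ℝ, EQ) z₀.1).symm p.1, (extChartAt 𝓘(ℝ, EX) z₀.2).symm p.2)
  have htoQX : toQX p₀ = z₀ := Prod.ext (extChartAt_to_inv z₀.1) (extChartAt_to_inv z₀.2)
  have hpull := differentiableAt_form_apply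
    (hνQ.differentiableAt_pull (contMDiffAt_assocMkInChart z₀)) fun i => (0, e i)
  have hinChart : ContinuousAt (fun p : EQ × EX => ν.inChart z₀.2 p.2 e) p₀ :=
    ContinuousAt.comp (g := fun x => ν.inChart z₀.2 x e) (differentiableAt_form_apply
      (hν.differentiableAt_inChart z₀.2 (mem_extChartAt_target z₀.2)) e).continuousAt
      continuousAt_snd
  have htargetQ := (continuousAt_fst (p := p₀)).tendsto.eventually
    (eventually_mem_extChartAt_target (I := 𝓘(ℝ, EQ)) z₀.1)
  have htargetX := (continuousAt_snd (p := p₀)).tendsto.eventually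
    (eventually_mem_extChartAt_target (I := 𝓘(ℝ, EX)) z₀.2)
  have hconst : ∀ᶠ p in 𝓝 p₀, c (toQX p) = c (toQX p₀) := by
    refine eventually_eq_of_eq_mul_of_sign (Filter.Eventually.of_forall fun p => hsign (toQX p))
      hpull.continuousAt hinChart ((ν.inChart_self z₀.2 e).trans_ne he) ?_
    filter_upwards [htargetQ, htargetX] with p hpQ hpX
    exact hc.pull_assocMkInChart_apply hpQ hpX e fun _ => by rw [map_zero, map_zero]
  rw [htoQX] at hconst
  filter_upwards [htargetQ, htargetX, hconst] with p hpQ hpX hp a v ha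
  exact (hc.pull_assocMkInChart_apply hpQ hpX v ha).trans (congrArg (· * _) hp)

theorem d_cons {a : EQ} (ha : Φ.modelForm z₀.1 a = 0) (h : EX) :
    νQ.d.val (P.assocMk z₀)
        (Fin.cons (P.assocMkDeriv z₀ (a, h)) fun i => P.assocMkDeriv z₀ ((0, e i) : EQ × EX)) =
      c z₀ * ν.d.val z₀.2 (Fin.cons h e) := by
  set p₀ : EQ × EX := (extChartAt 𝓘(ℝ, EQ) z₀.1 z₀.1, extChartAt 𝓘(ℝ, EX) z₀.2 z₀.2)
  have hlocal := hc.eventually_pull_assocMkInChart hsign hν hνQ he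
  have hslice : ContinuousAt (fun x : EX => (p₀.1, x)) p₀.2 := by fun_prop
  have hinChart := hν.differentiableAt_inChart z₀.2 (mem_extChartAt_target (I := 𝓘(ℝ, EX)) z₀.2)
  have hext := extDeriv_prod_cons (β := c z₀ • ν.inChart z₀.2) (p₀ := p₀) (a := a)
    (hνQ.differentiableAt_pull (contMDiffAt_assocMkInChart z₀)) (hinChart.const_smul (c z₀))
    (hlocal.mono fun p hp v => hp (fun _ => 0) v fun _ => by rw [map_zero, map_zero])
    ((hslice.eventually hlocal).mono fun x hx r v => hx (fun i => r i • a) v fun i => by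
      rw [modelDeriv_extChartAt_symm_self, extChartAt_to_inv]
      exact (map_smul (Φ.modelForm z₀.1) (r i) a).trans (by rw [ha, smul_zero])) h e
  rw [hνQ.extDeriv_pull (contMDiffAt_assocMkInChart z₀), assocMkInChart_self, extDeriv_smul] at hext
  refine Eq.trans (congrArg (νQ.d.val (P.assocMk z₀)) (funext fun j => ?_))
    (hext.trans (congrArg (c z₀ * ·) (hν.extDeriv_inChart_self z₀.2 _)))
  cases j using Fin.cases with
  | zero => exact (modelDeriv_assocMkInChart_self (a, h)).symm
  | succ j => exact (modelDeriv_assocMkInChart_self (0, e j)).symm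

end Connection.IsHorPullback

end Curvature

section SubContract

variable {EY Y ι : Type*} [NormedAddCommGroup EY] [NormedSpace ℝ EY] [TopologicalSpace Y]
    [ChartedSpace EY Y] [MulAction G Y] [Fintype ι]

theorem Connection.subContract_snd (Φ : P.Connection)
    (e : Module.Basis ι ℝ (GroupLieAlgebra 𝓘(ℝ, EG) G)) (z : Q × Y) {α : EY → ℝ}
    (A : EY →ₗ[ℝ] ℝ) (hα : ∀ v, α v = A v) (w : EQ × EY) :
    Φ.subContract e z
        (fun w => α (mfderiv (𝓘(ℝ, EQ).prod 𝓘(ℝ, EY)) 𝓘(ℝ, EY) Prod.snd z w)) w =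
      A (Φ.horPart z w).2 := by
  let act := modelDeriv 𝓘(ℝ, EG) (𝓘(ℝ, EQ).prod 𝓘(ℝ, EY))
    (fun g : G => ((op g • z.1, g⁻¹ • z.2) : Q × Y)) 1
  let contract : GroupLieAlgebra 𝓘(ℝ, EG) G →ₗ[ℝ] ℝ :=
    A ∘ₗ LinearMap.snd ℝ EQ EY ∘ₗ act.toLinearMap
  have hsnd (u : EQ × EY) :
      α (mfderiv (𝓘(ℝ, EQ).prod 𝓘(ℝ, EY)) 𝓘(ℝ, EY) Prod.snd z u) = A u.2 := by
    rw [mfderiv_snd]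
    exact hα u.2
  have hfst : Φ.form z.1 (mfderiv (𝓘(ℝ, EQ).prod 𝓘(ℝ, EY)) 𝓘(ℝ, EQ) Prod.fst z w) =
      Φ.modelForm z.1 w.1 := by
    rw [mfderiv_fst]
    rfl
  have hsum : ∑ a, e.coord a (Φ.form z.1
      (mfderiv (𝓘(ℝ, EQ).prod 𝓘(ℝ, EY)) 𝓘(ℝ, EQ) Prod.fst z w)) *
      α (mfderiv (𝓘(ℝ, EQ).prod 𝓘(ℝ, EY)) 𝓘(ℝ, EY) Prod.snd z (generator EQ (e a) z)) =
      contract (Φ.modelForm z.1 w.1) := by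
    rw [hfst]
    conv_rhs => rw [← e.sum_repr (Φ.modelForm z.1 w.1), map_sum]
    refine Finset.sum_congr rfl fun a _ => ?_
    refine (congrArg (_ * ·) (hsnd (generator EQ (e a) z))).trans ?_
    rw [map_smul]
    rfl
  exact (congrArg₂ (· - ·) (hsnd w) hsum).trans (map_sub A _ _).symm

end SubContract

section MeanCurvature

variable [ContMDiffSMul 𝓘(ℝ, EG) 𝓘(ℝ, EX) ∞ G X] [LieGroup 𝓘(ℝ, EG) ∞ G]
    [MulAction G S] [ContinuousSMul G S] [ContMDiffSMul 𝓘(ℝ, EG) 𝓘(ℝ, ES) ∞ G S]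
    {D : FamilyData 𝓘(ℝ, EX) 𝓘(ℝ, ES) X S} {hG : D.IsInvariant G}

theorem isBasic_toBase (hπ : MDifferentiable 𝓘(ℝ, EX) 𝓘(ℝ, ES) D.proj)
    (hb : ∀ x, D.HorBijectiveAt x) (kQ : OneForm (𝓘(ℝ, EM).prod 𝓘(ℝ, EX)) (P.Assoc X)) :
    IsBasic (G := G) EG D.proj fun (z : Q × X)
      (w : TangentSpace (𝓘(ℝ, EQ).prod 𝓘(ℝ, ES)) ((z.1, D.proj z.2) : Q × S)) =>
      (assocFamily Φ D hG).toBase kQ (P.assocMk z) (P.assocDeriv (z.1, D.proj z.2) w) := by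
  constructor
  · intro z v
    obtain ⟨L, hL⟩ :=
      (assocFamily_horBijectiveAt (Φ := Φ) hG hπ (hb z.2)).exists_linear_horLift
    have hgen := P.assocMkDeriv_generator (EY := ES) v (z.1, D.proj z.2)
    exact (congrArg (kQ (P.assocMk z))
      ((hL _).trans ((congrArg L hgen).trans (map_zero L)))).trans (map_zero (kQ (P.assocMk z)))
  · intro z g w
    let act : EQ × ES →L[ℝ] EQ × ES :=
      modelDeriv (𝓘(ℝ, EQ).prod 𝓘(ℝ, ES)) (𝓘(ℝ, EQ).prod 𝓘(ℝ, ES))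
        (fun p : Q × S => ((op g • p.1, g⁻¹ • p.2) : Q × S)) (z.1, D.proj z.2)
    have hact : P.assocMkDeriv (EY := ES) (op g • z.1, g⁻¹ • D.proj z.2) (act w) =
        P.assocMkDeriv (EY := ES) (z.1, D.proj z.2) w :=
      (congrArg (P.assocMkDeriv (EY := ES) (op g • z.1, g⁻¹ • D.proj z.2))
        (DFunLike.congr_fun (P.modelDeriv_act (EY := ES) g (z.1, D.proj z.2)) w)).trans
        (P.assocMkDeriv_act (EY := ES) g (z.1, D.proj z.2) w)
    have htransport (y : P.Assoc X) (s : S) (hy : y = P.assocMk z) (hs : s = g⁻¹ • D.proj z.2) :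
        (assocFamily Φ D hG).toBase kQ y (P.assocMkDeriv (EY := ES) (op g • z.1, s) (act w)) =
          (assocFamily Φ D hG).toBase kQ (P.assocMk z)
            (P.assocMkDeriv (EY := ES) (z.1, D.proj z.2) w) := by
      subst hy hs
      exact congrArg (fun u : EM × ES => (assocFamily Φ D hG).toBase kQ (P.assocMk z) u) hact
    exact htransport _ _ (P.assocMk_act g z) (hG.proj_smul g⁻¹ z.2)

variable [IsManifold 𝓘(ℝ, EQ) ∞ Q] [IsManifold 𝓘(ℝ, EM) ∞ M] [IsManifold 𝓘(ℝ, EX) ∞ X]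
    [FiniteDimensional ℝ EX] {k : OneForm 𝓘(ℝ, EX) X}
    {kQ : OneForm (𝓘(ℝ, EM).prod 𝓘(ℝ, EX)) (P.Assoc X)}
    (hD : D.IsMetricFamily n) (hν : D.IsVolumeForm ν) (hk : D.IsMeanCurvature ν k)
    (hνQ : (assocFamily Φ D hG).IsVolumeForm νQ)
    (hkQ : (assocFamily Φ D hG).IsMeanCurvature νQ kQ)

include hD hν hk hνQ hkQ

theorem meanCurvature_assocMkDeriv (z : Q × X) {a : EQ} (ha : Φ.modelForm z.1 a = 0) (h : EX) :
    kQ (P.assocMk z) (P.assocMkDeriv z (a, h)) = k z.2 h := by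
  have hπ : MDifferentiable 𝓘(ℝ, EX) 𝓘(ℝ, ES) D.proj := hD.contMDiff_proj.mdifferentiable (by simp)
  obtain ⟨e, he⟩ := hD.exists_orthonormal_basis z.2
  obtain ⟨c, hsign, hc⟩ := exists_isHorPullback_volumeForm hG hD hν hνQ
  let v : Fin n → EX := fun i => (e i).1
  have hv : ν.val z.2 v ≠ 0 := hν.apply_ne_zero he
  have hc_ne : c z ≠ 0 := by
    rcases hsign z with h | h <;> rw [h]
    exacts [one_ne_zero, neg_ne_zero.2 one_ne_zero]
  have hdX : ν.d.val z.2 (Fin.cons h v) = k z.2 h * ν.val z.2 v :=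
    hk.d_cons (fun e he u => (hD.horBijectiveAt z.2).frobenius_eq_zero he
      (hD.vertProj_fderiv_vertProjInChart he) u) (hD.metric_zero z.2) he h
  have hdQ : νQ.d.val (P.assocMk z) (Fin.cons (P.assocMkDeriv z (a, h))
      fun i => P.assocMkDeriv z ((0, v i) : EQ × EX)) =
      kQ (P.assocMk z) (P.assocMkDeriv z (a, h)) *
        νQ.val (P.assocMk z) fun i => P.assocMkDeriv z ((0, v i) : EQ × EX) :=
    hkQ.d_cons (fun _ he u => assocFamily_frobenius_eq_zero hG hD _ he u)
      (assocFamily_metric_zero hG hD z) (isOrthonormal_assocVert hG hπ he) _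
  rw [hc z (fun _ => 0) v fun _ => map_zero _,
    hc.d_cons hsign hν.smooth hνQ.smooth hv ha h, hdX, mul_left_comm] at hdQ
  exact (mul_right_cancel₀ (mul_ne_zero hc_ne hv) hdQ).symm

variable {ι : Type*} [Fintype ι] (e : Module.Basis ι ℝ (GroupLieAlgebra 𝓘(ℝ, EG) G))

theorem meanCurvature_eq_subContract (z : Q × X)
    (w : TangentSpace (𝓘(ℝ, EQ).prod 𝓘(ℝ, EX)) z) :
    kQ (P.assocMk z) (P.assocDeriv z w) =
      Φ.subContract e z
        (fun w => k z.2 (mfderiv (𝓘(ℝ, EQ).prod 𝓘(ℝ, EX)) 𝓘(ℝ, EX) Prod.snd z w)) w :=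
  calc kQ (P.assocMk z) (P.assocDeriv z w)
      = kQ (P.assocMk z) (P.assocMkDeriv z (Φ.horPart (EY := EX) z w)) :=
        congrArg (kQ (P.assocMk z)) (Φ.assocMkDeriv_horPart (EY := EX) z w).symm
    _ = k z.2 (Φ.horPart (EY := EX) z w).2 :=
        meanCurvature_assocMkDeriv hD hν hk hνQ hkQ z (Φ.modelForm_horPart_fst (EY := EX) z w) _
    _ = _ := (Φ.subContract_snd (EY := EX) e z (α := fun v : EX => k z.2 v)
        (k z.2).toLinearMap (fun _ => rfl) w).symm

theorem toBase_meanCurvature_eq_subContract (q : Q) (x : X)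
    (w : TangentSpace (𝓘(ℝ, EQ).prod 𝓘(ℝ, ES)) ((q, D.proj x) : Q × S)) :
    (assocFamily Φ D hG).toBase kQ (P.assocMk (q, x)) (P.assocDeriv (q, D.proj x) w) =
      Φ.subContract e (q, D.proj x)
        (fun w => D.toBase k x (mfderiv (𝓘(ℝ, EQ).prod 𝓘(ℝ, ES)) 𝓘(ℝ, ES) Prod.snd
          ((q, D.proj x) : Q × S) w)) w := by
  have hπ : MDifferentiable 𝓘(ℝ, EX) 𝓘(ℝ, ES) D.proj := hD.contMDiff_proj.mdifferentiable (by simp)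
  have hb := hD.horBijectiveAt x
  obtain ⟨L, hL⟩ := hb.exists_linear_horLift
  let u : EQ × ES := Φ.horPart (EY := ES) (q, D.proj x) w
  have hu : Φ.modelForm q u.1 = 0 := Φ.modelForm_horPart_fst (EY := ES) (q, D.proj x) w
  have hmem : P.assocMkDeriv (EY := EX) (q, x) (u.1, L u.2) ∈
      (assocFamily Φ D hG).hor (P.assocMk (q, x)) :=
    (mem_assocFamily_hor hG).2 ⟨(u.1, L u.2), hu, hL u.2 ▸ FamilyData.horLift_mem x u.2, rfl⟩
  have hproj : modelDeriv 𝓘(ℝ, EX) 𝓘(ℝ, ES) D.proj x (L u.2) = u.2 :=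
    (congrArg (modelDeriv 𝓘(ℝ, EX) 𝓘(ℝ, ES) D.proj x) (hL u.2).symm).trans
      (hb.modelDeriv_proj_horLift u.2)
  have hlift : ((assocFamily Φ D hG).horLift (P.assocMk (q, x)) (P.assocDeriv (q, D.proj x) w) :
      EM × EX) = P.assocMkDeriv (EY := EX) (q, x) (u.1, L u.2) := by
    refine (assocFamily_horBijectiveAt hG hπ hb).horLift_eq hmem ?_
    refine (modelDeriv_assocFamily_proj hG hπ (q, x) (u.1, L u.2)).trans ?_
    rw [hproj]
    exact Φ.assocMkDeriv_horPart (EY := ES) (q, D.proj x) w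
  calc kQ (P.assocMk (q, x))
        ((assocFamily Φ D hG).horLift (P.assocMk (q, x)) (P.assocDeriv (q, D.proj x) w))
      = kQ (P.assocMk (q, x)) (P.assocMkDeriv (EY := EX) (q, x) (u.1, L u.2)) :=
        congrArg (kQ (P.assocMk (q, x))) hlift
    _ = k x (L u.2) := meanCurvature_assocMkDeriv hD hν hk hνQ hkQ (q, x) hu _
    _ = _ := (Φ.subContract_snd e (q, D.proj x) ((k x).toLinearMap ∘ₗ L)
        (fun v => congrArg (k x) (hL v)) w).symm

end MeanCurvature

end PrincipalBundle

end Families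

theorem mainTheorem5_general
    {EG EQ EM EX ES G Q M X S : Type*}
    [NormedAddCommGroup EG] [NormedSpace ℝ EG] [NormedAddCommGroup EQ] [NormedSpace ℝ EQ]
    [NormedAddCommGroup EM] [NormedSpace ℝ EM]
    [NormedAddCommGroup EX] [NormedSpace ℝ EX] [FiniteDimensional ℝ EX]
    [NormedAddCommGroup ES] [NormedSpace ℝ ES]
    [Group G] [TopologicalSpace G] [ChartedSpace EG G] [LieGroup 𝓘(ℝ, EG) ∞ G]
    [TopologicalSpace Q] [ChartedSpace EQ Q] [IsManifold 𝓘(ℝ, EQ) ∞ Q]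
    [TopologicalSpace M] [ChartedSpace EM M] [IsManifold 𝓘(ℝ, EM) ∞ M]
    [TopologicalSpace X] [ChartedSpace EX X] [IsManifold 𝓘(ℝ, EX) ∞ X]
    [TopologicalSpace S] [ChartedSpace ES S]
    [MulAction G X] [ContinuousSMul G X] [ContMDiffSMul 𝓘(ℝ, EG) 𝓘(ℝ, EX) ∞ G X]
    [MulAction G S] [ContinuousSMul G S] [ContMDiffSMul 𝓘(ℝ, EG) 𝓘(ℝ, ES) ∞ G S]
    [MulAction Gᵐᵒᵖ Q] (P : Families.PrincipalBundle EG EQ EM G Q M) (Φ : P.Connection)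
    {ι : Type*} [Fintype ι] (e : Module.Basis ι ℝ (GroupLieAlgebra 𝓘(ℝ, EG) G))
    {n : ℕ} (D : Families.FamilyData 𝓘(ℝ, EX) 𝓘(ℝ, ES) X S) (hD : D.IsMetricFamily n)
    (hG : D.IsInvariant G)
    (ν : Families.Form 𝓘(ℝ, EX) X n) (hν : D.IsVolumeForm ν)
    (k : Families.OneForm 𝓘(ℝ, EX) X) (hk : D.IsMeanCurvature ν k)
    (νQ : Families.Form (𝓘(ℝ, EM).prod 𝓘(ℝ, EX)) (P.Assoc X) n)
    (hνQ : (Families.PrincipalBundle.assocFamily Φ D hG).IsVolumeForm νQ)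
    (kQ : Families.OneForm (𝓘(ℝ, EM).prod 𝓘(ℝ, EX)) (P.Assoc X))
    (hkQ : (Families.PrincipalBundle.assocFamily Φ D hG).IsMeanCurvature νQ kQ) :
    (∀ (q : Q) (x : X) (w : TangentSpace (𝓘(ℝ, EQ).prod 𝓘(ℝ, ES)) ((q, D.proj x) : Q × S)),
      (Families.PrincipalBundle.assocFamily Φ D hG).toBase kQ (P.assocMk (q, x))
          (P.assocDeriv (q, D.proj x) w) =
        Φ.subContract e (q, D.proj x)
          (fun w => D.toBase k x (mfderiv (𝓘(ℝ, EQ).prod 𝓘(ℝ, ES)) 𝓘(ℝ, ES) Prod.snd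
            ((q, D.proj x) : Q × S) w)) w) ∧
    Families.PrincipalBundle.IsBasic (G := G) EG D.proj (fun z : Q × X =>
      Φ.subContract e ((z.1, D.proj z.2) : Q × S)
        (fun w => D.toBase k z.2 (mfderiv (𝓘(ℝ, EQ).prod 𝓘(ℝ, ES)) 𝓘(ℝ, ES) Prod.snd
          ((z.1, D.proj z.2) : Q × S) w))) ∧
    (∀ (z : Q × X) (w : TangentSpace (𝓘(ℝ, EQ).prod 𝓘(ℝ, EX)) z),
      kQ (P.assocMk z) (P.assocDeriv z w) =
        Φ.subContract e z
          (fun w => k z.2 (mfderiv (𝓘(ℝ, EQ).prod 𝓘(ℝ, EX)) 𝓘(ℝ, EX) Prod.snd z w)) w) := by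
  have hbase := Families.PrincipalBundle.toBase_meanCurvature_eq_subContract hD hν hk hνQ hkQ e
  have hbasic := Families.PrincipalBundle.isBasic_toBase (hG := hG) (Φ := Φ)
    (hD.contMDiff_proj.mdifferentiable (by simp)) hD.horBijectiveAt kQ
  exact ⟨hbase,
    (congrArg (Families.PrincipalBundle.IsBasic (G := G) EG D.proj)
      (funext fun z : Q × X => funext (hbase z.1 z.2))).mp hbasic,
    Families.PrincipalBundle.meanCurvature_eq_subContract hD hν hk hνQ hkQ e⟩

theorem mainTheorem5
    {EG EQ EM EX ES G Q M X S F : Type*}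
    [NormedAddCommGroup EG] [NormedSpace ℝ EG] [FiniteDimensional ℝ EG]
    [NormedAddCommGroup EQ] [NormedSpace ℝ EQ] [FiniteDimensional ℝ EQ]
    [NormedAddCommGroup EM] [NormedSpace ℝ EM] [FiniteDimensional ℝ EM]
    [NormedAddCommGroup EX] [NormedSpace ℝ EX] [FiniteDimensional ℝ EX]
    [NormedAddCommGroup ES] [NormedSpace ℝ ES] [FiniteDimensional ℝ ES]
    -- the Lie group `G`
    [Group G] [TopologicalSpace G] [ChartedSpace EG G] [LieGroup 𝓘(ℝ, EG) ∞ G]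
    -- the manifolds `Q`, `M`, `X`, `S`
    [TopologicalSpace Q] [ChartedSpace EQ Q] [IsManifold 𝓘(ℝ, EQ) ∞ Q]
    [TopologicalSpace M] [ChartedSpace EM M] [IsManifold 𝓘(ℝ, EM) ∞ M]
    [TopologicalSpace X] [ChartedSpace EX X] [IsManifold 𝓘(ℝ, EX) ∞ X]
    [TopologicalSpace S] [ChartedSpace ES S] [IsManifold 𝓘(ℝ, ES) ∞ S]
    -- the smooth actions of `G` on `X` and `S`
    [MulAction G X] [ContinuousSMul G X] [ContMDiffSMul 𝓘(ℝ, EG) 𝓘(ℝ, EX) ∞ G X]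
    [MulAction G S] [ContinuousSMul G S] [ContMDiffSMul 𝓘(ℝ, EG) 𝓘(ℝ, ES) ∞ G S]
    -- the principal bundle `Q → M` with its connection, and a basis of the Lie algebra
    [MulAction Gᵐᵒᵖ Q] (P : Families.PrincipalBundle EG EQ EM G Q M) (Φ : P.Connection)
    {ι : Type*} [Fintype ι] (e : Module.Basis ι ℝ (GroupLieAlgebra 𝓘(ℝ, EG) G))
    -- the geometric family `X → S`, with typical fibre `F`, preserved by `G`
    (n : ℕ) [TopologicalSpace F] [ChartedSpace (EuclideanSpace ℝ (Fin n)) F] [IsManifold (𝓡 n) ∞ F]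
    (D : Families.FamilyData 𝓘(ℝ, EX) 𝓘(ℝ, ES) X S) (hD : D.IsGeometricFamily n F)
    (hG : D.IsInvariant G)
    -- its `G`-invariant vertical volume form and its mean curvature form
    (ν : Families.Form 𝓘(ℝ, EX) X n) (hν : D.IsVolumeForm ν) (hνG : Families.Form.IsInvariant G ν)
    (k : Families.OneForm 𝓘(ℝ, EX) X) (hk : D.IsMeanCurvature ν k)
    -- the vertical volume form and the mean curvature form of `X_Q → S_Q`
    (νQ : Families.Form (𝓘(ℝ, EM).prod 𝓘(ℝ, EX)) (P.Assoc X) n)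
    (hνQ : (Families.PrincipalBundle.assocFamily Φ D hG).IsVolumeForm νQ)
    (kQ : Families.OneForm (𝓘(ℝ, EM).prod 𝓘(ℝ, EX)) (P.Assoc X))
    (hkQ : (Families.PrincipalBundle.assocFamily Φ D hG).IsMeanCurvature νQ kQ) :
    -- `k_Q = k - φᵃ ι_a k` as `1`-forms on `Q × S` with values in the functions on the fibres
    (∀ (q : Q) (x : X) (w : TangentSpace (𝓘(ℝ, EQ).prod 𝓘(ℝ, ES)) ((q, D.proj x) : Q × S)),
      (Families.PrincipalBundle.assocFamily Φ D hG).toBase kQ (P.assocMk (q, x))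
          (P.assocDeriv (q, D.proj x) w) =
        Φ.subContract e (q, D.proj x)
          (fun w => D.toBase k x (mfderiv (𝓘(ℝ, EQ).prod 𝓘(ℝ, ES)) 𝓘(ℝ, ES) Prod.snd
            ((q, D.proj x) : Q × S) w)) w) ∧
    -- the right-hand side is basic
    Families.PrincipalBundle.IsBasic (G := G) EG D.proj (fun z : Q × X =>
      Φ.subContract e ((z.1, D.proj z.2) : Q × S)
        (fun w => D.toBase k z.2 (mfderiv (𝓘(ℝ, EQ).prod 𝓘(ℝ, ES)) 𝓘(ℝ, ES) Prod.snd
          ((z.1, D.proj z.2) : Q × S) w))) ∧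
    -- `k_Q = k - φᵃ ι_a k` as `1`-forms on `Q × X`
    (∀ (z : Q × X) (w : TangentSpace (𝓘(ℝ, EQ).prod 𝓘(ℝ, EX)) z),
      kQ (P.assocMk z) (P.assocDeriv z w) =
        Φ.subContract e z
          (fun w => k z.2 (mfderiv (𝓘(ℝ, EQ).prod 𝓘(ℝ, EX)) 𝓘(ℝ, EX) Prod.snd z w)) w) :=
  mainTheorem5_general P Φ e D hD.isMetricFamily hG ν hν k hk νQ hνQ kQ hkQ
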